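/- Let $n,p\ge 1$. A depth-$p$ QAOA instance on $n$ qubits consists of a cost function $C=\sum_{i=1}^m C_i$ on $\{0,1\}^n$, given as a sum of $m$ real-valued terms each depending on at most two variables, and of angles $\gamma,\beta\in\mathbf{R}^p$. Its output distribution is $$\Pr[z]=\bigl|\langle z|\,e^{-i\beta_pB}e^{-i\gamma_pC}\cdots e^{-i\beta_1B}e^{-i\gamma_1C}\,|+\rangle^{\otimes n}\bigr|^2,\qquad z\in\{0,1\}^n,\quad B=\sum_{j=1}^nX_j,$$ where $C$ acts as the diagonal operator $C|z\rangle=C(z)|z\rangle$. Its interaction graph is the simple graph on $[n]$ in which $j\ne k$ are adjacent if some term $C_i$ depends nontrivially on both variables $j$ and $k$ (flipping either bit can change the value of $C_i$); the interaction degree is the maximum degree of this graph. Running times are worst-case over the random choices and count elementary steps: arithmetic operations and equality tests on exact complex numbers, elementary operations on natural numbers and lists, and draws of a random bit whose bias is a computed number each cost one step. The circuit is given to the algorithm by $n$, $p$, and for every term the two variables it acts on together with the diagonal entries of its gates $e^{-i\gamma_kC_i}$, and the entries $\cos\beta_k$, $-i\sin\beta_k$ of the one-qubit mixer gates. Then there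 is a single classical randomized algorithm that, given the circuit of any QAOA instance of interaction degree at most $2$, outputs a string $z\in\{0,1\}^n$ distributed exactly according to the output distribution. Its running time is at most $(m+1)\,(np)^{O(1)}\exp(O(p))$ with absolute constants; in particular it is $(np)^{O(1)}\exp(O(p))$ for decompositions with $m=n^{O(1)}$ terms (for example, at most one term for each set of at most two variables). When moreover $p=O(\log n)$, the running time is $n^{O(1)}$. -/

import Mathlib

open scoped Matrix NNReal ENNReal

/-! ### QAOA instances and their output probabilities -/

/-- A term of a cost function on `n` bits that depends on at most two variables:
`x ↦ table (x fst) (x snd)`.  Terms in one variable (and constants) are included; `fst = snd`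
is allowed. -/
structure LocalTerm (n : ℕ) where
  fst : Fin n
  snd : Fin n
  table : Bool → Bool → ℝ

/-- The function on bit strings given by a term. -/
def LocalTerm.val {n : ℕ} (t : LocalTerm n) (x : Fin n → Bool) : ℝ :=
  t.table (x t.fst) (x t.snd)

/-- `x` with bit `j` flipped. -/
def flipBit {n : ℕ} (j : Fin n) (x : Fin n → Bool) : Fin n → Bool :=
  Function.update x j (!(x j))

/-- `f` depends nontrivially on variable `j`: flipping bit `j` can change the value. -/
def DependsOnVar {n : ℕ} (f : (Fin n → Bool) → ℝ) (j : Fin n) : Prop :=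
  ∃ x, f (flipBit j x) ≠ f x

/-- A depth-`p` QAOA instance on `n` qubits: a decomposition of the cost function into 2-local
terms, and the angles of the `p` layers. -/
structure QAOA (n p : ℕ) where
  terms : List (LocalTerm n)
  γ : Fin p → ℝ
  β : Fin p → ℝ

namespace QAOA

variable {n p : ℕ}

/-- The interaction graph of the decomposition. -/
def interactionGraph (Q : QAOA n p) : SimpleGraph (Fin n) where
  Adj j k := j ≠ k ∧ ∃ t ∈ Q.terms, DependsOnVar t.val j ∧ DependsOnVar t.val k
  symm := ⟨fun _ _ ⟨h, t, ht, hj, hk⟩ => ⟨h.symm, t, ht, hk, hj⟩⟩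
  loopless := ⟨fun _ h => h.1 rfl⟩

open Classical in
/-- The maximum vertex degree of the interaction graph. -/
noncomputable def interactionDegree (Q : QAOA n p) : ℕ :=
  Q.interactionGraph.maxDegree

/-- The cost function `C = ∑ C_i`. -/
def cost (Q : QAOA n p) (x : Fin n → Bool) : ℝ :=
  (Q.terms.map fun t => t.val x).sum

/-- The Pauli operator `X_j` on `n` qubits. -/
def pauliX (j : Fin n) : Matrix (Fin n → Bool) (Fin n → Bool) ℂ :=
  Matrix.of fun x y => if x = flipBit j y then 1 else 0

/-- The mixing operator `B = ∑_j X_j`. -/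
def mixingOp (n : ℕ) : Matrix (Fin n → Bool) (Fin n → Bool) ℂ :=
  ∑ j : Fin n, pauliX j

/-- The cost function as a diagonal operator. -/
noncomputable def costOp (Q : QAOA n p) : Matrix (Fin n → Bool) (Fin n → Bool) ℂ :=
  Matrix.diagonal fun x => (Q.cost x : ℂ)

/-- The `k`-th layer `exp(-i β_k B) exp(-i γ_k C)`. -/
noncomputable def layer (Q : QAOA n p) (k : Fin p) :
    Matrix (Fin n → Bool) (Fin n → Bool) ℂ :=
  NormedSpace.exp ((-Complex.I * (Q.β k : ℂ)) • mixingOp n) *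
    NormedSpace.exp ((-Complex.I * (Q.γ k : ℂ)) • Q.costOp)

/-- The state `|+⟩^{⊗ n}`. -/
noncomputable def plusState (n : ℕ) : (Fin n → Bool) → ℂ :=
  fun _ => (1 / (Real.sqrt 2 : ℂ)) ^ n

/-- The depth-`p` QAOA state; the layer with the smallest index acts first. -/
noncomputable def state (Q : QAOA n p) : (Fin n → Bool) → ℂ :=
  Fin.foldl p (fun ψ k => Q.layer k *ᵥ ψ) (plusState n)

/-- The probability that measuring the QAOA state in the computational basis yields `z`. -/
noncomputable def outputProb (Q : QAOA n p) (z : Fin n → Bool) : ℝ :=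
  ‖Q.state z‖ ^ 2

end QAOA

/-! ### Randomized algorithms that count arithmetic operations

Algorithms are programs of a small first-order functional language over booleans, natural numbers,
exact complex scalars, pairs and (immutable, linked) lists.  A program is a finite object that
contains no scalar constants except `0` and `1`.  Every elementary operation costs one step:
arithmetic on scalars, a scalar equality test, a successor, predecessor or comparison of natural
numbers, building or inspecting a pair or a list cell, a branch, a loop iteration, and the draw of
one random bit whose bias is a computed scalar. -/

/-- Data types of the language. -/
inductive Ty : Type
  | unit : Ty
  | bool : Ty
  | nat : Ty
  | scalar : Ty
  | prod : Ty → Ty → Ty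
  | list : Ty → Ty

/-- The values of a data type. -/
@[reducible] def Ty.Val : Ty → Type
  | .unit => Unit
  | .bool => Bool
  | .nat => ℕ
  | .scalar => ℂ
  | .prod a b => a.Val × b.Val
  | .list a => List a.Val

/-- Programs with input of type `a` and output of type `b`. -/
inductive Prog : Ty → Ty → Type
  | id {a : Ty} : Prog a a
  | comp {a b c : Ty} (g : Prog b c) (f : Prog a b) : Prog a c
  | star {a : Ty} : Prog a .unit
  | pair {a b c : Ty} (f : Prog a b) (g : Prog a c) : Prog a (.prod b c)
  | fst {a b : Ty} : Prog (.prod a b) a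
  | snd {a b : Ty} : Prog (.prod a b) b
  | boolConst {a : Ty} (v : Bool) : Prog a .bool
  | cond {a b : Ty} (c : Prog a .bool) (f g : Prog a b) : Prog a b
  | natZero {a : Ty} : Prog a .nat
  | natSucc : Prog .nat .nat
  | natPred : Prog .nat .nat
  | natEq : Prog (.prod .nat .nat) .bool
  | natLt : Prog (.prod .nat .nat) .bool
  | zero {a : Ty} : Prog a .scalar
  | one {a : Ty} : Prog a .scalar
  | add : Prog (.prod .scalar .scalar) .scalar
  | sub : Prog (.prod .scalar .scalar) .scalar
  | mul : Prog (.prod .scalar .scalar) .scalar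
  | div : Prog (.prod .scalar .scalar) .scalar
  | conj : Prog .scalar .scalar
  | scalarEq : Prog (.prod .scalar .scalar) .bool
  | nil {a b : Ty} : Prog a (.list b)
  | cons {a : Ty} : Prog (.prod a (.list a)) (.list a)
  /-- Case distinction on a list: empty, or a head and a tail. -/
  | listCase {c a b : Ty} (f : Prog c b) (g : Prog (.prod c (.prod a (.list a))) b) :
      Prog (.prod c (.list a)) b
  /-- Loop over the entries of a list, first entry first, updating a state `s`;
  `c` is a read-only context. -/
  | fold {c s a : Ty} (f : Prog (.prod c (.prod s a)) s) : Prog (.prod c (.prod s (.list a))) s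
  /-- Repeat the body a given number of times, updating a state `s`. -/
  | iter {c s : Ty} (f : Prog (.prod c s) s) : Prog (.prod c (.prod s .nat)) s
  /-- Draw a random bit that is `true` with probability equal to the argument. -/
  | flip : Prog .scalar .bool

/-- A random bit that is `true` with probability `q` (cut off to `[0, 1]`). -/
noncomputable def coin (q : ℝ) : PMF Bool :=
  PMF.ofFintype (fun b => if b then ((min q.toNNReal 1 : ℝ≥0) : ℝ≥0∞)
      else ((1 - min q.toNNReal 1 : ℝ≥0) : ℝ≥0∞)) (by
    rw [Fintype.sum_bool, if_pos rfl, if_neg Bool.false_ne_true, ← ENNReal.coe_add,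
      add_tsub_cancel_of_le (min_le_right _ _), ENNReal.coe_one])

namespace Prog

/-- The joint law of the final state and the number of steps of a loop over a list. -/
noncomputable def foldRun {σ α : Type} (step : σ → α → PMF (σ × ℕ)) :
    List α → σ → PMF (σ × ℕ)
  | [], s => PMF.pure (s, 0)
  | x :: l, s => (step s x).bind fun r =>
      (foldRun step l r.1).bind fun r' => PMF.pure (r'.1, r.2 + r'.2 + 1)

/-- The joint law of the final state and the number of steps of a counted loop. -/
noncomputable def iterRun {σ : Type} (step : σ → PMF (σ × ℕ)) : ℕ → σ → PMF (σ × ℕ)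
  | 0, s => PMF.pure (s, 0)
  | k + 1, s => (step s).bind fun r =>
      (iterRun step k r.1).bind fun r' => PMF.pure (r'.1, r.2 + r'.2 + 1)

open Classical in
/-- The joint law of the output and the number of steps of a program on a given input. -/
noncomputable def run : {a b : Ty} → Prog a b → a.Val → PMF (b.Val × ℕ)
  | _, _, .id, x => PMF.pure (x, 1)
  | _, _, .comp g f, x => (f.run x).bind fun r =>
      (g.run r.1).bind fun r' => PMF.pure (r'.1, r.2 + r'.2 + 1)
  | _, _, .star, _ => PMF.pure ((), 1)
  | _, _, .pair f g, x => (f.run x).bind fun r =>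
      (g.run x).bind fun r' => PMF.pure ((r.1, r'.1), r.2 + r'.2 + 1)
  | _, _, .fst, x => PMF.pure (x.1, 1)
  | _, _, .snd, x => PMF.pure (x.2, 1)
  | _, _, .boolConst v, _ => PMF.pure (v, 1)
  | _, _, .cond c f g, x => (c.run x).bind fun r =>
      (if r.1 = true then f.run x else g.run x).bind fun r' =>
        PMF.pure (r'.1, r.2 + r'.2 + 1)
  | _, _, .natZero, _ => PMF.pure ((0 : ℕ), 1)
  | _, _, .natSucc, x => PMF.pure (Nat.succ x, 1)
  | _, _, .natPred, x => PMF.pure (Nat.pred x, 1)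
  | _, _, .natEq, x => PMF.pure (decide (x.1 = x.2), 1)
  | _, _, .natLt, x => PMF.pure (decide (x.1 < x.2), 1)
  | _, _, .zero, _ => PMF.pure ((0 : ℂ), 1)
  | _, _, .one, _ => PMF.pure ((1 : ℂ), 1)
  | _, _, .add, x => PMF.pure (x.1 + x.2, 1)
  | _, _, .sub, x => PMF.pure (x.1 - x.2, 1)
  | _, _, .mul, x => PMF.pure (x.1 * x.2, 1)
  | _, _, .div, x => PMF.pure (x.1 / x.2, 1)
  | _, _, .conj, x => PMF.pure (starRingEnd ℂ x, 1)
  | _, _, .scalarEq, x => PMF.pure (decide (x.1 = x.2), 1)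
  | _, _, .nil, _ => PMF.pure ([], 1)
  | _, _, .cons, x => PMF.pure (x.1 :: x.2, 1)
  | _, _, .listCase f g, x =>
      (match x.2 with
        | [] => f.run x.1
        | y :: l => g.run (x.1, (y, l))).bind fun r => PMF.pure (r.1, r.2 + 1)
  | _, _, .fold f, x =>
      (foldRun (fun s y => f.run (x.1, (s, y))) x.2.2 x.2.1).bind fun r =>
        PMF.pure (r.1, r.2 + 1)
  | _, _, .iter f, x =>
      (iterRun (fun s => f.run (x.1, s)) x.2.2 x.2.1).bind fun r =>
        PMF.pure (r.1, r.2 + 1)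
  | _, _, .flip, x => (coin (Complex.re x)).bind fun v => PMF.pure (v, 1)

end Prog

/-! ### QAOA circuits as inputs, and exact samplers -/

/-- Four scalars: the diagonal entries of a two-qubit diagonal gate. -/
abbrev gateTy : Ty := .prod (.prod .scalar .scalar) (.prod .scalar .scalar)

/-- The input format: the number of qubits; the depth; for each term, the two qubits it acts on and,
for each layer, the diagonal of its gate; for each layer, the two distinct entries of the
one-qubit mixer gate. -/
abbrev circuitTy : Ty :=
  .prod .nat (.prod .nat
    (.prod (.list (.prod (.prod .nat .nat) (.list gateTy))) (.list (.prod .scalar .scalar))))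

/-- The diagonal entries, in the order `00, 01, 10, 11`, of the gate `exp(-i γ C_i)` of a term. -/
noncomputable def LocalTerm.gate {n : ℕ} (t : LocalTerm n) (γ : ℝ) : gateTy.Val :=
  let e : Bool → Bool → ℂ := fun a b => Complex.exp (-Complex.I * (γ : ℂ) * (t.table a b : ℂ))
  ((e false false, e false true), (e true false, e true true))

/-- The circuit of a QAOA instance, given by its gate matrix entries.  The mixer gate
`exp(-i β X)` has diagonal entries `cos β` and off-diagonal entries `-i sin β`. -/
noncomputable def QAOA.circuit {n p : ℕ} (Q : QAOA n p) : circuitTy.Val :=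
  (n, (p,
    (Q.terms.map fun t =>
        (((t.fst : ℕ), (t.snd : ℕ)), List.ofFn fun k : Fin p => t.gate (Q.γ k)),
      List.ofFn fun k : Fin p =>
        ((Real.cos (Q.β k) : ℂ), -Complex.I * (Real.sin (Q.β k) : ℂ)))))

/-- On the circuit of `Q`, the output of the program is distributed exactly as the measurement
outcome `z_1 ⋯ z_n`. -/
def SamplesExactly (A : Prog circuitTy (.list .bool)) {n p : ℕ} (Q : QAOA n p) : Prop :=
  ∀ z : Fin n → Bool,
    ((A.run Q.circuit).map Prod.fst) (List.ofFn z) = ENNReal.ofReal (Q.outputProb z)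

/-- On the circuit of `Q`, the program stops after at most `T` steps, whatever the random bits. -/
def RunsInTime (A : Prog circuitTy (.list .bool)) {n p : ℕ} (Q : QAOA n p) (T : ℝ) : Prop :=
  ∀ r ∈ (A.run Q.circuit).support, (r.2 : ℝ) ≤ T

/-! Expanding the squared amplitude gives a sum over pairs of computational paths, one through the
circuit and one through its conjugate, both ending in the measured string. At each qubit, record the
values of both paths at the times 0, …, p as a word of p + 1 letters, each a pair of bits. The mixer
is a tensor power, so its matrix entries contribute a weight at each single qubit. The cost gates
are diagonal, so a term contributes a weight at the words of its at most two qubits. Hence 2^n times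
an output probability is the partition function of a pairwise model with complex weights and 4^(p+1)
states per site, whose links all lie in the interaction graph (`QAOA.weight_factors`,
`QAOA.contract_conditioned`). Complex weights do no harm, since only exact sums are taken.

The partition function is computed by eliminating one variable at a time, in any order. With degree
at most 2, summing out v produces a single function of its at most two neighbours. A path a–v–b
becomes an edge a–b, so the model stays pairwise and its degree stays at most 2
(`Factor.DegreeLeTwo.elim`, `Factor.weight_elim`, `Factor.contract_eq`). Paths and cycles need not
be told apart.

Fixing a measured bit multiplies by a one-site factor, so the same contraction yields every marginal
of a block of final bits. The sampler draws the bits from the last to the first with their exact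
conditional probabilities; the quotients telescope to the output probability
(`QAOA.iterRun_drawBitP_apply`). Unitarity of the layers, in the form `QAOA.sum_outputProb`,
provides the total mass one.

For the running time, `Prog.CostBound` is a compositional calculus with two size parameters: N, of
order n·4^p, and M, one more than the number of terms. Loops over the list of factors or terms are
never nested in one another, so M enters only to the first power (`QAOA.exists_cost_le`). -/

namespace Prog

/-! ### Deterministic semantics: values and costs without probability -/

/-- The output of a program in which every random bit is `false`. -/
noncomputable def eval : {a b : Ty} → Prog a b → a.Val → b.Val
  | _, _, .id, x => x
  | _, _, .comp g f, x => g.eval (f.eval x)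
  | _, _, .star, _ => ()
  | _, _, .pair f g, x => (f.eval x, g.eval x)
  | _, _, .fst, x => x.1
  | _, _, .snd, x => x.2
  | _, _, .boolConst v, _ => v
  | _, _, .cond c f g, x => if @Eq Bool (c.eval x) true then f.eval x else g.eval x
  | _, _, .natZero, _ => (0 : ℕ)
  | _, _, .natSucc, x => Nat.succ x
  | _, _, .natPred, x => Nat.pred x
  | _, _, .natEq, x => decide (@Eq ℕ x.1 x.2)
  | _, _, .natLt, x => decide (x.1 < x.2)
  | _, _, .zero, _ => (0 : ℂ)
  | _, _, .one, _ => (1 : ℂ)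
  | _, _, .add, x => x.1 + x.2
  | _, _, .sub, x => x.1 - x.2
  | _, _, .mul, x => x.1 * x.2
  | _, _, .div, x => x.1 / x.2
  | _, _, .conj, x => starRingEnd ℂ x
  | _, _, .scalarEq, x => open Classical in decide (@Eq ℂ x.1 x.2)
  | _, _, .nil, _ => []
  | _, _, .cons, x => x.1 :: x.2
  | _, _, .listCase f g, x =>
      match x.2 with
        | [] => f.eval x.1
        | y :: l => g.eval (x.1, (y, l))
  | _, _, .fold f, x => x.2.2.foldl (fun s y => f.eval (x.1, (s, y))) x.2.1
  | _, _, .iter f, x => (fun s => f.eval (x.1, s))^[x.2.2] x.2.1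
  | _, _, .flip, _ => false

/-- The number of steps of a loop over a list whose body is deterministic. -/
def foldCost {σ α : Type} (step : σ → α → σ) (cost : σ → α → ℕ) : List α → σ → ℕ
  | [], _ => 0
  | x :: l, s => cost s x + foldCost step cost l (step s x) + 1

/-- The number of steps of a counted loop whose body is deterministic. -/
def iterCost {σ : Type} (step : σ → σ) (cost : σ → ℕ) : ℕ → σ → ℕ
  | 0, _ => 0
  | k + 1, s => cost s + iterCost step cost k (step s) + 1

/-- The number of steps of a program in which every random bit is `false`. -/
noncomputable def cost : {a b : Ty} → Prog a b → a.Val → ℕ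
  | _, _, .comp g f, x => f.cost x + g.cost (f.eval x) + 1
  | _, _, .pair f g, x => f.cost x + g.cost x + 1
  | _, _, .cond c f g, x => c.cost x + (if @Eq Bool (c.eval x) true then f.cost x else g.cost x) + 1
  | _, _, .listCase f g, x =>
      (match x.2 with
        | [] => f.cost x.1
        | y :: l => g.cost (x.1, (y, l))) + 1
  | _, _, .fold f, x =>
      foldCost (fun s y => f.eval (x.1, (s, y))) (fun s y => f.cost (x.1, (s, y))) x.2.2 x.2.1 + 1
  | _, _, .iter f, x =>
      iterCost (fun s => f.eval (x.1, s)) (fun s => f.cost (x.1, s)) x.2.2 x.2.1 + 1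
  | _, _, _, _ => 1

/-- A program that draws no random bits. -/
def det : {a b : Ty} → Prog a b → Bool
  | _, _, .comp g f => g.det && f.det
  | _, _, .pair f g => f.det && g.det
  | _, _, .cond c f g => c.det && f.det && g.det
  | _, _, .listCase f g => f.det && g.det
  | _, _, .fold f => f.det
  | _, _, .iter f => f.det
  | _, _, .flip => false
  | _, _, _ => true

theorem foldRun_pure {σ α : Type} (step : σ → α → σ) (cost : σ → α → ℕ) (l : List α) (s : σ) :
    foldRun (fun s y => PMF.pure (step s y, cost s y)) l s
      = PMF.pure (l.foldl step s, foldCost step cost l s) := by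
  induction l generalizing s with
  | nil => rfl
  | cons x l ih => simp only [foldRun, PMF.pure_bind, ih, List.foldl_cons, foldCost]

theorem iterRun_pure {σ : Type} (step : σ → σ) (cost : σ → ℕ) (k : ℕ) (s : σ) :
    iterRun (fun s => PMF.pure (step s, cost s)) k s
      = PMF.pure (step^[k] s, iterCost step cost k s) := by
  induction k generalizing s with
  | zero => rfl
  | succ k ih => simp only [iterRun, PMF.pure_bind, ih, Function.iterate_succ_apply, iterCost]

/-- All of the sampler except one `flip` is deterministic. This lemma moves that part out of `PMF`,
so that correctness concerns `eval` and running time concerns `cost`, separately. -/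
theorem run_eq_pure {a b : Ty} (f : Prog a b) (hf : f.det = true) (x : a.Val) :
    f.run x = PMF.pure (f.eval x, f.cost x) := by
  induction f with
  | comp g f ihg ihf =>
    simp only [det, Bool.and_eq_true] at hf
    simp only [run, ihf hf.2, ihg hf.1, PMF.pure_bind, eval, cost]
  | pair f g ihf ihg =>
    simp only [det, Bool.and_eq_true] at hf
    simp only [run, ihf hf.1, ihg hf.2, PMF.pure_bind, eval, cost]
  | cond c f g ihc ihf ihg =>
    simp only [det, Bool.and_eq_true] at hf
    simp only [run, ihc hf.1.1, ihf hf.1.2, ihg hf.2, PMF.pure_bind, eval, cost]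
    split <;> simp only [PMF.pure_bind]
  | listCase f g ihf ihg =>
    simp only [det, Bool.and_eq_true] at hf
    obtain ⟨c, l⟩ := x
    cases l <;> simp only [run, ihf hf.1, ihg hf.2, PMF.pure_bind, eval, cost]
  | fold f ih =>
    simp only [det] at hf
    simp only [run, ih hf, foldRun_pure, PMF.pure_bind, eval, cost]
  | iter f ih =>
    simp only [det] at hf
    simp only [run, ih hf, iterRun_pure, PMF.pure_bind, eval, cost]
  | flip => simp [det] at hf
  | _ => rfl

/-! ### Derived program constructs -/

variable {Γ a b s : Ty}

/-- Bind the value of `e` as a new last variable. -/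
def letIn (e : Prog Γ a) (f : Prog (.prod Γ a) b) : Prog Γ b := .comp f (.pair .id e)

def eqNat (f g : Prog Γ .nat) : Prog Γ .bool := .comp .natEq (.pair f g)

def eqScalar (f g : Prog Γ .scalar) : Prog Γ .bool := .comp .scalarEq (.pair f g)

def mulS (f g : Prog Γ .scalar) : Prog Γ .scalar := .comp .mul (.pair f g)

def consL (f : Prog Γ a) (g : Prog Γ (.list a)) : Prog Γ (.list a) := .comp .cons (.pair f g)

def andB (f g : Prog Γ .bool) : Prog Γ .bool := .cond f g (.boolConst false)

def orB (f g : Prog Γ .bool) : Prog Γ .bool := .cond f (.boolConst true) g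

def notB (f : Prog Γ .bool) : Prog Γ .bool := .cond f (.boolConst false) (.boolConst true)

/-- Equality of two bits. -/
def eqB (f g : Prog Γ .bool) : Prog Γ .bool := .cond f g (notB g)

/-- A loop over the list `l`, in a given context. -/
def foldIn (init : Prog Γ s) (l : Prog Γ (.list a)) (f : Prog (.prod Γ (.prod s a)) s) :
    Prog Γ s := .comp (.fold f) (.pair .id (.pair init l))

/-- A counted loop, in a given context. -/
def iterIn (init : Prog Γ s) (k : Prog Γ .nat) (f : Prog (.prod Γ s) s) : Prog Γ s :=
  .comp (.iter f) (.pair .id (.pair init k))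

def tailL : Prog (.list a) (.list a) :=
  .comp (.listCase .nil (.comp .snd .snd)) (.pair (.star) .id)

def headL (d : Prog .unit a) : Prog (.list a) a :=
  .comp (.listCase d (.comp .fst .snd)) (.pair (.star) .id)

/-- The `i`-th entry of the list `l`, with default value `d`. -/
def nth (d : Prog .unit a) (l : Prog Γ (.list a)) (i : Prog Γ .nat) : Prog Γ a :=
  .comp (headL d) (iterIn l i (.comp tailL .snd))

/-- The body of the loop of `tabulate`, which runs downwards. -/
def tabulateStep (f : Prog (.prod Γ .nat) a) :
    Prog (.prod Γ (.prod .nat (.list a))) (.prod .nat (.list a)) :=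
  letIn (.comp .natPred (.comp .fst .snd))
    (.pair .snd (consL (.comp f (.pair (.comp .fst .fst) .snd))
      (.comp .snd (.comp .snd .fst))))

/-- The list `f 0, …, f (k - 1)`. -/
def tabulate (k : Prog Γ .nat) (f : Prog (.prod Γ .nat) a) : Prog Γ (.list a) :=
  .comp .snd (iterIn (.pair k .nil) k (tabulateStep f))

def sumL : Prog (.list .scalar) .scalar := foldIn .zero .id (.comp .add .snd)

def prodL : Prog (.list .scalar) .scalar := foldIn .one .id (.comp .mul .snd)

@[simp] theorem eval_letIn (e : Prog Γ a) (f : Prog (.prod Γ a) b) (x : Γ.Val) :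
    (letIn e f).eval x = f.eval (x, e.eval x) := rfl

@[simp] theorem eval_eqNat_iff (f g : Prog Γ .nat) (x : Γ.Val) :
    @Eq Bool ((eqNat f g).eval x) true ↔ @Eq ℕ (f.eval x) (g.eval x) :=
  decide_eq_true_iff

@[simp] theorem eval_eqScalar_iff (f g : Prog Γ .scalar) (x : Γ.Val) :
    @Eq Bool ((eqScalar f g).eval x) true ↔ @Eq ℂ (f.eval x) (g.eval x) :=
  open Classical in decide_eq_true_iff

@[simp] theorem eval_mulS (f g : Prog Γ .scalar) (x : Γ.Val) :
    (mulS f g).eval x = (f.eval x * g.eval x : ℂ) := rfl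

@[simp] theorem eval_consL (f : Prog Γ a) (g : Prog Γ (.list a)) (x : Γ.Val) :
    (consL f g).eval x = f.eval x :: g.eval x := rfl

@[simp] theorem eval_andB_iff (f g : Prog Γ .bool) (x : Γ.Val) :
    @Eq Bool ((andB f g).eval x) true ↔ @Eq Bool (f.eval x) true ∧ @Eq Bool (g.eval x) true := by
  simp only [andB, eval]
  cases (f.eval x : Bool) <;> simp

@[simp] theorem eval_orB_iff (f g : Prog Γ .bool) (x : Γ.Val) :
    @Eq Bool ((orB f g).eval x) true ↔ @Eq Bool (f.eval x) true ∨ @Eq Bool (g.eval x) true := by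
  simp only [orB, eval]
  cases (f.eval x : Bool) <;> simp

@[simp] theorem eval_notB_iff (f : Prog Γ .bool) (x : Γ.Val) :
    @Eq Bool ((notB f).eval x) true ↔ ¬ @Eq Bool (f.eval x) true := by
  simp only [notB, eval]
  cases (f.eval x : Bool) <;> simp

@[simp] theorem eval_eqB (f g : Prog Γ .bool) (x : Γ.Val) :
    (eqB f g).eval x = @BEq.beq Bool _ (f.eval x) (g.eval x) := by
  simp only [eqB, notB, eval]
  cases (f.eval x : Bool) <;> cases (g.eval x : Bool) <;> rfl

@[simp] theorem eval_foldIn (init : Prog Γ s) (l : Prog Γ (.list a))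
    (f : Prog (.prod Γ (.prod s a)) s) (x : Γ.Val) :
    (foldIn init l f).eval x
      = List.foldl (fun t y => f.eval (x, (t, y))) (init.eval x) (l.eval x) := rfl

@[simp] theorem eval_iterIn (init : Prog Γ s) (k : Prog Γ .nat) (f : Prog (.prod Γ s) s)
    (x : Γ.Val) :
    (iterIn init k f).eval x = (fun t => f.eval (x, t))^[k.eval x] (init.eval x) := rfl

@[simp] theorem eval_tailL (l : List a.Val) : (tailL (a := a)).eval l = l.tail := by
  cases l <;> rfl

theorem eval_headL (d : Prog .unit a) (l : List a.Val) :
    (headL d).eval l = l.headD (d.eval ()) := by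
  cases l <;> rfl

@[simp] theorem eval_nth (d : Prog .unit a) (l : Prog Γ (.list a)) (i : Prog Γ .nat) (x : Γ.Val) :
    (nth d l i).eval x = List.getD (l.eval x) (i.eval x) (d.eval ()) := by
  have h : ∀ (k : ℕ) (l : List a.Val), (fun t : List a.Val => t.tail)^[k] l = l.drop k := by
    intro k
    induction k with
    | zero => intro l; rfl
    | succ k ih => intro l; rw [Function.iterate_succ_apply, ih]; cases l <;> simp
  change (headL d).eval ((fun t => tailL.eval t)^[i.eval x] (l.eval x)) = _
  simp only [eval_tailL, h, eval_headL]
  rw [List.headD_eq_head?_getD, List.head?_drop, List.getD_eq_getElem?_getD]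

@[simp] theorem eval_tabulate (k : Prog Γ .nat) (f : Prog (.prod Γ .nat) a) (x : Γ.Val) :
    (tabulate k f).eval x = (List.range (k.eval x)).map (fun i => f.eval (x, i)) := by
  -- The counter is decreased before use, so the entries j - 1, …, 0 are prepended in this order and
  -- the list comes out ascending. The induction needs an arbitrary list already built.
  have h : ∀ (j : ℕ) (l : List a.Val),
      ((fun t : ℕ × List a.Val => (t.1.pred, f.eval (x, t.1.pred) :: t.2))^[j] (j, l))
        = (0, (List.range j).map (fun i => f.eval (x, i)) ++ l) := by
    intro j
    induction j with
    | zero => intro l; rfl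
    | succ j ih =>
      intro l
      rw [Function.iterate_succ_apply]
      simp only [Nat.pred_succ, ih, List.range_succ, List.map_append, List.map_cons, List.map_nil,
        List.append_assoc, List.singleton_append]
  change ((fun t : ℕ × List a.Val => (t.1.pred, f.eval (x, t.1.pred) :: t.2))^[k.eval x]
    (k.eval x, [])).2 = _
  rw [h, List.append_nil]

@[simp] theorem eval_sumL (l : List ℂ) : sumL.eval l = l.sum := by
  rw [List.sum_eq_foldl]; rfl

@[simp] theorem eval_prodL (l : List ℂ) : prodL.eval l = l.prod := by
  rw [List.prod_eq_foldl]; rfl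

end Prog

/-! ### A compositional calculus of running times -/

namespace Prog

theorem foldCost_le {σ α : Type} (step : σ → α → σ) (cost : σ → α → ℕ) (B : ℕ)
    (h : ∀ s y, cost s y ≤ B) (l : List α) (s : σ) :
    foldCost step cost l s ≤ l.length * (B + 1) := by
  induction l generalizing s with
  | nil => simp [foldCost]
  | cons x l ih =>
    have h1 := ih (step s x)
    have h2 := h s x
    simp only [foldCost, List.length_cons, add_mul]
    omega

/-- Unlike `foldCost_le`, this asks for a bound only on the states actually reached. The cost of an
elimination depends on the length of the current factor list, which is controlled only along the
orbit. -/
theorem iterCost_le {σ : Type} (step : σ → σ) (cost : σ → ℕ) (B k : ℕ) (s : σ)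
    (h : ∀ j < k, cost (step^[j] s) ≤ B) : iterCost step cost k s ≤ k * (B + 1) := by
  induction k generalizing s with
  | zero => simp [iterCost]
  | succ k ih =>
    have h1 := ih (step s) fun j hj => h (j + 1) (by omega)
    have h2 := h 0 (by omega)
    simp only [Function.iterate_zero, id_eq] at h2
    simp only [iterCost, add_mul]
    omega

variable {Γ a b s : Ty}

/-- On inputs `x` with `P N M x`, the program runs in time `M ^ e` times a polynomial in `N`.  Here
`N` and `M` are bounds for the size of the input. -/
def CostBound (e : ℕ) (P : ℕ → ℕ → Γ.Val → Prop) (f : Prog Γ a) : Prop :=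
  ∃ k : ℕ, ∀ (N M : ℕ) (x : Γ.Val), 2 ≤ N → 1 ≤ M → P N M x → f.cost x ≤ M ^ e * N ^ k

theorem polyBound_mono {e e' N M k k' c : ℕ} (hN : 2 ≤ N) (hM : 1 ≤ M) (he : e ≤ e')
    (hk : k ≤ k') (hc : c ≤ M ^ e * N ^ k) : c ≤ M ^ e' * N ^ k' :=
  hc.trans (Nat.mul_le_mul (Nat.pow_le_pow_right hM he) (Nat.pow_le_pow_right (by omega) hk))

theorem polyBound_pos {N M : ℕ} (e k : ℕ) (hN : 2 ≤ N) (hM : 1 ≤ M) : 1 ≤ M ^ e * N ^ k :=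
  Nat.mul_pos (Nat.pow_pos hM) (Nat.pow_pos (by omega))

/-- Three quantities, each at most M^e · N^(k+l), are absorbed by N^2 ≥ 4. This is the reason for
requiring N ≥ 2: bounds stay of the form M^e · N^k, with no constant in front. -/
theorem polyBound_add {e N M k l c d : ℕ} (hN : 2 ≤ N) (hM : 1 ≤ M)
    (hc : c ≤ M ^ e * N ^ k) (hd : d ≤ M ^ e * N ^ l) : c + d + 1 ≤ M ^ e * N ^ (k + l + 2) := by
  have h1 := polyBound_mono hN hM le_rfl (Nat.le_add_right k l) hc
  have h2 := polyBound_mono hN hM le_rfl (Nat.le_add_left l k) hd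
  have h3 := polyBound_pos e (k + l) hN hM
  have h4 : 4 ≤ N ^ 2 := by nlinarith
  rw [pow_add, ← mul_assoc]
  nlinarith

/-- The exponents of M add. For a final bound linear in M, a loop of length up to M · N must have a
body whose cost has M-exponent 0. -/
theorem polyBound_loop {e e' N M k c m : ℕ} (hN : 2 ≤ N) (hM : 1 ≤ M)
    (hc : c ≤ M ^ e * N ^ k) (hm : m ≤ M ^ e' * N) :
    m * (c + 1) + 1 ≤ M ^ (e' + e) * N ^ (k + 3) := by
  have h3 := polyBound_pos e k hN hM
  have h5 := polyBound_pos e' 1 hN hM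
  have h4 : 4 ≤ N ^ 2 := by nlinarith
  rw [pow_one] at h5
  calc m * (c + 1) + 1 ≤ (M ^ e' * N) * (M ^ e * N ^ k + 1) + 1 := by gcongr
    _ ≤ (M ^ e' * N) * (M ^ e * N ^ k * 4) := by nlinarith
    _ ≤ (M ^ e' * N) * (M ^ e * N ^ k * N ^ 2) := by gcongr
    _ = _ := by ring

namespace CostBound

variable {e : ℕ} {P : ℕ → ℕ → Γ.Val → Prop}

theorem mono {e' : ℕ} {Q : ℕ → ℕ → Γ.Val → Prop} {f : Prog Γ a} (h : CostBound e P f)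
    (he : e ≤ e') (hQ : ∀ N M x, Q N M x → P N M x) : CostBound e' Q f := by
  obtain ⟨k, hk⟩ := h
  exact ⟨k, fun N M x hN hM hx => polyBound_mono hN hM he le_rfl (hk N M x hN hM (hQ _ _ _ hx))⟩

theorem of_cost_le (f : Prog Γ a) (h : ∀ x, f.cost x ≤ 1) : CostBound e P f :=
  ⟨0, fun _ _ x hN hM _ => (h x).trans (polyBound_pos e 0 hN hM)⟩

theorem id' : CostBound e P (.id : Prog Γ Γ) := of_cost_le _ fun _ => le_rfl
theorem star' : CostBound e P (.star : Prog Γ .unit) := of_cost_le _ fun _ => le_rfl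
theorem fst' {P : ℕ → ℕ → (Ty.prod a b).Val → Prop} : CostBound e P (.fst : Prog (.prod a b) a) :=
  of_cost_le _ fun _ => le_rfl
theorem snd' {P : ℕ → ℕ → (Ty.prod a b).Val → Prop} : CostBound e P (.snd : Prog (.prod a b) b) :=
  of_cost_le _ fun _ => le_rfl
theorem boolConst' (v : Bool) : CostBound e P (.boolConst v : Prog Γ .bool) :=
  of_cost_le _ fun _ => le_rfl
theorem natZero' : CostBound e P (.natZero : Prog Γ .nat) := of_cost_le _ fun _ => le_rfl
theorem zero' : CostBound e P (.zero : Prog Γ .scalar) := of_cost_le _ fun _ => le_rfl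
theorem one' : CostBound e P (.one : Prog Γ .scalar) := of_cost_le _ fun _ => le_rfl
theorem nil' : CostBound e P (.nil : Prog Γ (.list a)) := of_cost_le _ fun _ => le_rfl

theorem comp' {Q : ℕ → ℕ → a.Val → Prop} {f : Prog Γ a} {g : Prog a b} (hf : CostBound e P f)
    (hg : CostBound e Q g) (h : ∀ N M x, P N M x → Q N M (f.eval x)) :
    CostBound e P (.comp g f) := by
  obtain ⟨k, hk⟩ := hf
  obtain ⟨l, hl⟩ := hg
  exact ⟨_, fun N M x hN hM hx =>
    polyBound_add hN hM (hk N M x hN hM hx) (hl N M _ hN hM (h N M x hx))⟩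

/-- Composition with an operation of cost one. -/
theorem op {f : Prog Γ a} {g : Prog a b} (hf : CostBound e P f) (hg : ∀ x, g.cost x ≤ 1) :
    CostBound e P (.comp g f) :=
  hf.comp' (Q := fun _ _ _ => True) (of_cost_le _ hg) fun _ _ _ _ => trivial

theorem pair' {f : Prog Γ a} {g : Prog Γ b} (hf : CostBound e P f) (hg : CostBound e P g) :
    CostBound e P (.pair f g) := by
  obtain ⟨k, hk⟩ := hf
  obtain ⟨l, hl⟩ := hg
  exact ⟨_, fun N M x hN hM hx =>
    polyBound_add hN hM (hk N M x hN hM hx) (hl N M x hN hM hx)⟩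

theorem cond' {c : Prog Γ .bool} {f g : Prog Γ b} (hc : CostBound e P c) (hf : CostBound e P f)
    (hg : CostBound e P g) : CostBound e P (.cond c f g) := by
  obtain ⟨j, hj⟩ := hc
  obtain ⟨k, hk⟩ := hf
  obtain ⟨l, hl⟩ := hg
  refine ⟨j + (k + l) + 2, fun N M x hN hM hx => ?_⟩
  refine polyBound_add hN hM (hj N M x hN hM hx) ?_
  split
  · exact polyBound_mono hN hM le_rfl (by omega) (hk N M x hN hM hx)
  · exact polyBound_mono hN hM le_rfl (by omega) (hl N M x hN hM hx)

theorem letIn' {f : Prog Γ a} {g : Prog (.prod Γ a) b} (hf : CostBound e P f)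
    {Q : ℕ → ℕ → (Ty.prod Γ a).Val → Prop} (hg : CostBound e Q g)
    (h : ∀ N M x, P N M x → Q N M (x, f.eval x)) : CostBound e P (letIn f g) :=
  (id'.pair' hf).comp' hg h

theorem eqNat' {f g : Prog Γ .nat} (hf : CostBound e P f) (hg : CostBound e P g) :
    CostBound e P (eqNat f g) := (hf.pair' hg).op fun _ => le_rfl

theorem eqScalar' {f g : Prog Γ .scalar} (hf : CostBound e P f) (hg : CostBound e P g) :
    CostBound e P (eqScalar f g) := (hf.pair' hg).op fun _ => le_rfl

theorem mulS' {f g : Prog Γ .scalar} (hf : CostBound e P f) (hg : CostBound e P g) :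
    CostBound e P (mulS f g) := (hf.pair' hg).op fun _ => le_rfl

theorem consL' {f : Prog Γ a} {g : Prog Γ (.list a)} (hf : CostBound e P f)
    (hg : CostBound e P g) : CostBound e P (consL f g) := (hf.pair' hg).op fun _ => le_rfl

theorem andB' {f g : Prog Γ .bool} (hf : CostBound e P f) (hg : CostBound e P g) :
    CostBound e P (andB f g) := hf.cond' hg (boolConst' _)

theorem orB' {f g : Prog Γ .bool} (hf : CostBound e P f) (hg : CostBound e P g) :
    CostBound e P (orB f g) := hf.cond' (boolConst' _) hg

theorem notB' {f : Prog Γ .bool} (hf : CostBound e P f) : CostBound e P (notB f) :=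
  hf.cond' (boolConst' _) (boolConst' _)

theorem eqB' {f g : Prog Γ .bool} (hf : CostBound e P f) (hg : CostBound e P g) :
    CostBound e P (eqB f g) := hf.cond' hg hg.notB'

/-- A loop over a list of length at most `M ^ e' * N`; the cost of the body may depend on the
context only. -/
theorem foldIn' (e₀ e' : ℕ) {init : Prog Γ s} {l : Prog Γ (.list a)}
    {f : Prog (.prod Γ (.prod s a)) s} (hi : CostBound e P init) (hl : CostBound e P l)
    (hlen : ∀ N M x, P N M x → List.length (l.eval x) ≤ M ^ e' * N)
    (hf : CostBound e₀ (fun N M (y : (Ty.prod Γ (.prod s a)).Val) => P N M y.1) f) (he : e' + e₀ ≤ e) :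
    CostBound e P (foldIn init l f) := by
  obtain ⟨j, hj⟩ := (id' (P := P) (e := e)).pair' (hi.pair' hl)
  obtain ⟨k, hk⟩ := hf
  refine ⟨_, fun N M x hN hM hx => polyBound_add (l := k + 3) hN hM (hj N M x hN hM hx) ?_⟩
  refine polyBound_mono (k := k + 3) hN hM he (by omega)
    (le_trans (Nat.succ_le_succ (foldCost_le _ _ (M ^ e₀ * N ^ k) (fun t y => ?_) _ _))
      (polyBound_loop hN hM le_rfl (hlen N M x hx)))
  exact hk N M (x, (t, y)) hN hM hx

/-- The number of rounds is bounded by N alone, so the M-exponent of the body is kept. The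
precondition `Q` of the body may speak of the loop state and is checked along the orbit. -/
theorem iterIn' {Q : ℕ → ℕ → (Ty.prod Γ s).Val → Prop} {init : Prog Γ s} {k : Prog Γ .nat}
    {f : Prog (.prod Γ s) s} (hi : CostBound e P init) (hk : CostBound e P k)
    (hlen : ∀ N M x, P N M x → (k.eval x : ℕ) ≤ N) (hf : CostBound e Q f)
    (hQ : ∀ N M x, P N M x → ∀ j < (k.eval x : ℕ),
      Q N M (x, (fun t => f.eval (x, t))^[j] (init.eval x))) :
    CostBound e P (iterIn init k f) := by
  obtain ⟨j, hj⟩ := (id' (P := P) (e := e)).pair' (hi.pair' hk)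
  obtain ⟨l, hl⟩ := hf
  refine ⟨_, fun N M x hN hM hx => polyBound_add (l := l + 3) hN hM (hj N M x hN hM hx) ?_⟩
  refine polyBound_mono (e := 0 + e) (k := l + 3) hN hM (by omega) (by omega)
    (le_trans (Nat.succ_le_succ (iterCost_le _ _ (M ^ e * N ^ l) _ _ fun i hi => ?_))
      (polyBound_loop hN hM le_rfl ((hlen N M x hx).trans (by simp))))
  exact hl N M _ hN hM (hQ N M x hx i hi)

theorem tailL' {P : ℕ → ℕ → (Ty.list a).Val → Prop} : CostBound e P (tailL (a := a)) := by
  refine (star'.pair' id').comp' (Q := fun _ _ _ => True) ?_ fun _ _ _ _ => trivial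
  refine ⟨3, fun N M x hN hM _ => ?_⟩
  obtain ⟨x, l⟩ := x
  have h4 : 8 ≤ N ^ 3 := Nat.pow_le_pow_left hN 3
  have h5 : 1 ≤ M ^ e := Nat.pow_pos hM
  have h6 : 8 ≤ M ^ e * N ^ 3 := by nlinarith
  cases l <;> simp only [cost] <;> omega

theorem headL' {P : ℕ → ℕ → (Ty.list a).Val → Prop} {d : Prog .unit a}
    (hd : CostBound e (fun _ _ _ => True) d) : CostBound e P (headL d) := by
  refine (star'.pair' id').comp' (Q := fun _ _ _ => True) ?_ fun _ _ _ _ => trivial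
  obtain ⟨k, hk⟩ := hd
  refine ⟨k + 3 + 2, fun N M x hN hM _ => ?_⟩
  have h4 : 8 ≤ N ^ 3 := Nat.pow_le_pow_left hN 3
  have h5 : 1 ≤ M ^ e := Nat.pow_pos hM
  have h6 : 3 ≤ M ^ e * N ^ 3 := by nlinarith
  obtain ⟨x, l⟩ := x
  have h7 := polyBound_add hN hM (hk N M () hN hM trivial) h6
  cases l with
  | nil =>
    refine le_trans ?_ h7
    change d.cost () + 1 ≤ _
    omega
  | cons y l =>
    refine le_trans ?_ h7
    simp only [cost]
    omega

theorem nth' {d : Prog .unit a} {l : Prog Γ (.list a)} {i : Prog Γ .nat}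
    (hd : CostBound e (fun _ _ _ => True) d) (hl : CostBound e P l) (hi : CostBound e P i)
    (h : ∀ N M x, P N M x → (i.eval x : ℕ) ≤ N) : CostBound e P (nth d l i) := by
  refine CostBound.comp' (Q := fun _ _ _ => True) ?_ (headL' hd) fun _ _ _ _ => trivial
  exact iterIn' (Q := fun _ _ _ => True) hl hi h
    (snd'.comp' (Q := fun _ _ _ => True) tailL' fun _ _ _ _ => trivial) fun _ _ _ _ _ _ => trivial

theorem tabulate' {Q : ℕ → ℕ → (Ty.prod Γ .nat).Val → Prop} {k : Prog Γ .nat}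
    {f : Prog (.prod Γ .nat) a} (hk : CostBound e P k)
    (h : ∀ N M x, P N M x → (k.eval x : ℕ) ≤ N) (hf : CostBound e Q f)
    (hQ : ∀ N M x, P N M x → ∀ i < (k.eval x : ℕ), Q N M (x, i)) :
    CostBound e P (tabulate k f) := by
  refine CostBound.op (iterIn' (Q := fun N M (y : (Ty.prod Γ (.prod .nat (.list a))).Val) =>
      P N M y.1 ∧ Nat.pred y.2.1 < k.eval y.1)
    (hk.pair' nil') hk h ?_ ?_) fun _ => le_rfl
  · refine letIn' (Q := fun N M (y : (Ty.prod (.prod Γ (.prod .nat (.list a))) .nat).Val) =>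
        P N M y.1.1 ∧ y.2 < (k.eval y.1.1 : ℕ))
      ((snd'.op fun _ => le_rfl).op fun _ => le_rfl) ?_ fun N M x hx => hx
    refine snd'.pair' (consL' ?_ ((fst'.op fun _ => le_rfl).op fun _ => le_rfl))
    exact CostBound.comp' ((fst'.op fun _ => le_rfl).pair' snd') hf
      fun N M x hx => hQ N M _ hx.1 _ hx.2
  · intro N M x hx j hj
    -- After j rounds the counter has dropped by j, so the body is evaluated at an index strictly
    -- below the length of the table.
    have h : ∀ (j n : ℕ) (l : List a.Val),
        ((fun t : ℕ × List a.Val => (t.1.pred, f.eval (x, t.1.pred) :: t.2))^[j] (n, l)).1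
          = n - j := by
      intro j
      induction j with
      | zero => intro n l; rfl
      | succ j ih =>
        intro n l
        rw [Function.iterate_succ_apply, ih]
        simp only [Nat.pred_eq_sub_one]
        omega
    refine ⟨hx, ?_⟩
    change Nat.pred ((fun t : ℕ × List a.Val =>
      (t.1.pred, f.eval (x, t.1.pred) :: t.2))^[j] (k.eval x, [])).1 < _
    rw [h, Nat.pred_eq_sub_one]
    have h' : ∀ i n : ℕ, i < n → n - i - 1 < n := by intros; omega
    exact h' _ _ hj

theorem sumL' {e e' : ℕ} (he : e' ≤ e) :
    CostBound e (fun N M (l : List ℂ) => l.length ≤ M ^ e' * N) sumL :=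
  foldIn' 0 e' zero' id' (fun _ _ _ h => h) (snd'.op fun _ => le_rfl) he

theorem prodL' {e e' : ℕ} (he : e' ≤ e) :
    CostBound e (fun N M (l : List ℂ) => l.length ≤ M ^ e' * N) prodL :=
  foldIn' 0 e' one' id' (fun _ _ _ h => h) (snd'.op fun _ => le_rfl) he

theorem sum_tabulate {Q : ℕ → ℕ → (Ty.prod Γ .nat).Val → Prop} {k : Prog Γ .nat}
    {f : Prog (.prod Γ .nat) .scalar} (hk : CostBound e P k)
    (h : ∀ N M x, P N M x → (k.eval x : ℕ) ≤ N) (hf : CostBound e Q f)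
    (hQ : ∀ N M x, P N M x → ∀ i < (k.eval x : ℕ), Q N M (x, i)) :
    CostBound e P (.comp sumL (tabulate k f)) :=
  (tabulate' hk h hf hQ).comp' (sumL' (Nat.zero_le e)) fun N M x hx => by
    simpa using h N M x hx

theorem prod_tabulate {Q : ℕ → ℕ → (Ty.prod Γ .nat).Val → Prop} {k : Prog Γ .nat}
    {f : Prog (.prod Γ .nat) .scalar} (hk : CostBound e P k)
    (h : ∀ N M x, P N M x → (k.eval x : ℕ) ≤ N) (hf : CostBound e Q f)
    (hQ : ∀ N M x, P N M x → ∀ i < (k.eval x : ℕ), Q N M (x, i)) :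
    CostBound e P (.comp prodL (tabulate k f)) :=
  (tabulate' hk h hf hQ).comp' (prodL' (Nat.zero_le e)) fun N M x hx => by
    simpa using h N M x hx

end CostBound

end Prog

/-! ### Variable elimination for pairwise factors -/

/-- A factor of a weight on assignments `σ : ℕ → ℕ`: two variables and the table of its values. -/
abbrev Factor : Type := (ℕ × ℕ) × List (List ℂ)

/-- The entry `(i, j)` of a table. -/
def tableEntry (M : List (List ℂ)) (i j : ℕ) : ℂ := (M.getD i []).getD j 0

/-- The table of a function of two indices below `D`. -/
def mkTable (D : ℕ) (f : ℕ → ℕ → ℂ) : List (List ℂ) :=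
  (List.range D).map fun i => (List.range D).map fun j => f i j

namespace Factor

/-- A factor has `v` as one of its variables. -/
abbrev Touches (v : ℕ) (f : Factor) : Prop := f.1.1 = v ∨ f.1.2 = v

/-- A neighbour of `v` other than `w`, or `w` if there is none. -/
def neighbor (v w : ℕ) (F : List Factor) : ℕ :=
  F.foldl (fun t f =>
    if f.1.1 = v ∧ f.1.2 ≠ v ∧ f.1.2 ≠ w then f.1.2
    else if f.1.2 = v ∧ f.1.1 ≠ v ∧ f.1.1 ≠ w then f.1.1 else t) w

/-- The value of the variable `x` if `v`, `a` and any other variable have the values `s`, `i`,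
`j`. -/
def localValue (v a s i j x : ℕ) : ℕ := if x = v then s else if x = a then i else j

/-- Sum over the values of the variable `v`: the factors that have `v` as a variable are replaced by
a single one. -/
def elim (D v : ℕ) (F : List Factor) : List Factor :=
  ((neighbor v v F, neighbor v (neighbor v v F) F), mkTable D fun i j =>
      ((List.range D).map fun s =>
        F.foldl (fun t f => t * if Touches v f then
            tableEntry f.2 (localValue v (neighbor v v F) s i j f.1.1)
              (localValue v (neighbor v v F) s i j f.1.2) else 1) 1).sum) ::
    F.foldl (fun t f => if Touches v f then t else f :: t) []

/-- Eliminate the variables `0, …, n - 1` one after the other. -/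
def elimAll (n D : ℕ) (F : List Factor) : List Factor :=
  ((fun t : ℕ × List Factor => (t.1 + 1, elim D t.1 t.2))^[n] (0, F)).2

/-- The sum of the weight over all assignments of `0, …, n - 1`. -/
def contract (n D : ℕ) (F : List Factor) : ℂ :=
  (elimAll n D F).foldl (fun t f => t * tableEntry f.2 0 0) 1

end Factor

/-! ### The factors of a circuit -/

/-- Prefix all words by all letters. -/
def extendWords (S : List (List (Bool × Bool))) : List (List (Bool × Bool)) :=
  S.foldl (fun t w => ((false, false) :: w) :: ((false, true) :: w) ::
    ((true, false) :: w) :: ((true, true) :: w) :: t) []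

/-- All words of length `k` over the alphabet of pairs of bits. -/
def words (k : ℕ) : List (List (Bool × Bool)) := extendWords^[k] [[]]

/-- The letter `k` of word number `i`. -/
def letter (S : List (List (Bool × Bool))) (i k : ℕ) : Bool × Bool :=
  (S.getD i []).getD k (false, false)

/-- The diagonal entry of a two-qubit gate. -/
def gateEntry (g : (ℂ × ℂ) × (ℂ × ℂ)) (a b : Bool) : ℂ :=
  if a then (if b then g.2.2 else g.2.1) else (if b then g.1.2 else g.1.1)

/-- The entry of a one-qubit mixer gate. -/
def mixEntry (g : ℂ × ℂ) (a b : Bool) : ℂ := if a == b then g.1 else g.2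

/-- The weight of a word at a single qubit: the first components are the path of the qubit through
the circuit, the second components its path through the conjugate circuit. -/
def pathWeight (p : ℕ) (mix : List (ℂ × ℂ)) (w : ℕ → Bool × Bool) : ℂ :=
  (if (w p).1 == (w p).2 then 1 else 0) * ((List.range p).map fun k =>
    mixEntry (mix.getD k (0, 0)) (w (k + 1)).1 (w k).1 *
      starRingEnd ℂ (mixEntry (mix.getD k (0, 0)) (w (k + 1)).2 (w k).2)).prod

/-- The weight of a term at the words of its two qubits. -/
def termWeight (p : ℕ) (g : List ((ℂ × ℂ) × (ℂ × ℂ))) (w w' : ℕ → Bool × Bool) : ℂ :=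
  ((List.range p).map fun k =>
    gateEntry (g.getD k ((0, 0), (0, 0))) (w k).1 (w' k).1 *
      starRingEnd ℂ (gateEntry (g.getD k ((0, 0), (0, 0))) (w k).2 (w' k).2)).prod

/-- The gates of a term do not depend on its second variable. -/
def SndTrivial (p : ℕ) (g : List ((ℂ × ℂ) × (ℂ × ℂ))) : Prop :=
  ((List.range p).map fun k => if (g.getD k ((0, 0), (0, 0))).1.1 = (g.getD k ((0, 0), (0, 0))).1.2 ∧
    (g.getD k ((0, 0), (0, 0))).2.1 = (g.getD k ((0, 0), (0, 0))).2.2 then (1 : ℂ) else 0).prod = 1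

/-- The gates of a term do not depend on its first variable. -/
def FstTrivial (p : ℕ) (g : List ((ℂ × ℂ) × (ℂ × ℂ))) : Prop :=
  ((List.range p).map fun k => if (g.getD k ((0, 0), (0, 0))).1.1 = (g.getD k ((0, 0), (0, 0))).2.1 ∧
    (g.getD k ((0, 0), (0, 0))).1.2 = (g.getD k ((0, 0), (0, 0))).2.2 then (1 : ℂ) else 0).prod = 1

open Classical in
/-- The factor of a term; its variables are those on which the gates really depend. -/
noncomputable def termFactor (p D : ℕ) (S : List (List (Bool × Bool)))
    (t : (ℕ × ℕ) × List ((ℂ × ℂ) × (ℂ × ℂ))) : Factor :=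
  (if SndTrivial p t.2 then (t.1.1, t.1.1) else
    if FstTrivial p t.2 then (t.1.2, t.1.2) else (t.1.1, t.1.2),
    mkTable D fun i j => termWeight p t.2 (letter S i) (letter S j))

/-- The factor of a single qubit. -/
def pathFactor (p D : ℕ) (S : List (List (Bool × Bool))) (mix : List (ℂ × ℂ)) (v : ℕ) : Factor :=
  ((v, v), mkTable D fun _ j => pathWeight p mix (letter S j))

/-- The factor that fixes the measured bit of a qubit. -/
def bitFactor (p D : ℕ) (S : List (List (Bool × Bool))) (v : ℕ) (b : Bool) : Factor :=
  ((v, v), mkTable D fun _ j => if (letter S j p).1 == b then 1 else 0)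

/-- The factors of a circuit. -/
noncomputable def circuitFactors (n p D : ℕ) (S : List (List (Bool × Bool)))
    (ts : List ((ℕ × ℕ) × List ((ℂ × ℂ) × (ℂ × ℂ)))) (mix : List (ℂ × ℂ)) : List Factor :=
  ts.foldl (fun F t => termFactor p D S t :: F) ((List.range n).map (pathFactor p D S mix))

/-! ### The programs -/

namespace Prog

abbrev spinTy : Ty := .prod .bool .bool
abbrev wordTy : Ty := .list spinTy
abbrev tableTy : Ty := .list (.list .scalar)
abbrev factorTy : Ty := .prod (.prod .nat .nat) tableTy
abbrev termTy : Ty := .prod (.prod .nat .nat) (.list gateTy)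
/-- A circuit together with the list of all words and its length. -/
abbrev envTy : Ty := .prod circuitTy (.prod (.list wordTy) .nat)

variable {Γ a b : Ty}

/-- Use a program in an extended context. -/
def wk (f : Prog Γ a) : Prog (.prod Γ b) a := .comp f .fst

@[simp] theorem eval_wk (f : Prog Γ a) (x : (Ty.prod Γ b).Val) :
    (wk f : Prog (.prod Γ b) a).eval x = f.eval x.1 := rfl

/-- The table of a function of two indices below `D`. -/
def table (D : Prog Γ .nat) (f : Prog (.prod (.prod Γ .nat) .nat) .scalar) : Prog Γ tableTy :=
  tabulate D (tabulate (wk D) f)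

@[simp] theorem eval_table (D : Prog Γ .nat) (f : Prog (.prod (.prod Γ .nat) .nat) .scalar)
    (x : Γ.Val) : (table D f).eval x = mkTable (D.eval x) fun i j => f.eval ((x, i), j) := by
  simp only [table, eval_tabulate, eval_wk]
  rfl

def entryAt (M : Prog Γ tableTy) (i j : Prog Γ .nat) : Prog Γ .scalar := nth .zero (nth .nil M i) j

@[simp] theorem eval_entryAt (M : Prog Γ tableTy) (i j : Prog Γ .nat) (x : Γ.Val) :
    (entryAt M i j).eval x = tableEntry (M.eval x) (i.eval x) (j.eval x) := by
  simp only [entryAt, eval_nth]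
  rfl

/-- The first variable of the current factor in a loop. -/
def loopFst {s : Ty} : Prog (.prod Γ (.prod s factorTy)) .nat := .comp .fst (.comp .fst (.comp .snd .snd))
/-- The second variable of the current factor in a loop. -/
def loopSnd {s : Ty} : Prog (.prod Γ (.prod s factorTy)) .nat := .comp .snd (.comp .fst (.comp .snd .snd))

def neighborP (v w : Prog Γ .nat) (F : Prog Γ (.list factorTy)) : Prog Γ .nat :=
  foldIn w F
    (.cond (andB (eqNat loopFst (wk v)) (andB (notB (eqNat loopSnd (wk v)))
        (notB (eqNat loopSnd (wk w))))) loopSnd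
      (.cond (andB (eqNat loopSnd (wk v)) (andB (notB (eqNat loopFst (wk v)))
        (notB (eqNat loopFst (wk w))))) loopFst (.comp .fst .snd)))

@[simp] theorem eval_neighborP (v w : Prog Γ .nat) (F : Prog Γ (.list factorTy)) (x : Γ.Val) :
    (neighborP v w F).eval x = Factor.neighbor (v.eval x) (w.eval x) (F.eval x) := by
  simp only [neighborP, eval_foldIn, Factor.neighbor]
  congr 1
  funext t f
  simp [eval, loopFst, loopSnd]

/-- Context of the elimination step: the size of the tables, the variable, the factors. -/
abbrev elimTy : Ty := .prod .nat (.prod .nat (.list factorTy))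

/-- `localValue` of a variable, in a context that ends with two variables and three values. -/
def localValueP (x : Prog (.prod (.prod (.prod (.prod (.prod (.prod elimTy .nat) .nat) .nat) .nat)
    .nat) b) .nat) :
    Prog (.prod (.prod (.prod (.prod (.prod (.prod elimTy .nat) .nat) .nat) .nat) .nat) b) .nat :=
  .cond (eqNat x (wk (wk (wk (wk (wk (wk (.comp .fst .snd)))))))) (wk .snd)
    (.cond (eqNat x (wk (wk (wk (wk (wk .snd)))))) (wk (wk (wk .snd))) (wk (wk .snd)))

/-- The product of the factors that have `v` as a variable. -/
def localProdP :
    Prog (.prod (.prod (.prod (.prod (.prod elimTy .nat) .nat) .nat) .nat) .nat) .scalar :=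
  foldIn .one (wk (wk (wk (wk (wk (.comp .snd .snd))))))
    (mulS (.comp .fst .snd)
      (.cond (orB (eqNat loopFst (wk (wk (wk (wk (wk (wk (.comp .fst .snd))))))))
          (eqNat loopSnd (wk (wk (wk (wk (wk (wk (.comp .fst .snd)))))))))
        (entryAt (.comp .snd (.comp .snd .snd)) (localValueP loopFst) (localValueP loopSnd)) .one))

def dropTouchingP : Prog elimTy (.list factorTy) :=
  foldIn .nil (.comp .snd .snd)
    (.cond (orB (eqNat loopFst (wk (.comp .fst .snd))) (eqNat loopSnd (wk (.comp .fst .snd))))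
      (.comp .fst .snd) (consL (.comp .snd .snd) (.comp .fst .snd)))

/-- The two neighbours are bound outside the table, so the factor list is not rescanned for them
inside the loop over factors. -/
def elimP : Prog elimTy (.list factorTy) :=
  letIn (neighborP (.comp .fst .snd) (.comp .fst .snd) (.comp .snd .snd))
    (letIn (neighborP (wk (.comp .fst .snd)) .snd (wk (.comp .snd .snd)))
      (consL (.pair (.pair (wk .snd) .snd) (table (wk (wk .fst))
          (.comp sumL (tabulate (wk (wk (wk (wk .fst)))) localProdP))))
        (wk (wk dropTouchingP))))

theorem eval_localProdP
    (x : (Ty.prod (.prod (.prod (.prod (.prod elimTy .nat) .nat) .nat) .nat) .nat).Val) :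
    localProdP.eval x
      = List.foldl (fun t f => t * if Factor.Touches x.1.1.1.1.1.2.1 f then
            tableEntry f.2 (Factor.localValue x.1.1.1.1.1.2.1 x.1.1.1.1.2 x.2 x.1.1.2 x.1.2 f.1.1)
              (Factor.localValue x.1.1.1.1.1.2.1 x.1.1.1.1.2 x.2 x.1.1.2 x.1.2 f.1.2) else 1) 1
          x.1.1.1.1.1.2.2 := by
  simp only [localProdP, eval_foldIn]
  congr 1
  funext t f
  simp [eval, loopFst, loopSnd, localValueP, Factor.localValue]

theorem eval_dropTouchingP (x : elimTy.Val) :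
    dropTouchingP.eval x
      = List.foldl (fun t f => if Factor.Touches x.2.1 f then t else f :: t) [] x.2.2 := by
  simp only [dropTouchingP, eval_foldIn]
  congr 1
  funext t f
  simp [eval, loopFst, loopSnd]

theorem eval_elimP (x : elimTy.Val) : elimP.eval x = Factor.elim x.1 x.2.1 x.2.2 := by
  simp only [elimP, eval_letIn, eval_consL, eval, eval_table, eval_wk, eval_neighborP,
    eval_tabulate, eval_localProdP, eval_dropTouchingP, eval_sumL]
  rfl

/-- One iteration of the loop of `contractP`. -/
def contractStepP : Prog (.prod (.prod .nat (.prod .nat (.list factorTy)))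
    (.prod .nat (.list factorTy))) (.prod .nat (.list factorTy)) :=
  .pair (.comp .natSucc (.comp .fst .snd)) (.comp elimP (.pair (wk (.comp .fst .snd)) .snd))

theorem eval_contractStepP (x : (Ty.prod (.prod .nat (.prod .nat (.list factorTy)))
    (.prod .nat (.list factorTy))).Val) :
    contractStepP.eval x = (x.2.1 + 1, Factor.elim x.1.2.1 x.2.1 x.2.2) := by
  simp only [contractStepP, eval, eval_elimP]
  rfl

/-- Input: the number of variables, the size of the tables, the factors. -/
def contractP : Prog (.prod .nat (.prod .nat (.list factorTy))) .scalar :=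
  .comp (foldIn .one .id (mulS (.comp .fst .snd)
      (entryAt (.comp .snd (.comp .snd .snd)) .natZero .natZero)))
    (.comp .snd (iterIn (.pair .natZero (.comp .snd .snd)) .fst contractStepP))

theorem eval_contractP (x : (Ty.prod .nat (.prod .nat (.list factorTy))).Val) :
    contractP.eval x = Factor.contract x.1 x.2.1 x.2.2 := by
  simp only [contractP, eval, eval_iterIn, eval_foldIn, eval_mulS, eval_entryAt,
    eval_contractStepP]
  rfl

/-! The circuit and the words. -/

def envN : Prog envTy .nat := .comp .fst .fst
def envDepth : Prog envTy .nat := .comp .fst (.comp .snd .fst)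
def envTerms : Prog envTy (.list termTy) := .comp .fst (.comp .snd (.comp .snd .fst))
def envMix : Prog envTy (.list (.prod .scalar .scalar)) := .comp .snd (.comp .snd (.comp .snd .fst))
def envWords : Prog envTy (.list wordTy) := .comp .fst .snd
def envD : Prog envTy .nat := .comp .snd .snd

def letterP (S : Prog Γ (.list wordTy)) (i k : Prog Γ .nat) : Prog Γ spinTy :=
  nth (.pair (.boolConst false) (.boolConst false)) (nth .nil S i) k

@[simp] theorem eval_letterP (S : Prog Γ (.list wordTy)) (i k : Prog Γ .nat) (x : Γ.Val) :
    (letterP S i k).eval x = letter (S.eval x) (i.eval x) (k.eval x) := by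
  simp only [letterP, eval_nth]
  rfl

def gateEntryP (g : Prog Γ gateTy) (a b : Prog Γ .bool) : Prog Γ .scalar :=
  .cond a (.cond b (.comp .snd (.comp .snd g)) (.comp .fst (.comp .snd g)))
    (.cond b (.comp .snd (.comp .fst g)) (.comp .fst (.comp .fst g)))

@[simp] theorem eval_gateEntryP (g : Prog Γ gateTy) (a b : Prog Γ .bool) (x : Γ.Val) :
    (gateEntryP g a b).eval x = gateEntry (g.eval x) (a.eval x) (b.eval x) := rfl

def mixEntryP (g : Prog Γ (.prod .scalar .scalar)) (a b : Prog Γ .bool) : Prog Γ .scalar :=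
  .cond (eqB a b) (.comp .fst g) (.comp .snd g)

@[simp] theorem eval_mixEntryP (g : Prog Γ (.prod .scalar .scalar)) (a b : Prog Γ .bool)
    (x : Γ.Val) : (mixEntryP g a b).eval x = mixEntry (g.eval x) (a.eval x) (b.eval x) := by
  simp only [mixEntryP, eval, eval_eqB]
  rfl

def zeroGate : Prog .unit gateTy := .pair (.pair .zero .zero) (.pair .zero .zero)

/-- The factor of layer `k` in the weight of the word `j`; the context ends with `j` and `k`. -/
def pathLayerP : Prog (.prod (.prod (.prod envTy .nat) .nat) .nat) .scalar :=
  letIn (nth (.pair .zero .zero) (wk (wk (wk envMix))) .snd)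
    (letIn (letterP (wk (wk (wk (wk envWords)))) (wk (wk .snd)) (wk .snd))
      (letIn (letterP (wk (wk (wk (wk (wk envWords))))) (wk (wk (wk .snd)))
          (.comp .natSucc (wk (wk .snd))))
        (mulS (mixEntryP (wk (wk .snd)) (.comp .fst .snd) (.comp .fst (wk .snd)))
          (.comp .conj (mixEntryP (wk (wk .snd)) (.comp .snd .snd) (.comp .snd (wk .snd)))))))

def pathTableP : Prog envTy tableTy :=
  table envD (mulS
    (letIn (letterP (wk (wk envWords)) .snd (wk (wk envDepth)))
      (.cond (eqB (.comp .fst .snd) (.comp .snd .snd)) .one .zero))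
    (.comp prodL (tabulate (wk (wk envDepth)) pathLayerP)))

def bitTableP : Prog (.prod envTy .bool) tableTy :=
  table (wk envD) (.cond (eqB (.comp .fst (letterP (wk (wk (wk envWords))) .snd
    (wk (wk (wk envDepth))))) (wk (wk .snd))) .one .zero)

/-- The factor of layer `k` in the weight of a term at the words `i` and `j`; the context ends with
`i`, `j` and `k`. -/
def termLayerP : Prog (.prod (.prod (.prod (.prod envTy termTy) .nat) .nat) .nat) .scalar :=
  letIn (nth zeroGate (wk (wk (wk (.comp .snd .snd)))) .snd)
    (letIn (letterP (wk (wk (wk (wk (wk envWords))))) (wk (wk (wk .snd))) (wk .snd))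
      (letIn (letterP (wk (wk (wk (wk (wk (wk envWords)))))) (wk (wk (wk .snd)))
          (wk (wk .snd)))
        (mulS (gateEntryP (wk (wk .snd)) (.comp .fst (wk .snd)) (.comp .fst .snd))
          (.comp .conj (gateEntryP (wk (wk .snd)) (.comp .snd (wk .snd)) (.comp .snd .snd))))))

def termTableP : Prog (.prod envTy termTy) tableTy :=
  table (wk envD) (.comp prodL (tabulate (wk (wk (wk envDepth))) termLayerP))

def sndTrivialP : Prog (.prod envTy termTy) .bool :=
  eqScalar (.comp prodL (tabulate (wk envDepth)
    (letIn (nth zeroGate (wk (.comp .snd .snd)) .snd)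
      (.cond (andB (eqScalar (.comp .fst (.comp .fst .snd)) (.comp .snd (.comp .fst .snd)))
          (eqScalar (.comp .fst (.comp .snd .snd)) (.comp .snd (.comp .snd .snd)))) .one .zero))))
    .one

def fstTrivialP : Prog (.prod envTy termTy) .bool :=
  eqScalar (.comp prodL (tabulate (wk envDepth)
    (letIn (nth zeroGate (wk (.comp .snd .snd)) .snd)
      (.cond (andB (eqScalar (.comp .fst (.comp .fst .snd)) (.comp .fst (.comp .snd .snd)))
          (eqScalar (.comp .snd (.comp .fst .snd)) (.comp .snd (.comp .snd .snd)))) .one .zero))))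
    .one

def termFactorP : Prog (.prod envTy termTy) factorTy :=
  .pair (.cond sndTrivialP (.pair (.comp .fst (.comp .fst .snd)) (.comp .fst (.comp .fst .snd)))
    (.cond fstTrivialP (.pair (.comp .snd (.comp .fst .snd)) (.comp .snd (.comp .fst .snd)))
      (.pair (.comp .fst (.comp .fst .snd)) (.comp .snd (.comp .fst .snd))))) termTableP

def circuitFactorsP : Prog envTy (.list factorTy) :=
  foldIn (tabulate envN (.pair (.pair .snd .snd) (wk pathTableP))) envTerms
    (consL (.comp termFactorP (.pair .fst (.comp .snd .snd))) (.comp .fst .snd))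

theorem eval_pathTableP (x : envTy.Val) : pathTableP.eval x
    = mkTable x.2.2 fun _ j => pathWeight x.1.2.1 x.1.2.2.2 (letter x.2.1 j) := by
  simp only [pathTableP, eval_table, eval_mulS, eval_letIn, eval_letterP, eval, eval_wk, eval_eqB,
    eval_prodL, eval_tabulate, pathLayerP, eval_mixEntryP, eval_nth]
  rfl

theorem eval_bitTableP (x : (Ty.prod envTy .bool).Val) : bitTableP.eval x
    = mkTable x.1.2.2 fun _ j => if (letter x.1.2.1 j x.1.1.2.1).1 == x.2 then 1 else 0 := by
  simp only [bitTableP, eval_table, eval_letterP, eval, eval_wk, eval_eqB]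
  rfl

theorem eval_termTableP (x : (Ty.prod envTy termTy).Val) : termTableP.eval x
    = mkTable x.1.2.2 fun i j =>
        termWeight x.1.1.2.1 x.2.2 (letter x.1.2.1 i) (letter x.1.2.1 j) := by
  simp only [termTableP, eval_table, eval_mulS, eval_letIn, eval_letterP, eval, eval_wk,
    eval_prodL, eval_tabulate, termLayerP, eval_gateEntryP, eval_nth]
  rfl

theorem eval_sndTrivialP_iff (x : (Ty.prod envTy termTy).Val) :
    @Eq Bool (sndTrivialP.eval x) true ↔ SndTrivial x.1.1.2.1 x.2.2 := by
  simp only [sndTrivialP, SndTrivial, eval_eqScalar_iff, eval_letIn, eval, eval_wk, eval_andB_iff,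
    eval_prodL, eval_tabulate, eval_nth]
  rfl

theorem eval_fstTrivialP_iff (x : (Ty.prod envTy termTy).Val) :
    @Eq Bool (fstTrivialP.eval x) true ↔ FstTrivial x.1.1.2.1 x.2.2 := by
  simp only [fstTrivialP, FstTrivial, eval_eqScalar_iff, eval_letIn, eval, eval_wk, eval_andB_iff,
    eval_prodL, eval_tabulate, eval_nth]
  rfl

theorem eval_termFactorP (x : (Ty.prod envTy termTy).Val) :
    termFactorP.eval x = termFactor x.1.1.2.1 x.1.2.2 x.1.2.1 x.2 := by
  classical
  simp only [termFactorP, eval, eval_termTableP]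
  exact congrArg₂ Prod.mk (if_congr (eval_sndTrivialP_iff x) rfl
    (if_congr (eval_fstTrivialP_iff x) rfl rfl)) rfl

theorem eval_circuitFactorsP (x : envTy.Val) : circuitFactorsP.eval x
    = circuitFactors x.1.1 x.1.2.1 x.2.2 x.2.1 x.1.2.2.1 x.1.2.2.2 := by
  simp only [circuitFactorsP, eval_foldIn, eval_consL, eval, eval_termFactorP, eval_tabulate,
    eval_wk, eval_pathTableP]
  rfl

def extendWordsP : Prog (.list wordTy) (.list wordTy) :=
  foldIn .nil .id
    (consL (consL (.pair (.boolConst false) (.boolConst false)) (.comp .snd .snd))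
    (consL (consL (.pair (.boolConst false) (.boolConst true)) (.comp .snd .snd))
    (consL (consL (.pair (.boolConst true) (.boolConst false)) (.comp .snd .snd))
    (consL (consL (.pair (.boolConst true) (.boolConst true)) (.comp .snd .snd))
      (.comp .fst .snd)))))

def wordsP : Prog circuitTy (.list wordTy) :=
  iterIn (consL .nil .nil) (.comp .natSucc (.comp .fst .snd)) (.comp extendWordsP .snd)

@[simp] theorem eval_wordsP (c : circuitTy.Val) : wordsP.eval c = words (c.2.1 + 1) := rfl

def lengthP : Prog (.list a) .nat := foldIn .natZero .id (.comp .natSucc (.comp .fst .snd))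

@[simp] theorem eval_lengthP (l : List a.Val) : lengthP.eval l = l.length := by
  have h : ∀ (l : List a.Val) (k : ℕ), l.foldl (fun t _ => t + 1) k = k + l.length := by
    intro l
    induction l with
    | nil => intro k; rfl
    | cons x l ih => intro k; rw [List.foldl_cons, ih, List.length_cons]; omega
  exact (h l 0).trans (Nat.zero_add _)

def envP : Prog circuitTy envTy := .pair .id (.comp (.pair .id lengthP) wordsP)

@[simp] theorem eval_envP (c : circuitTy.Val) :
    envP.eval c = (c, (words (c.2.1 + 1), (words (c.2.1 + 1)).length)) := by
  simp only [envP, eval, eval_lengthP, eval_wordsP]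

/-! The sampler. -/

/-- State of the sampler: the bits drawn so far, their first position, and the factors that
condition on them. -/
abbrev samplerTy : Ty := .prod (.list .bool) (.prod .nat (.list factorTy))

/-- The factors conditioned on the next bit; the context ends with this bit. -/
def conditionP : Prog (.prod (.prod envTy samplerTy) .bool) (.list factorTy) :=
  letIn (.comp .natPred (wk (.comp .fst (.comp .snd .snd))))
    (consL (.pair (.pair .snd .snd) (wk (.comp bitTableP (.pair (wk .fst) .snd))))
      (wk (wk (.comp .snd (.comp .snd .snd)))))

/-- The conditional probability that the next bit is `true`. -/
def biasP : Prog (.prod envTy samplerTy) .scalar :=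
  .comp .div (.pair
    (.comp contractP (.pair (wk envN) (.pair (wk envD)
      (.comp conditionP (.pair .id (.boolConst true))))))
    (.comp contractP (.pair (wk envN) (.pair (wk envD) (.comp .snd (.comp .snd .snd))))))

/-- The new state after a bit has been drawn. -/
def updateP : Prog (.prod (.prod envTy samplerTy) .bool) samplerTy :=
  .pair (consL .snd (wk (.comp .fst .snd)))
    (.pair (.comp .natPred (wk (.comp .fst (.comp .snd .snd)))) conditionP)

def drawBitP : Prog (.prod envTy samplerTy) samplerTy :=
  .comp updateP (.pair .id (.comp .flip biasP))

def setupP : Prog circuitTy (.prod envTy (.prod samplerTy .nat)) :=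
  .comp (.pair .id (.pair (.pair .nil (.pair envN circuitFactorsP)) envN)) envP

def samplerP : Prog circuitTy (.list .bool) :=
  .comp .fst (.comp (.iter drawBitP) setupP)

theorem eval_conditionP (x : (Ty.prod (.prod envTy samplerTy) .bool).Val) :
    conditionP.eval x = bitFactor x.1.1.1.2.1 x.1.1.2.2 x.1.1.2.1 (Nat.pred x.1.2.2.1) x.2 ::
      x.1.2.2.2 := by
  simp only [conditionP, eval_letIn, eval_consL, eval, eval_wk, eval_bitTableP]
  rfl

theorem eval_biasP (x : (Ty.prod envTy samplerTy).Val) : biasP.eval x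
    = Factor.contract x.1.1.1 x.1.2.2
        (bitFactor x.1.1.2.1 x.1.2.2 x.1.2.1 (Nat.pred x.2.2.1) true :: x.2.2.2) /
      Factor.contract x.1.1.1 x.1.2.2 x.2.2.2 := by
  simp only [biasP, eval, eval_wk, eval_conditionP, eval_contractP]
  rfl

theorem eval_updateP (x : (Ty.prod (.prod envTy samplerTy) .bool).Val) :
    updateP.eval x = (x.2 :: x.1.2.1, (Nat.pred x.1.2.2.1,
      bitFactor x.1.1.1.2.1 x.1.1.2.2 x.1.1.2.1 (Nat.pred x.1.2.2.1) x.2 :: x.1.2.2.2)) := by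
  simp only [updateP, eval, eval_consL, eval_wk, eval_conditionP]

theorem eval_setupP (c : circuitTy.Val) :
    setupP.eval c = ((c, (words (c.2.1 + 1), (words (c.2.1 + 1)).length)),
      (([], (c.1, circuitFactors c.1 c.2.1 (words (c.2.1 + 1)).length (words (c.2.1 + 1))
        c.2.2.1 c.2.2.2)), c.1)) := by
  simp only [setupP, eval, eval_envP, eval_circuitFactorsP]
  rfl

theorem det_biasP : biasP.det = true := by decide
theorem det_updateP : updateP.det = true := by decide
theorem det_setupP : setupP.det = true := by decide

end Prog

/-! ### Correctness of variable elimination in degree at most two -/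

theorem tableEntry_mkTable {D i j : ℕ} (f : ℕ → ℕ → ℂ) (hi : i < D) (hj : j < D) :
    tableEntry (mkTable D f) i j = f i j := by
  simp [tableEntry, mkTable, List.getD_eq_getElem?_getD, hi, hj]

namespace Factor

/-- The value of a factor at an assignment. -/
def value (σ : ℕ → ℕ) (f : Factor) : ℂ := tableEntry f.2 (σ f.1.1) (σ f.1.2)

/-- The product of the values of the factors. -/
def weight (F : List Factor) (σ : ℕ → ℕ) : ℂ := (F.map (value σ)).prod

/-- Two distinct variables occur in a common factor. -/
def Linked (F : List Factor) (v w : ℕ) : Prop :=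
  v ≠ w ∧ ∃ f ∈ F, f.1 = (v, w) ∨ f.1 = (w, v)

/-- Every variable is linked to at most two others. -/
def DegreeLeTwo (F : List Factor) : Prop :=
  ∀ v x y z, Linked F v x → Linked F v y → Linked F v z → x = y ∨ x = z ∨ y = z

theorem Linked.symm {F : List Factor} {v w : ℕ} (h : Linked F v w) : Linked F w v :=
  ⟨h.1.symm, let ⟨f, hf, h'⟩ := h.2; ⟨f, hf, h'.symm⟩⟩

/-- The scan returns its default `w` only if no neighbour differs from `w`, so two scans, with
defaults v and the first result, exhaust a neighbourhood of size at most two. The induction appends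
at the end because the last matching factor decides. -/
theorem neighbor_spec (v w : ℕ) (F : List Factor) :
    (neighbor v w F = w ∨ (neighbor v w F ≠ w ∧ Linked F v (neighbor v w F))) ∧
      (neighbor v w F = w → ∀ x, Linked F v x → x = w) := by
  induction F using List.reverseRecOn with
  | nil => exact ⟨Or.inl rfl, fun _ x hx => by simp [Linked] at hx⟩
  | append_singleton F f ih =>
    have hmono : ∀ x, Linked F v x → Linked (F ++ [f]) v x := fun x hx =>
      ⟨hx.1, let ⟨g, hg, h'⟩ := hx.2; ⟨g, List.mem_append_left _ hg, h'⟩⟩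
    have hnew : ∀ x, Linked (F ++ [f]) v x →
        Linked F v x ∨ (v ≠ x ∧ (f.1 = (v, x) ∨ f.1 = (x, v))) := by
      rintro x ⟨h, g, hg, h'⟩
      rcases List.mem_append.1 hg with hg | hg
      · exact Or.inl ⟨h, g, hg, h'⟩
      · rw [List.mem_singleton.1 hg] at h'
        exact Or.inr ⟨h, h'⟩
    have hf : f ∈ F ++ [f] := by simp
    have hdef : neighbor v w (F ++ [f]) = if f.1.1 = v ∧ f.1.2 ≠ v ∧ f.1.2 ≠ w then f.1.2
        else if f.1.2 = v ∧ f.1.1 ≠ v ∧ f.1.1 ≠ w then f.1.1 else neighbor v w F := by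
      simp only [neighbor, List.foldl_append, List.foldl_cons, List.foldl_nil]
    rw [hdef]
    split_ifs with h1 h2
    · exact ⟨Or.inr ⟨h1.2.2, Ne.symm h1.2.1, f, hf, Or.inl (by rw [← h1.1])⟩,
        fun h => absurd h h1.2.2⟩
    · exact ⟨Or.inr ⟨h2.2.2, Ne.symm h2.2.1, f, hf, Or.inr (by rw [← h2.1])⟩,
        fun h => absurd h h2.2.2⟩
    · refine ⟨ih.1.imp id fun h => ⟨h.1, hmono _ h.2⟩, fun h x hx => ?_⟩
      rcases hnew x hx with hx | ⟨hne, hx | hx⟩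
      · exact ih.2 h x hx
      · by_contra hxw
        exact h1 ⟨by rw [hx], by rw [hx]; exact hne.symm, by rw [hx]; exact hxw⟩
      · by_contra hxw
        exact h2 ⟨by rw [hx], by rw [hx]; exact hne.symm, by rw [hx]; exact hxw⟩

/-- The two neighbours found by the elimination step are all neighbours. -/
theorem linked_eq_neighbor {F : List Factor} (hF : DegreeLeTwo F) {v x : ℕ} (hx : Linked F v x) :
    x = neighbor v v F ∨ x = neighbor v (neighbor v v F) F := by
  obtain ⟨h1, h2⟩ := neighbor_spec v v F
  obtain ⟨h3, h4⟩ := neighbor_spec v (neighbor v v F) F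
  rcases h1 with h1 | ⟨h1, h1'⟩
  · exact absurd (h2 h1 x hx) hx.1.symm
  rcases h3 with h3 | ⟨h3, h3'⟩
  · exact Or.inl (h4 h3 x hx)
  · rcases hF v x _ _ hx h1' h3' with h | h | h
    · exact Or.inl h
    · exact Or.inr h
    · exact absurd h.symm h3

theorem foldl_drop_mem (v : ℕ) (F l : List Factor) (f : Factor) :
    f ∈ F.foldl (fun t f => if Touches v f then t else f :: t) l ↔
      f ∈ l ∨ (f ∈ F ∧ ¬ Touches v f) := by
  induction F generalizing l with
  | nil => simp
  | cons g F ih =>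
    rw [List.foldl_cons, ih]
    split_ifs with h
    · simp only [List.mem_cons]
      constructor
      · rintro (h' | h')
        · exact Or.inl h'
        · exact Or.inr ⟨Or.inr h'.1, h'.2⟩
      · rintro (h' | ⟨rfl | h', h''⟩)
        · exact Or.inl h'
        · exact absurd h h''
        · exact Or.inr ⟨h', h''⟩
    · simp only [List.mem_cons]
      constructor
      · rintro ((rfl | h') | h')
        · exact Or.inr ⟨Or.inl rfl, h⟩
        · exact Or.inl h'
        · exact Or.inr ⟨Or.inr h'.1, h'.2⟩
      · rintro (h' | ⟨rfl | h', h''⟩)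
        · exact Or.inl (Or.inr h')
        · exact Or.inl (Or.inl rfl)
        · exact Or.inr ⟨h', h''⟩

/-- A crude count, one new factor and perhaps none removed, but it suffices: n eliminations lengthen
the list by at most n. -/
theorem length_elim_le (D v : ℕ) (F : List Factor) : (elim D v F).length ≤ F.length + 1 := by
  have h : ∀ l : List Factor, (F.foldl (fun t f => if Touches v f then t else f :: t) l).length
      ≤ F.length + l.length := by
    induction F with
    | nil => simp
    | cons f F ih =>
      intro l
      rw [List.foldl_cons]
      split_ifs
      · have := ih l
        simp only [List.length_cons]
        omega
      · have := ih (f :: l)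
        simp only [List.length_cons] at this ⊢
        omega
  have := h []
  simp only [elim, List.length_cons]
  simpa using this

/-- The old links away from `v`, and a link between the neighbours of `v`. -/
theorem linked_elim {D v : ℕ} {F : List Factor} {x y : ℕ} (h : Linked (elim D v F) x y) :
    (Linked F x y ∧ x ≠ v ∧ y ≠ v) ∨ (Linked F v x ∧ Linked F v y) := by
  obtain ⟨hne, f, hf, h'⟩ := h
  rw [elim, List.mem_cons, foldl_drop_mem] at hf
  rcases hf with rfl | hf | ⟨hf, ht⟩
  · right
    obtain ⟨h1, h2⟩ := neighbor_spec v v F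
    obtain ⟨h3, h4⟩ := neighbor_spec v (neighbor v v F) F
    simp only [Prod.mk.injEq] at h'
    -- A link through the new factor forces its two variables to differ, and then both scans found
    -- genuine neighbours of v.
    have hab : neighbor v v F ≠ neighbor v (neighbor v v F) F := by
      rcases h' with ⟨h', h''⟩ | ⟨h', h''⟩
      · exact fun h => hne (h'.symm.trans (h.trans h''))
      · exact fun h => hne (h''.symm.trans (h.symm.trans h'))
    rcases h3 with h3 | ⟨h3, h3'⟩
    · exact absurd h3.symm hab
    rcases h1 with h1 | ⟨h1, h1'⟩
    · exact absurd (h2 h1 _ h3').symm h3'.1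
    rcases h' with ⟨h', h''⟩ | ⟨h', h''⟩
    · exact ⟨h' ▸ h1', h'' ▸ h3'⟩
    · exact ⟨h'' ▸ h3', h' ▸ h1'⟩
  · simp at hf
  · left
    refine ⟨⟨hne, f, hf, h'⟩, ?_, ?_⟩
    · rintro rfl
      rcases h' with h' | h'
      · exact ht (Or.inl (by rw [h']))
      · exact ht (Or.inr (by rw [h']))
    · rintro rfl
      rcases h' with h' | h'
      · exact ht (Or.inr (by rw [h']))
      · exact ht (Or.inl (by rw [h']))

/-- Elimination contracts the path a–v–b to an edge. A neighbour of v loses its link to v and gains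
at most a link to the other neighbour; links elsewhere are not increased. -/
theorem DegreeLeTwo.elim {D v : ℕ} {F : List Factor} (hF : DegreeLeTwo F) :
    DegreeLeTwo (elim D v F) := by
  intro w x y z hx hy hz
  have hx0 := hx.1
  have hy0 := hy.1
  have hz0 := hz.1
  -- The case in which w–x comes from the new factor, so that w and x are both old neighbours of v.
  -- The bound is applied at w if the other two links are old, and at v if one of them is new. The
  -- remaining cases permute x, y, z.
  have key : ∀ x y z, Linked F v w → Linked F v x → w ≠ x → w ≠ y → w ≠ z →
      ((Linked F w y ∧ w ≠ v ∧ y ≠ v) ∨ (Linked F v w ∧ Linked F v y)) →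
      ((Linked F w z ∧ w ≠ v ∧ z ≠ v) ∨ (Linked F v w ∧ Linked F v z)) →
      x = y ∨ x = z ∨ y = z := by
    intro x y z hw hx hx0 hy0 hz0 hy hz
    rcases hy with ⟨hy, hwv, hyv⟩ | ⟨-, hy⟩
    · rcases hz with ⟨hz, -, hzv⟩ | ⟨-, hz⟩
      · rcases hF w v y z hw.symm hy hz with h | h | h
        · exact absurd h.symm hyv
        · exact absurd h.symm hzv
        · exact Or.inr (Or.inr h)
      · rcases hF v w x z hw hx hz with h | h | h
        · exact absurd h hx0
        · exact absurd h hz0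
        · exact Or.inr (Or.inl h)
    · rcases hF v w x y hw hx hy with h | h | h
      · exact absurd h hx0
      · exact absurd h hy0
      · exact Or.inl h
  rcases linked_elim hx with ⟨hx1, hxv⟩ | ⟨hw, hx1⟩
  · rcases linked_elim hy with ⟨hy1, hyv⟩ | ⟨hw, hy1⟩
    · rcases linked_elim hz with ⟨hz1, hzv⟩ | ⟨hw, hz1⟩
      · exact hF w x y z hx1 hy1 hz1
      · rcases key z x y hw hz1 hz0 hx0 hy0 (linked_elim hx) (linked_elim hy) with h | h | h
        · exact Or.inr (Or.inl h.symm)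
        · exact Or.inr (Or.inr h.symm)
        · exact Or.inl h
    · rcases key y x z hw hy1 hy0 hx0 hz0 (linked_elim hx) (linked_elim hz) with h | h | h
      · exact Or.inl h.symm
      · exact Or.inr (Or.inr h)
      · exact Or.inr (Or.inl h)
  · exact key x y z hw hx1 hx0 hy0 hz0 (linked_elim hy) (linked_elim hz)

theorem foldl_mul (F : List Factor) (g : Factor → ℂ) (c : ℂ) :
    F.foldl (fun t f => t * g f) c = c * (F.map g).prod := by
  induction F generalizing c with
  | nil => simp
  | cons f F ih => rw [List.foldl_cons, ih, List.map_cons, List.prod_cons, mul_assoc]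

theorem weight_drop (v : ℕ) (F l : List Factor) (σ : ℕ → ℕ) :
    weight (F.foldl (fun t f => if Touches v f then t else f :: t) l) σ
      = weight l σ * (F.map fun f => if Touches v f then 1 else value σ f).prod := by
  induction F generalizing l with
  | nil => simp
  | cons f F ih =>
    rw [List.foldl_cons, ih, List.map_cons, List.prod_cons]
    split_ifs
    · rw [one_mul]
    · simp only [weight, List.map_cons, List.prod_cons]
      ring

/-- Distributivity: factors without v are constant in the summation, and the others see only v and
its two possible neighbours. If v has no neighbour, both scans return v and the new factor is a
constant table labelled (v, v), which is still correct. -/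
theorem weight_elim {D v : ℕ} {F : List Factor} (hF : DegreeLeTwo F) (σ : ℕ → ℕ)
    (hσ : ∀ x, σ x < D) :
    weight (elim D v F) σ = ∑ s ∈ Finset.range D, weight F (Function.update σ v s) := by
  set a := neighbor v v F with ha
  set b := neighbor v a F with hb
  -- `localValue` gives the value at b to every variable other than v and a. On a factor touching v
  -- this is right, since no further variable can occur there.
  have hval : ∀ s, ∀ f ∈ F, Touches v f → ∀ x, x = f.1.1 ∨ x = f.1.2 →
      localValue v a s (σ a) (σ b) x = Function.update σ v s x := by
    intro s f hf ht x hx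
    by_cases hxv : x = v
    · simp [localValue, hxv]
    have hl : Linked F v x := by
      refine ⟨Ne.symm hxv, f, hf, ?_⟩
      rcases hx with rfl | rfl <;> rcases ht with ht | ht
      · exact absurd ht hxv
      · exact Or.inr (by rw [← ht])
      · exact Or.inl (by rw [← ht])
      · exact absurd ht hxv
    rw [localValue, if_neg hxv, Function.update_of_ne hxv]
    split_ifs with hxa
    · rw [hxa]
    · rcases linked_eq_neighbor hF hl with h | h
      · exact absurd h hxa
      · exact congrArg σ h.symm
  rw [elim, weight, List.map_cons, List.prod_cons, ← weight, weight_drop, ← ha, ← hb]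
  rw [value]
  simp only
  rw [tableEntry_mkTable _ (hσ _) (hσ _), weight, List.map_nil, List.prod_nil, one_mul,
    ← List.sum_toFinset _ List.nodup_range, List.toFinset_range, Finset.sum_mul]
  refine Finset.sum_congr rfl fun s _ => ?_
  rw [foldl_mul, one_mul, ← List.prod_map_mul, weight]
  congr 1
  refine List.map_congr_left fun f hf => ?_
  split_ifs with ht
  · rw [mul_one, value, hval s f hf ht _ (Or.inl rfl), hval s f hf ht _ (Or.inr rfl)]
  · rw [one_mul, value, value, Function.update_of_ne (fun h => ht (Or.inl h)),
      Function.update_of_ne (fun h => ht (Or.inr h))]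

/-- The assignment with the values `τ` at `0, …, n - 1` and the values `σ` elsewhere. -/
def extend {n D : ℕ} (τ : Fin n → Fin D) (σ : ℕ → ℕ) (x : ℕ) : ℕ :=
  if h : x < n then τ ⟨x, h⟩ else σ x

theorem length_iterate_elim_le (n D : ℕ) (F : List Factor) :
    ((fun t : ℕ × List Factor => (t.1 + 1, elim D t.1 t.2))^[n] (0, F)).2.length
      ≤ F.length + n := by
  induction n with
  | zero => exact le_rfl
  | succ n ih =>
    rw [Function.iterate_succ_apply']
    exact (length_elim_le _ _ _).trans (by omega)

/-- The outer assignment `σ` is arbitrary so that the induction step can place the value of the next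
variable in it and then move that value into the inner assignment. The first component identifies
the loop counter with the variable to be eliminated. -/
theorem elimAll_spec {D : ℕ} {F : List Factor} (hF : DegreeLeTwo F) (n : ℕ) :
    ((fun t : ℕ × List Factor => (t.1 + 1, elim D t.1 t.2))^[n] (0, F)).1 = n ∧
    DegreeLeTwo (elimAll n D F) ∧
    ∀ σ : ℕ → ℕ, (∀ x, σ x < D) →
      weight (elimAll n D F) σ = ∑ τ : Fin n → Fin D, weight F (extend τ σ) := by
  induction n with
  | zero =>
    refine ⟨rfl, hF, fun σ _ => ?_⟩
    rw [Fintype.sum_unique]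
    congr 1
  | succ n ih =>
    obtain ⟨h1, h3, h4⟩ := ih
    have hstep : elimAll (n + 1) D F = elim D n (elimAll n D F) := by
      rw [elimAll, Function.iterate_succ_apply']
      simp only [h1]
      rfl
    refine ⟨by rw [Function.iterate_succ_apply', h1], hstep ▸ h3.elim, fun σ hσ => ?_⟩
    · rw [hstep, weight_elim h3 σ hσ, ← Fin.sum_univ_eq_sum_range
        (fun s => weight (elimAll n D F) (Function.update σ n s))]
      have : ∀ s : Fin D, weight (elimAll n D F) (Function.update σ n s)
          = ∑ τ : Fin n → Fin D, weight F (extend (Fin.snoc (α := fun _ => Fin D) τ s) σ) := by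
        intro s
        rw [h4 _ fun x => ?_]
        · refine Finset.sum_congr rfl fun τ _ => congrArg _ (funext fun x => ?_)
          simp only [extend]
          rcases lt_trichotomy x n with h | rfl | h
          · rw [dif_pos h, dif_pos (by omega)]
            have : (⟨x, by omega⟩ : Fin (n + 1)) = Fin.castSucc ⟨x, h⟩ := rfl
            rw [this, Fin.snoc_castSucc]
          · rw [dif_neg (lt_irrefl _), dif_pos (by omega), Function.update_self]
            have : (⟨x, by omega⟩ : Fin (x + 1)) = Fin.last x := rfl
            rw [this, Fin.snoc_last]
          · rw [dif_neg (by omega), dif_neg (by omega), Function.update_of_ne (by omega)]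
        · by_cases hx : x = n
          · rw [hx, Function.update_self]; exact s.2
          · rw [Function.update_of_ne hx]; exact hσ x
      simp_rw [this]
      rw [← Fintype.sum_prod_type'
        (fun s τ => weight F (extend (Fin.snoc (α := fun _ => Fin D) τ s) σ))]
      exact Fintype.sum_equiv (Fin.snocEquiv fun _ => Fin D) _ _ fun x => rfl

/-- Reading entry (0, 0) of every remaining table is evaluation at the zero assignment. It is
therefore unnecessary to know which labels the remaining factors carry. -/
theorem contract_eq {n D : ℕ} (hD : 0 < D) {F : List Factor} (hF : DegreeLeTwo F) :
    contract n D F = ∑ τ : Fin n → Fin D, weight F (extend τ fun _ => 0) := by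
  rw [← (elimAll_spec hF n).2.2 _ fun _ => hD, contract, foldl_mul, one_mul]
  rfl

end Factor

/-! ### The QAOA state as a sum over paths -/

namespace QAOA

variable {n p : ℕ}

theorem flipBit_flipBit (j : Fin n) (x : Fin n → Bool) : flipBit j (flipBit j x) = x := by
  simp [flipBit]

/-- The entry of the Hadamard matrix, without normalization. -/
def hadamardSign (a b : Bool) : ℂ := if a && b then -1 else 1

/-- The `n`-fold tensor power of the Hadamard matrix, without normalization. -/
def hadamard (n : ℕ) : Matrix (Fin n → Bool) (Fin n → Bool) ℂ :=
  Matrix.of fun x y => ∏ j, hadamardSign (x j) (y j)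

theorem sum_prod_bool (f : Fin n → Bool → ℂ) :
    ∑ w : Fin n → Bool, ∏ j, f j (w j) = ∏ j, (f j true + f j false) := by
  have := (Finset.prod_univ_sum (fun _ : Fin n => (Finset.univ : Finset Bool)) f).symm
  rw [Fintype.piFinset_univ] at this
  rw [this]
  simp only [Fintype.sum_bool]

theorem hadamard_mul_self : hadamard n * hadamard n = (2 : ℂ) ^ n • 1 := by
  ext x y
  rw [Matrix.mul_apply]
  simp only [hadamard, Matrix.of_apply, ← Finset.prod_mul_distrib]
  rw [sum_prod_bool (fun j c => hadamardSign (x j) c * hadamardSign c (y j)), Matrix.smul_apply,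
    Matrix.one_apply]
  split_ifs with h
  · subst h
    rw [Finset.prod_congr rfl (g := fun _ => (2 : ℂ))]
    · simp
    · intro j _
      cases x j <;> norm_num [hadamardSign]
  · obtain ⟨j, hj⟩ := Function.ne_iff.1 h
    rw [smul_zero]
    refine Finset.prod_eq_zero (Finset.mem_univ j) ?_
    revert hj
    cases x j <;> cases y j <;> norm_num [hadamardSign]

/-- The columns of the Hadamard matrix are eigenvectors of every Pauli X, with eigenvalue the sign
of the corresponding bit. Summing over j diagonalizes the mixing operator. -/
theorem pauliX_mul_hadamard (j : Fin n) (x w : Fin n → Bool) :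
    (pauliX j * hadamard n) x w = hadamard n x w * hadamardSign true (w j) := by
  rw [Matrix.mul_apply, Finset.sum_eq_single (flipBit j x)]
  · simp only [pauliX, hadamard, Matrix.of_apply, flipBit_flipBit, if_true, one_mul]
    rw [← Finset.mul_prod_erase _ _ (Finset.mem_univ j),
      ← Finset.mul_prod_erase (a := j) _ (fun i => hadamardSign (x i) (w i)) (Finset.mem_univ j),
      mul_right_comm]
    congr 1
    · simp only [flipBit, Function.update_self]
      cases x j <;> cases w j <;> norm_num [hadamardSign]
    · refine Finset.prod_congr rfl fun i hi => ?_
      rw [flipBit, Function.update_of_ne (Finset.ne_of_mem_erase hi)]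
  · intro y _ hy
    simp only [pauliX, Matrix.of_apply]
    rw [if_neg, zero_mul]
    rintro rfl
    exact hy (flipBit_flipBit j y).symm
  · simp

theorem mixingOp_mul_hadamard : mixingOp n * hadamard n
    = hadamard n * Matrix.diagonal fun w => ∑ j, hadamardSign true (w j) := by
  ext x w
  rw [mixingOp, Finset.sum_mul, Matrix.sum_apply, Matrix.mul_diagonal, Finset.mul_sum]
  exact Finset.sum_congr rfl fun j _ => pauliX_mul_hadamard j x w

/-- After diagonalization an entry is a sum over bit strings of a product over qubits, hence a
product of two-term sums. The powers of two from the inverse Hadamard matrix are shared out among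
the qubits, giving cosh or sinh at each. -/
theorem exp_mixingOp (t : ℂ) (x y : Fin n → Bool) :
    NormedSpace.exp (t • mixingOp n) x y
      = ∏ j, (if x j == y j then Complex.cosh t else Complex.sinh t) := by
  have h2 : (2 : ℂ) ^ n ≠ 0 := pow_ne_zero _ two_ne_zero
  have hinv : hadamard n * (((2 : ℂ) ^ n)⁻¹ • hadamard n) = 1 := by
    rw [Matrix.mul_smul, hadamard_mul_self, smul_smul, inv_mul_cancel₀ h2, one_smul]
  have hU : IsUnit (hadamard n) := IsUnit.of_mul_eq_one _ hinv
  have hinv' : (hadamard n)⁻¹ = ((2 : ℂ) ^ n)⁻¹ • hadamard n := Matrix.inv_eq_right_inv hinv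
  have hB : t • mixingOp n = hadamard n *
      (Matrix.diagonal fun w => t * ∑ j, hadamardSign true (w j)) * (hadamard n)⁻¹ := by
    have : (Matrix.diagonal fun w : Fin n → Bool => t * ∑ j, hadamardSign true (w j))
        = t • Matrix.diagonal fun w : Fin n → Bool => ∑ j, hadamardSign true (w j) := by
      rw [← Matrix.diagonal_smul]
      rfl
    rw [this, Matrix.mul_smul, ← mixingOp_mul_hadamard, Matrix.smul_mul, mul_assoc, hinv', hinv,
      mul_one]
  rw [hB, Matrix.exp_conj _ _ hU, Matrix.exp_diagonal, hinv', Matrix.mul_smul, Matrix.smul_apply,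
    Matrix.mul_apply]
  simp only [Matrix.mul_diagonal]
  have hsum : ∀ w : Fin n → Bool, hadamard n x w *
        NormedSpace.exp (fun w : Fin n → Bool => t * ∑ j, hadamardSign true (w j)) w * hadamard n w y
      = ∏ j, (hadamardSign (x j) (w j) * Complex.exp (t * hadamardSign true (w j)) *
          hadamardSign (w j) (y j)) := by
    intro w
    have : NormedSpace.exp (fun w : Fin n → Bool => t * ∑ j, hadamardSign true (w j)) w
        = ∏ j, Complex.exp (t * hadamardSign true (w j)) := by
      rw [Pi.coe_exp, ← Complex.exp_sum, ← Finset.mul_sum, Complex.exp_eq_exp_ℂ]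
    rw [this, Finset.prod_mul_distrib, Finset.prod_mul_distrib]
    rfl
  simp only [hsum]
  rw [sum_prod_bool (fun j c => hadamardSign (x j) c * Complex.exp (t * hadamardSign true c) *
          hadamardSign c (y j)), smul_eq_mul, ← inv_pow, ← Fin.prod_const, ← Finset.prod_mul_distrib]
  refine Finset.prod_congr rfl fun j _ => ?_
  rw [Complex.cosh, Complex.sinh]
  cases x j <;> cases y j <;> simp [hadamardSign] <;> ring

/-- The gates of the terms multiply to the exponential of the cost function. -/
theorem prod_gateEntry (Q : QAOA n p) (γ : ℝ) (y : Fin n → Bool) :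
    (Q.terms.map fun t => gateEntry (t.gate γ) (y t.fst) (y t.snd)).prod
      = Complex.exp (-Complex.I * (γ : ℂ) * (Q.cost y : ℂ)) := by
  rw [cost]
  induction Q.terms with
  | nil => simp
  | cons t l ih =>
    rw [List.map_cons, List.prod_cons, ih, List.map_cons, List.sum_cons, Complex.ofReal_add,
      mul_add, Complex.exp_add]
    congr 1
    simp only [gateEntry, LocalTerm.gate, LocalTerm.val]
    cases y t.fst <;> cases y t.snd <;> simp

/-- The entries of the mixer gate of layer `k`. -/
noncomputable def mixGate (Q : QAOA n p) (k : Fin p) : ℂ × ℂ :=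
  ((Real.cos (Q.β k) : ℂ), -Complex.I * (Real.sin (Q.β k) : ℂ))

theorem layer_apply (Q : QAOA n p) (k : Fin p) (x y : Fin n → Bool) :
    Q.layer k x y = (∏ j, mixEntry (Q.mixGate k) (x j) (y j)) *
      (Q.terms.map fun t => gateEntry (t.gate (Q.γ k)) (y t.fst) (y t.snd)).prod := by
  have h : (-Complex.I * (Q.γ k : ℂ)) • Q.costOp
      = Matrix.diagonal fun y => -Complex.I * (Q.γ k : ℂ) * (Q.cost y : ℂ) := by
    rw [costOp, ← Matrix.diagonal_smul]
    rfl
  rw [layer, h, Matrix.exp_diagonal, Matrix.mul_diagonal, exp_mixingOp, prod_gateEntry,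
    Pi.coe_exp, Complex.exp_eq_exp_ℂ]
  congr 1
  -- Moving the sign into the angle turns cosh and sinh of an imaginary argument into cos β and -i
  -- sin β, the mixer entries of the input.
  have hc : -Complex.I * (Q.β k : ℂ) = ((-Q.β k : ℝ) : ℂ) * Complex.I := by push_cast; ring
  refine Finset.prod_congr rfl fun j _ => ?_
  rw [mixEntry, mixGate, hc, Complex.cosh_mul_I, Complex.sinh_mul_I]
  push_cast
  rw [Complex.cos_neg, Complex.sin_neg]
  congr 1
  ring

/-- Path sum for a product of matrices, obtained by peeling off the last one. The initial vector is
constant, so paths are free at time 0 and constrained only at the final time. -/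
theorem foldl_mulVec {V : Type*} [Fintype V] [DecidableEq V] (p : ℕ)
    (A : Fin p → Matrix V V ℂ) (c : ℂ) (z : V) :
    Fin.foldl p (fun ψ k => A k *ᵥ ψ) (fun _ => c) z
      = c * ∑ x : Fin (p + 1) → V, if x (Fin.last p) = z then
          ∏ k : Fin p, A k (x k.succ) (x k.castSucc) else 0 := by
  induction p generalizing z with
  | zero =>
    rw [Fin.foldl_zero, Finset.sum_eq_single (fun _ => z)]
    · simp
    · intro x _ hx
      rw [if_neg]
      rintro rfl
      exact hx (funext fun i => congrArg x (Fin.ext (by simp)))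
    · simp
  | succ p ih =>
    have hR : (∑ x : Fin (p + 2) → V, if x (Fin.last (p + 1)) = z then
          ∏ k : Fin (p + 1), A k (x k.succ) (x k.castSucc) else 0)
        = ∑ x : Fin (p + 1) → V, (∏ k : Fin p, A k.castSucc (x k.succ) (x k.castSucc)) *
            A (Fin.last p) z (x (Fin.last p)) := by
      rw [← (Fin.snocEquiv fun _ : Fin (p + 2) => V).sum_comp, Fintype.sum_prod_type,
        Finset.sum_eq_single z]
      · simp only [Fin.snocEquiv, Equiv.coe_fn_mk, Fin.snoc_last, if_true, Fin.prod_univ_castSucc,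
          Fin.snoc_castSucc, Fin.succ_last, Fin.succ_castSucc]
      · intro b _ hb
        refine Finset.sum_eq_zero fun x _ => ?_
        simp only [Fin.snocEquiv, Equiv.coe_fn_mk, Fin.snoc_last]
        rw [if_neg hb]
      · simp
    rw [hR, Fin.foldl_succ_last, Matrix.mulVec, dotProduct]
    simp only [ih (fun k => A k.castSucc)]
    simp only [Finset.mul_sum]
    rw [Finset.sum_comm]
    refine Finset.sum_congr rfl fun x _ => ?_
    rw [Finset.sum_eq_single (x (Fin.last p))]
    · rw [if_pos rfl]
      ring
    · intro b _ hb
      rw [if_neg (Ne.symm hb), mul_zero, mul_zero]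
    · simp

/-- The amplitude of a path through the circuit, without normalization. -/
noncomputable def amplitude (Q : QAOA n p) (x : Fin (p + 1) → Fin n → Bool) : ℂ :=
  ∏ k : Fin p, Q.layer k (x k.succ) (x k.castSucc)

/-- Amplitude times conjugate amplitude is a double sum over paths with a common endpoint. The
factor 2^n cancels the normalization of the plus state, so the factors of the model need no square
roots. -/
theorem outputProb_eq (Q : QAOA n p) (z : Fin n → Bool) :
    (2 : ℂ) ^ n * (Q.outputProb z : ℂ)
      = ∑ x : Fin (p + 1) → Fin n → Bool, ∑ y : Fin (p + 1) → Fin n → Bool,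
          if x (Fin.last p) = z ∧ y (Fin.last p) = z then
            Q.amplitude x * starRingEnd ℂ (Q.amplitude y) else 0 := by
  have hs : Q.state z = (1 / (Real.sqrt 2 : ℂ)) ^ n * ∑ x : Fin (p + 1) → Fin n → Bool,
      if x (Fin.last p) = z then Q.amplitude x else 0 := foldl_mulVec p Q.layer _ z
  have hsqrt : (2 : ℂ) ^ n * ((1 / (Real.sqrt 2 : ℂ)) ^ n *
      starRingEnd ℂ ((1 / (Real.sqrt 2 : ℂ)) ^ n)) = 1 := by
    rw [map_pow, ← mul_pow, ← mul_pow, map_div₀, map_one, Complex.conj_ofReal, div_mul_div_comm,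
      ← Complex.ofReal_mul, Real.mul_self_sqrt (by norm_num)]
    norm_num
  have hp : ((Q.outputProb z : ℝ) : ℂ) = Q.state z * starRingEnd ℂ (Q.state z) := by
    rw [outputProb, Complex.mul_conj, Complex.normSq_eq_norm_sq]
  rw [hp, hs, map_mul, map_sum, mul_mul_mul_comm, ← mul_assoc, hsqrt, one_mul, Finset.sum_mul_sum]
  refine Finset.sum_congr rfl fun x _ => Finset.sum_congr rfl fun y _ => ?_
  split_ifs with h1 h2 h3 <;> simp_all

/-! ### Unitarity and normalization -/

theorem conjTranspose_exp_mul_self {V : Type*} [Fintype V] [DecidableEq V] (A : Matrix V V ℂ)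
    (hA : Aᴴ = -A) : (NormedSpace.exp A)ᴴ * NormedSpace.exp A = 1 := by
  rw [← Matrix.exp_conjTranspose, hA, ← Matrix.exp_add_of_commute _ _ (Commute.neg_left (Commute.refl A)),
    neg_add_cancel, NormedSpace.exp_zero]

theorem conjTranspose_layer_mul_self (Q : QAOA n p) (k : Fin p) :
    (Q.layer k)ᴴ * Q.layer k = 1 := by
  have hX : (mixingOp n)ᴴ = mixingOp n := by
    rw [mixingOp, Matrix.conjTranspose_sum]
    refine Finset.sum_congr rfl fun j _ => ?_
    ext x y
    simp only [pauliX, Matrix.conjTranspose_apply, Matrix.of_apply]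
    have : (y = flipBit j x) ↔ (x = flipBit j y) :=
      ⟨fun h => by rw [h, flipBit_flipBit], fun h => by rw [h, flipBit_flipBit]⟩
    simp [this]
  have hC : Q.costOpᴴ = Q.costOp := by
    rw [costOp, Matrix.diagonal_conjTranspose]
    congr 1
    funext x
    exact Complex.conj_ofReal _
  have h1 := conjTranspose_exp_mul_self ((-Complex.I * (Q.β k : ℂ)) • mixingOp n) (by
    rw [Matrix.conjTranspose_smul, hX, ← neg_smul]
    simp)
  have h2 := conjTranspose_exp_mul_self ((-Complex.I * (Q.γ k : ℂ)) • Q.costOp) (by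
    rw [Matrix.conjTranspose_smul, hC, ← neg_smul]
    simp)
  rw [layer, Matrix.conjTranspose_mul, mul_assoc, ← mul_assoc _ _ (NormedSpace.exp (_ • Q.costOp)),
    h1, one_mul, h2]

theorem star_dotProduct_foldl {V : Type*} [Fintype V] [DecidableEq V] (p : ℕ)
    (A : Fin p → Matrix V V ℂ) (hA : ∀ k, (A k)ᴴ * A k = 1) (ψ : V → ℂ) :
    star (Fin.foldl p (fun ψ k => A k *ᵥ ψ) ψ) ⬝ᵥ Fin.foldl p (fun ψ k => A k *ᵥ ψ) ψ
      = star ψ ⬝ᵥ ψ := by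
  induction p with
  | zero => simp only [Fin.foldl_zero]
  | succ p ih =>
    rw [Fin.foldl_succ_last, Matrix.star_mulVec, Matrix.dotProduct_mulVec, Matrix.vecMul_vecMul, hA,
      Matrix.vecMul_one]
    exact ih (fun k => A k.castSucc) fun k => hA _

/-- This gives the empty suffix mass one, so the chain of conditional probabilities starts from a
nonzero denominator. -/
theorem sum_outputProb (Q : QAOA n p) : ∑ z, Q.outputProb z = 1 := by
  have h := star_dotProduct_foldl p Q.layer Q.conjTranspose_layer_mul_self (plusState n)
  have hsqrt : starRingEnd ℂ (1 / (Real.sqrt 2 : ℂ)) * (1 / (Real.sqrt 2 : ℂ)) = 1 / 2 := by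
    rw [map_div₀, map_one, Complex.conj_ofReal, div_mul_div_comm,
      ← Complex.ofReal_mul, Real.mul_self_sqrt (by norm_num)]
    norm_num
  have h1 : star (plusState n) ⬝ᵥ plusState n = 1 := by
    simp only [dotProduct, plusState, Pi.star_apply, RCLike.star_def, map_pow, ← mul_pow, hsqrt]
    simp
  have h2 : star Q.state ⬝ᵥ Q.state = ((∑ z, Q.outputProb z : ℝ) : ℂ) := by
    rw [Complex.ofReal_sum, dotProduct]
    refine Finset.sum_congr rfl fun z _ => ?_
    rw [outputProb, ← Complex.normSq_eq_norm_sq, Pi.star_apply, RCLike.star_def,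
      Complex.normSq_eq_conj_mul_self]
  rw [h1] at h
  exact_mod_cast h2.symm.trans h

end QAOA

/-! ### The factors of a circuit represent its output distribution -/

theorem foldl_extend_length (S l : List (List (Bool × Bool))) :
    (S.foldl (fun t w => ((false, false) :: w) :: ((false, true) :: w) ::
      ((true, false) :: w) :: ((true, true) :: w) :: t) l).length = 4 * S.length + l.length := by
  induction S generalizing l with
  | nil => simp
  | cons w S ih =>
    rw [List.foldl_cons, ih]
    simp only [List.length_cons]
    omega

theorem mem_foldl_extend (S l : List (List (Bool × Bool))) (u : List (Bool × Bool))
    (h : u ∈ l ∨ ∃ c, ∃ w ∈ S, u = c :: w) :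
    u ∈ S.foldl (fun t w => ((false, false) :: w) :: ((false, true) :: w) ::
      ((true, false) :: w) :: ((true, true) :: w) :: t) l := by
  induction S generalizing l with
  | nil => simpa using h
  | cons w S ih =>
    rw [List.foldl_cons]
    apply ih
    rcases h with h | ⟨c, w', hw', rfl⟩
    · left
      simp [h]
    · rcases List.mem_cons.1 hw' with rfl | hw'
      · left
        obtain ⟨_ | _, _ | _⟩ := c <;> simp
      · exact Or.inr ⟨c, w', hw', rfl⟩

theorem words_succ (k : ℕ) : words (k + 1) = extendWords (words k) :=
  Function.iterate_succ_apply' _ _ _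

theorem length_words (k : ℕ) : (words k).length = 4 ^ k := by
  induction k with
  | zero => rfl
  | succ k ih => rw [words_succ, extendWords, foldl_extend_length, ih]; simp [pow_succ']

theorem mem_words (w : List (Bool × Bool)) : w ∈ words w.length := by
  induction w with
  | nil => simp [words]
  | cons c w ih =>
    rw [List.length_cons, words_succ]
    exact mem_foldl_extend _ _ _ (Or.inr ⟨c, w, ih, rfl⟩)

/-- Every word occurs in the list, and the list has exactly 4^(p+1) entries. Equality of
cardinalities then gives injectivity, with no separate proof that the list has no repetitions. -/
theorem letter_bijective (p : ℕ) : Function.Bijective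
    (fun (i : Fin (words (p + 1)).length) (k : Fin (p + 1)) => letter (words (p + 1)) i k) := by
  rw [Fintype.bijective_iff_surjective_and_card]
  constructor
  · intro w
    have h := mem_words (List.ofFn w)
    rw [List.length_ofFn] at h
    obtain ⟨i, hi, hiw⟩ := List.getElem_of_mem h
    refine ⟨⟨i, hi⟩, funext fun k => ?_⟩
    simp [letter, List.getD_eq_getElem?_getD, hi, hiw, Nat.lt_succ_iff.1 k.2, -List.ofFn_succ]
  · simp [length_words]

/-- The words as functions. -/
noncomputable def wordEquiv (p : ℕ) :
    Fin (words (p + 1)).length ≃ (Fin (p + 1) → Bool × Bool) :=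
  Equiv.ofBijective _ (letter_bijective p)

theorem list_prod_range (p : ℕ) (f : ℕ → ℂ) :
    ((List.range p).map f).prod = ∏ k : Fin p, f k := by
  rw [← List.prod_toFinset _ List.nodup_range, List.toFinset_range, Finset.prod_range]

theorem prod_boole_eq_one_iff (p : ℕ) (P : ℕ → Prop) [DecidablePred P] :
    ((List.range p).map fun k => if P k then (1 : ℂ) else 0).prod = 1 ↔ ∀ k < p, P k := by
  rw [list_prod_range, Finset.prod_boole]
  constructor
  · intro h k hk
    by_contra hP
    rw [if_neg (fun h' => hP (h' ⟨k, hk⟩ (Finset.mem_univ _)))] at h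
    exact zero_ne_one h
  · intro h
    rw [if_pos fun (k : Fin p) _ => h k k.2]

/-- A term may list a variable on which it does not depend, and such a variable creates no edge of
the interaction graph. This invariance lets `termFactor` drop it without changing the weight. -/
theorem termWeight_of_sndTrivial {p : ℕ} {g : List ((ℂ × ℂ) × (ℂ × ℂ))} (h : SndTrivial p g)
    (w u u' : ℕ → Bool × Bool) : termWeight p g w u = termWeight p g w u' := by
  classical
  rw [SndTrivial, prod_boole_eq_one_iff p fun k =>
    (g.getD k ((0, 0), (0, 0))).1.1 = (g.getD k ((0, 0), (0, 0))).1.2 ∧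
    (g.getD k ((0, 0), (0, 0))).2.1 = (g.getD k ((0, 0), (0, 0))).2.2] at h
  rw [termWeight, termWeight]
  congr 1
  refine List.map_congr_left fun k hk => ?_
  obtain ⟨h1, h2⟩ := h k (List.mem_range.1 hk)
  simp only [gateEntry, h1, h2, ite_self]

theorem termWeight_of_fstTrivial {p : ℕ} {g : List ((ℂ × ℂ) × (ℂ × ℂ))} (h : FstTrivial p g)
    (w w' u : ℕ → Bool × Bool) : termWeight p g w u = termWeight p g w' u := by
  classical
  rw [FstTrivial, prod_boole_eq_one_iff p fun k =>
    (g.getD k ((0, 0), (0, 0))).1.1 = (g.getD k ((0, 0), (0, 0))).2.1 ∧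
    (g.getD k ((0, 0), (0, 0))).1.2 = (g.getD k ((0, 0), (0, 0))).2.2] at h
  rw [termWeight, termWeight]
  congr 1
  refine List.map_congr_left fun k hk => ?_
  obtain ⟨h1, h2⟩ := h k (List.mem_range.1 hk)
  simp only [gateEntry, h1, h2, ite_self]

theorem weight_foldl_cons {α : Type*} (g : α → Factor) (l : List α) (F : List Factor) (σ : ℕ → ℕ) :
    Factor.weight (l.foldl (fun F t => g t :: F) F) σ
      = (l.map fun t => Factor.value σ (g t)).prod * Factor.weight F σ := by
  induction l generalizing F with
  | nil => simp
  | cons t l ih =>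
    rw [List.foldl_cons, ih, List.map_cons, List.prod_cons, Factor.weight, List.map_cons,
      List.prod_cons, ← Factor.weight]
    ring

theorem mem_foldl_cons {α β : Type*} (g : α → β) (l : List α) (F : List β) (f : β) :
    f ∈ l.foldl (fun F t => g t :: F) F ↔ f ∈ F ∨ ∃ t ∈ l, f = g t := by
  induction l generalizing F with
  | nil => simp
  | cons t l ih =>
    rw [List.foldl_cons, ih]
    simp only [List.mem_cons, exists_eq_or_imp]
    tauto

theorem length_foldl_cons {α β : Type*} (g : α → β) (l : List α) (F : List β) :
    (l.foldl (fun F t => g t :: F) F).length = l.length + F.length := by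
  induction l generalizing F with
  | nil => simp
  | cons t l ih => rw [List.foldl_cons, ih, List.length_cons, List.length_cons]; omega

theorem list_prod_map_prod {α : Type*} {p : ℕ} (l : List α) (f : α → Fin p → ℂ) :
    (l.map fun t => ∏ k, f t k).prod = ∏ k, (l.map fun t => f t k).prod := by
  induction l with
  | nil => simp
  | cons t l ih => simp only [List.map_cons, List.prod_cons, ih, Finset.prod_mul_distrib]

namespace QAOA

variable {n p : ℕ}

/-- The factors of the circuit of a QAOA instance. -/
noncomputable def factors (Q : QAOA n p) : List Factor :=
  circuitFactors n p (words (p + 1)).length (words (p + 1)) Q.circuit.2.2.1 Q.circuit.2.2.2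

/-- The factors, conditioned on the last measured bits. -/
noncomputable def conditioned (Q : QAOA n p) : List Bool → List Factor
  | [] => Q.factors
  | b :: l => bitFactor p (words (p + 1)).length (words (p + 1)) (n - l.length).pred b ::
      Q.conditioned l

/-- The last measured bits of `z` are `l`. -/
def EndsWith (z : Fin n → Bool) (l : List Bool) : Prop :=
  (List.ofFn z).drop (n - l.length) = l

theorem endsWith_nil (z : Fin n → Bool) : EndsWith z [] := by simp [EndsWith]

/-- Bits are drawn from position n - 1 downwards, each prepended to those already known. The
predecessor of n minus the current length is the next position, as in the sampler's state. -/
theorem endsWith_cons (z : Fin n → Bool) (b : Bool) (l : List Bool) (h : l.length < n) :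
    EndsWith z (b :: l) ↔ z ⟨(n - l.length).pred, by
      rw [Nat.pred_eq_sub_one]; omega⟩ = b ∧ EndsWith z l := by
  have h1 : n - (b :: l).length = (n - l.length).pred := by
    rw [List.length_cons, Nat.pred_eq_sub_one]; omega
  have h2 : (n - l.length).pred < (List.ofFn z).length := by
    rw [List.length_ofFn, Nat.pred_eq_sub_one]; omega
  have h3 : (n - l.length).pred + 1 = n - l.length := by
    rw [Nat.pred_eq_sub_one]; omega
  rw [EndsWith, h1, List.drop_eq_getElem_cons h2, h3, List.cons.injEq, List.getElem_ofFn, EndsWith]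

theorem endsWith_iff_eq (z : Fin n → Bool) (l : List Bool) (h : l.length = n) :
    EndsWith z l ↔ List.ofFn z = l := by
  rw [EndsWith, h, Nat.sub_self, List.drop_zero]

variable (Q : QAOA n p) (τ : Fin n → Fin (words (p + 1)).length)

/-- The forward path encoded in an assignment of words. -/
noncomputable def fwd (τ : Fin n → Fin (words (p + 1)).length) (k : Fin (p + 1)) (v : Fin n) : Bool :=
  (letter (words (p + 1)) (τ v) k).1

/-- The backward path encoded in an assignment of words. -/
noncomputable def bwd (τ : Fin n → Fin (words (p + 1)).length) (k : Fin (p + 1)) (v : Fin n) : Bool :=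
  (letter (words (p + 1)) (τ v) k).2

theorem extend_fin (v : Fin n) : Factor.extend τ (fun _ => 0) v = τ v := by
  simp [Factor.extend]

theorem value_pathFactor (mix : List (ℂ × ℂ)) (v : Fin n) :
    Factor.value (Factor.extend τ fun _ => 0)
        (pathFactor p (words (p + 1)).length (words (p + 1)) mix v)
      = pathWeight p mix (letter (words (p + 1)) (τ v)) := by
  simp only [Factor.value, pathFactor, extend_fin]
  exact tableEntry_mkTable _ (τ v).2 (τ v).2

theorem value_bitFactor (v : Fin n) (b : Bool) :
    Factor.value (Factor.extend τ fun _ => 0)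
        (bitFactor p (words (p + 1)).length (words (p + 1)) v b)
      = if fwd τ (Fin.last p) v = b then 1 else 0 := by
  simp only [Factor.value, bitFactor, extend_fin]
  rw [tableEntry_mkTable _ (τ v).2 (τ v).2]
  exact if_congr beq_iff_eq rfl rfl

theorem value_termFactor (g : List ((ℂ × ℂ) × (ℂ × ℂ))) (a b : Fin n) :
    Factor.value (Factor.extend τ fun _ => 0)
        (termFactor p (words (p + 1)).length (words (p + 1)) (((a : ℕ), (b : ℕ)), g))
      = termWeight p g (letter (words (p + 1)) (τ a)) (letter (words (p + 1)) (τ b)) := by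
  simp only [Factor.value, termFactor]
  split_ifs with h1 h2
  · simp only [extend_fin]
    rw [tableEntry_mkTable _ (τ a).2 (τ a).2]
    exact termWeight_of_sndTrivial h1 _ _ _
  · simp only [extend_fin]
    rw [tableEntry_mkTable _ (τ b).2 (τ b).2]
    exact termWeight_of_fstTrivial h2 _ _ _
  · simp only [extend_fin]
    exact tableEntry_mkTable _ (τ a).2 (τ b).2

theorem termWeight_gates (t : LocalTerm n) :
    termWeight p (List.ofFn fun k : Fin p => t.gate (Q.γ k)) (letter (words (p + 1)) (τ t.fst))
        (letter (words (p + 1)) (τ t.snd))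
      = ∏ k : Fin p, gateEntry (t.gate (Q.γ k)) (fwd τ k.castSucc t.fst) (fwd τ k.castSucc t.snd) *
          starRingEnd ℂ (gateEntry (t.gate (Q.γ k)) (bwd τ k.castSucc t.fst)
            (bwd τ k.castSucc t.snd)) := by
  rw [termWeight, list_prod_range]
  refine Finset.prod_congr rfl fun k _ => ?_
  have : (List.ofFn fun k : Fin p => t.gate (Q.γ k)).getD k ((0, 0), (0, 0)) = t.gate (Q.γ k) := by
    simp [List.getD_eq_getElem?_getD]
  rw [this]
  rfl

theorem pathWeight_mixGates (v : Fin n) :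
    pathWeight p (List.ofFn Q.mixGate) (letter (words (p + 1)) (τ v))
      = (if fwd τ (Fin.last p) v = bwd τ (Fin.last p) v then 1 else 0) *
        ∏ k : Fin p, mixEntry (Q.mixGate k) (fwd τ k.succ v) (fwd τ k.castSucc v) *
          starRingEnd ℂ (mixEntry (Q.mixGate k) (bwd τ k.succ v) (bwd τ k.castSucc v)) := by
  rw [pathWeight, list_prod_range]
  congr 1
  · exact if_congr beq_iff_eq rfl rfl
  refine Finset.prod_congr rfl fun k _ => ?_
  have : (List.ofFn Q.mixGate).getD k (0, 0) = Q.mixGate k := by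
    simp [List.getD_eq_getElem?_getD]
  rw [this]
  rfl

/-- The factors are grouped by qubit and by term, the amplitudes by layer; exchanging the products
matches them. The last-letter test of each `pathWeight` makes the two paths end in the same string.
-/
theorem weight_factors :
    Factor.weight Q.factors (Factor.extend τ fun _ => 0)
      = if fwd τ (Fin.last p) = bwd τ (Fin.last p) then
          Q.amplitude (fwd τ) * starRingEnd ℂ (Q.amplitude (bwd τ)) else 0 := by
  have hpath : Factor.weight ((List.range n).map
      (pathFactor p (words (p + 1)).length (words (p + 1)) (List.ofFn Q.mixGate)))
        (Factor.extend τ fun _ => 0)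
      = (if fwd τ (Fin.last p) = bwd τ (Fin.last p) then 1 else 0) *
        ∏ k : Fin p, ((∏ v, mixEntry (Q.mixGate k) (fwd τ k.succ v) (fwd τ k.castSucc v)) *
          starRingEnd ℂ (∏ v, mixEntry (Q.mixGate k) (bwd τ k.succ v) (bwd τ k.castSucc v))) := by
    rw [Factor.weight, List.map_map, list_prod_range]
    simp only [Function.comp_apply, value_pathFactor, pathWeight_mixGates, Finset.prod_mul_distrib,
      map_prod]
    rw [Finset.prod_comm, Finset.prod_comm (s := (Finset.univ : Finset (Fin n))), Finset.prod_boole]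
    simp only [Finset.mem_univ, true_imp_iff, funext_iff]
  have hterm : (Q.circuit.2.2.1.map fun t => Factor.value (Factor.extend τ fun _ => 0)
      (termFactor p (words (p + 1)).length (words (p + 1)) t)).prod
      = ∏ k : Fin p, ((Q.terms.map fun t => gateEntry (t.gate (Q.γ k)) (fwd τ k.castSucc t.fst)
            (fwd τ k.castSucc t.snd)).prod *
          starRingEnd ℂ (Q.terms.map fun t => gateEntry (t.gate (Q.γ k)) (bwd τ k.castSucc t.fst)
            (bwd τ k.castSucc t.snd)).prod) := by
    simp only [circuit, List.map_map, Function.comp_def, value_termFactor, termWeight_gates]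
    rw [list_prod_map_prod]
    refine Finset.prod_congr rfl fun k _ => ?_
    rw [map_list_prod, List.map_map, ← List.prod_map_mul]
    rfl
  rw [factors, circuitFactors, weight_foldl_cons, hterm]
  have : Q.circuit.2.2.2 = List.ofFn Q.mixGate := rfl
  rw [this, hpath, mul_left_comm, ← Finset.prod_mul_distrib, ite_mul, one_mul, zero_mul, amplitude,
    amplitude, map_prod, ← Finset.prod_mul_distrib]
  simp only [layer_apply, map_mul]
  congr 1
  refine Finset.prod_congr rfl fun k _ => ?_
  ring

open Classical in
theorem weight_conditioned (l : List Bool) (hl : l.length ≤ n) :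
    Factor.weight (Q.conditioned l) (Factor.extend τ fun _ => 0)
      = if EndsWith (fwd τ (Fin.last p)) l ∧ fwd τ (Fin.last p) = bwd τ (Fin.last p) then
          Q.amplitude (fwd τ) * starRingEnd ℂ (Q.amplitude (bwd τ)) else 0 := by
  induction l with
  | nil =>
    rw [conditioned, weight_factors]
    simp only [endsWith_nil, true_and]
  | cons b l ih =>
    have hl' : l.length < n := hl
    have hv : (n - l.length).pred < n := by rw [Nat.pred_eq_sub_one]; omega
    rw [conditioned, Factor.weight, List.map_cons, List.prod_cons, ← Factor.weight, ih hl'.le]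
    have := value_bitFactor τ ⟨_, hv⟩ b
    simp only at this
    rw [this, ite_mul, one_mul, zero_mul, ← ite_and]
    exact if_congr (by rw [endsWith_cons _ _ _ hl', and_assoc]) rfl rfl

/-- Assignments of words are pairs of paths. -/
noncomputable def pathEquiv (n p : ℕ) : (Fin n → Fin (words (p + 1)).length) ≃
    (Fin (p + 1) → Fin n → Bool) × (Fin (p + 1) → Fin n → Bool) where
  toFun τ := (fwd τ, bwd τ)
  invFun xy v := (wordEquiv p).symm fun k => (xy.1 k v, xy.2 k v)
  left_inv τ := by
    funext v
    rw [Equiv.symm_apply_eq]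
    rfl
  right_inv xy := by
    have h : ∀ (w : Fin (p + 1) → Bool × Bool) (k : Fin (p + 1)),
        letter (words (p + 1)) ((wordEquiv p).symm w) k = w k := fun w k =>
      congrFun ((wordEquiv p).apply_symm_apply w) k
    refine Prod.ext (funext fun k => funext fun v => ?_) (funext fun k => funext fun v => ?_)
    · simp only [fwd, h]
    · simp only [bwd, h]

-- Assignments of words are pairs of paths, and the surviving pairs share an endpoint. Sorting them
-- by this endpoint gives the path sums of the output probabilities over the strings with the
-- prescribed ending.
open Classical in
theorem contract_conditioned (l : List Bool) (hl : l.length ≤ n)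
    (hdeg : Factor.DegreeLeTwo (Q.conditioned l)) :
    Factor.contract n (words (p + 1)).length (Q.conditioned l)
      = ((2 ^ n * ∑ z, if EndsWith z l then Q.outputProb z else 0 : ℝ) : ℂ) := by
  have hD : 0 < (words (p + 1)).length := by rw [length_words]; positivity
  rw [Factor.contract_eq hD hdeg]
  simp only [weight_conditioned Q _ l hl]
  refine (Fintype.sum_equiv (pathEquiv n p) _ (fun xy => if EndsWith (xy.1 (Fin.last p)) l ∧
      xy.1 (Fin.last p) = xy.2 (Fin.last p) then
        Q.amplitude xy.1 * starRingEnd ℂ (Q.amplitude xy.2) else 0) fun τ => rfl).trans ?_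
  rw [Fintype.sum_prod_type]
  push_cast
  rw [Finset.mul_sum]
  have h : ∀ z, (2 : ℂ) ^ n * ((if EndsWith z l then Q.outputProb z else 0 : ℝ) : ℂ)
      = ∑ x : Fin (p + 1) → Fin n → Bool, ∑ y : Fin (p + 1) → Fin n → Bool,
          if EndsWith z l ∧ x (Fin.last p) = z ∧ y (Fin.last p) = z then
            Q.amplitude x * starRingEnd ℂ (Q.amplitude y) else 0 := by
    intro z
    split_ifs with hz
    · simp only [outputProb_eq, hz, true_and]
    · simp [hz]
  simp only [h]
  symm
  rw [Finset.sum_comm]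
  refine Finset.sum_congr rfl fun x _ => ?_
  rw [Finset.sum_comm]
  refine Finset.sum_congr rfl fun y _ => ?_
  -- The endpoint condition on x leaves a single measured string.
  rw [Finset.sum_eq_single (x (Fin.last p))]
  · exact if_congr (by rw [and_iff_right rfl, eq_comm (a := y _)]) rfl rfl
  · intro z _ hz
    rw [if_neg fun h => hz h.2.1.symm]
  · simp

/-! ### From the interaction graph to the links between factors -/

theorem dependsOnVar_snd {t : LocalTerm n} (h : t.fst ≠ t.snd) {a : Bool}
    (ha : t.table a false ≠ t.table a true) : DependsOnVar t.val t.snd := by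
  refine ⟨Function.update (fun _ => a) t.snd false, ?_⟩
  simp only [LocalTerm.val, flipBit, Function.update_self, Function.update_of_ne h]
  exact ha.symm

theorem dependsOnVar_fst {t : LocalTerm n} (h : t.fst ≠ t.snd) {a : Bool}
    (ha : t.table false a ≠ t.table true a) : DependsOnVar t.val t.fst := by
  refine ⟨Function.update (fun _ => a) t.fst false, ?_⟩
  simp only [LocalTerm.val, flipBit, Function.update_self, Function.update_of_ne h.symm]
  exact ha.symm

theorem getD_gates (t : LocalTerm n) {k : ℕ} (hk : k < p) :
    (List.ofFn fun k : Fin p => t.gate (Q.γ k)).getD k ((0, 0), (0, 0))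
      = t.gate (Q.γ ⟨k, hk⟩) := by
  simp [List.getD_eq_getElem?_getD, hk]

/-- Equal table values give equal gate entries. The converse can fail when phases differ by a
multiple of 2π; the test then discards a variable of the cost term, which only removes links. -/
theorem dependsOnVar_of_not_sndTrivial {t : LocalTerm n} (h : t.fst ≠ t.snd)
    (ht : ¬ SndTrivial p (List.ofFn fun k : Fin p => t.gate (Q.γ k))) :
    DependsOnVar t.val t.snd := by
  classical
  by_contra hd
  refine ht ((prod_boole_eq_one_iff p _).2 fun k hk => ?_)
  rw [getD_gates Q t hk]
  have h1 : ∀ a, t.table a false = t.table a true := fun a => by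
    by_contra ha
    exact hd (dependsOnVar_snd h ha)
  simp only [LocalTerm.gate, h1, and_self]

theorem dependsOnVar_of_not_fstTrivial {t : LocalTerm n} (h : t.fst ≠ t.snd)
    (ht : ¬ FstTrivial p (List.ofFn fun k : Fin p => t.gate (Q.γ k))) :
    DependsOnVar t.val t.fst := by
  classical
  by_contra hd
  refine ht ((prod_boole_eq_one_iff p _).2 fun k hk => ?_)
  rw [getD_gates Q t hk]
  have h1 : ∀ a, t.table false a = t.table true a := fun a => by
    by_contra ha
    exact hd (dependsOnVar_fst h ha)
  simp only [LocalTerm.gate, h1, and_self]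

/-- Path factors and terms failing to depend on one of their variables have a repeated label. A
factor with two labels has passed both tests, so its term depends on both variables. -/
theorem adj_of_mem_factors {f : Factor} (hf : f ∈ Q.factors) (hne : f.1.1 ≠ f.1.2) :
    ∃ a b : Fin n, f.1 = ((a : ℕ), (b : ℕ)) ∧ Q.interactionGraph.Adj a b := by
  rw [factors, circuitFactors, mem_foldl_cons] at hf
  rcases hf with hf | ⟨t', ht', rfl⟩
  · obtain ⟨v, -, rfl⟩ := List.mem_map.1 hf
    exact absurd rfl hne
  · obtain ⟨t, ht, rfl⟩ := List.mem_map.1 ht'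
    simp only [termFactor] at hne ⊢
    split_ifs at hne ⊢ with h1 h2
    · exact absurd rfl hne
    · exact absurd rfl hne
    · have hab : t.fst ≠ t.snd := fun h => hne (by simp [h])
      exact ⟨t.fst, t.snd, rfl, hab, t, ht, Q.dependsOnVar_of_not_fstTrivial hab h2,
        Q.dependsOnVar_of_not_sndTrivial hab h1⟩

/-- Bit factors have a single variable, so conditioning never creates a link. -/
theorem adj_of_linked {l : List Bool} {v w : ℕ} (h : Factor.Linked (Q.conditioned l) v w) :
    ∃ a b : Fin n, v = a ∧ w = b ∧ Q.interactionGraph.Adj a b := by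
  induction l with
  | nil =>
    obtain ⟨hne, f, hf, h | h⟩ := h
    · obtain ⟨a, b, hab, hadj⟩ := Q.adj_of_mem_factors hf (by rw [h]; exact hne)
      rw [h, Prod.mk.injEq] at hab
      exact ⟨a, b, hab.1, hab.2, hadj⟩
    · obtain ⟨a, b, hab, hadj⟩ := Q.adj_of_mem_factors hf (by rw [h]; exact hne.symm)
      rw [h, Prod.mk.injEq] at hab
      exact ⟨b, a, hab.2, hab.1, hadj.symm⟩
  | cons b l ih =>
    obtain ⟨hne, f, hf, h⟩ := h
    rw [conditioned, List.mem_cons] at hf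
    rcases hf with rfl | hf
    · simp only [bitFactor, Prod.mk.injEq] at h
      rcases h with h | h
      · exact absurd (h.1.symm.trans h.2) hne
      · exact absurd (h.2.symm.trans h.1) hne
    · exact ih ⟨hne, f, hf, h⟩

theorem degreeLeTwo_conditioned (hQ : Q.interactionDegree ≤ 2) (l : List Bool) :
    Factor.DegreeLeTwo (Q.conditioned l) := by
  classical
  intro v x y z hx hy hz
  obtain ⟨a, b, rfl, rfl, hb⟩ := Q.adj_of_linked hx
  obtain ⟨a', c, ha', rfl, hc⟩ := Q.adj_of_linked hy
  obtain ⟨a'', d, ha'', rfl, hd⟩ := Q.adj_of_linked hz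
  obtain rfl := Fin.ext ha'
  obtain rfl := Fin.ext ha''
  by_contra! hne
  have hsub : ({b, c, d} : Finset (Fin n)) ⊆ Q.interactionGraph.neighborFinset a := by
    intro e he
    simp only [Finset.mem_insert, Finset.mem_singleton] at he
    rw [SimpleGraph.mem_neighborFinset]
    rcases he with rfl | rfl | rfl
    exacts [hb, hc, hd]
  have hcard : ({b, c, d} : Finset (Fin n)).card = 3 :=
    Finset.card_eq_three.2 ⟨b, c, d, fun h => hne.1 (by rw [h]), fun h => hne.2.1 (by rw [h]),
      fun h => hne.2.2 (by rw [h]), rfl⟩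
  have h1 := Finset.card_le_card hsub
  have h2 : Q.interactionGraph.degree a ≤ Q.interactionDegree := by
    rw [interactionDegree]
    convert Q.interactionGraph.degree_le_maxDegree a
  rw [SimpleGraph.card_neighborFinset_eq_degree] at h1
  omega

theorem length_conditioned (l : List Bool) :
    (Q.conditioned l).length = Q.terms.length + n + l.length := by
  induction l with
  | nil =>
    rw [conditioned, factors, circuitFactors, length_foldl_cons]
    simp [circuit]
  | cons b l ih => rw [conditioned, List.length_cons, ih, List.length_cons]; omega

end QAOA

/-! ### Running times of the programs -/

namespace Prog

namespace CostBound

variable {Γ a b s : Ty} {e : ℕ} {P : ℕ → ℕ → Γ.Val → Prop}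

theorem of_le_const {f : Prog Γ a} (C : ℕ) (h : ∀ x, f.cost x ≤ C) : CostBound e P f := by
  refine ⟨C, fun N M x hN hM _ => ?_⟩
  calc f.cost x ≤ C := h x
    _ ≤ 2 ^ C := Nat.lt_two_pow_self.le
    _ ≤ N ^ C := Nat.pow_le_pow_left hN C
    _ ≤ M ^ e * N ^ C := Nat.le_mul_of_pos_left _ (Nat.pow_pos hM)

/-- Programs without branches and loops. -/
theorem straight {f : Prog Γ a} (h : ∀ x, Nat.ble (f.cost x) 99 = true) : CostBound e P f :=
  -- The number 99 is an arbitrary ceiling for the loop-free pieces. With a Boolean comparison, each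
  -- instance is settled by evaluation.
  of_le_const 99 fun x => Nat.le_of_ble_eq_true (h x)

theorem wk' {Q : ℕ → ℕ → (Ty.prod Γ b).Val → Prop} {f : Prog Γ a} (hf : CostBound e P f)
    (h : ∀ N M x, Q N M x → P N M x.1) : CostBound e Q (wk f : Prog (.prod Γ b) a) :=
  fst'.comp' hf h

theorem table' {Q : ℕ → ℕ → (Ty.prod (.prod Γ .nat) .nat).Val → Prop} {D : Prog Γ .nat}
    {f : Prog (.prod (.prod Γ .nat) .nat) .scalar} (hD : CostBound e P D)
    (h : ∀ N M x, P N M x → (D.eval x : ℕ) ≤ N) (hf : CostBound e Q f)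
    (hQ : ∀ N M x, P N M x → ∀ i j : ℕ, i ≤ N → j ≤ N → Q N M ((x, i), j)) :
    CostBound e P (table D f) :=
  tabulate' (Q := fun N M (y : (Ty.prod Γ .nat).Val) => P N M y.1 ∧ y.2 ≤ N) hD h
    (tabulate' (hD.wk' fun _ _ _ hx => hx.1) (fun N M _ hx => h N M _ hx.1) hf
      fun N M _ hx _ hj => hQ N M _ hx.1 _ _ hx.2 (hj.le.trans (h N M _ hx.1)))
    fun N M x hx _ hi => ⟨hx, hi.le.trans (h N M x hx)⟩

theorem entryAt' {M : Prog Γ tableTy} {i j : Prog Γ .nat} (hM : CostBound e P M)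
    (hi : CostBound e P i) (hj : CostBound e P j) (hi' : ∀ N M x, P N M x → (i.eval x : ℕ) ≤ N)
    (hj' : ∀ N M x, P N M x → (j.eval x : ℕ) ≤ N) : CostBound e P (entryAt M i j) :=
  nth' zero' (nth' nil' hM hi hi') hj hj'

theorem letterP' {S : Prog Γ (.list wordTy)} {i k : Prog Γ .nat} (hS : CostBound e P S)
    (hi : CostBound e P i) (hk : CostBound e P k) (hi' : ∀ N M x, P N M x → (i.eval x : ℕ) ≤ N)
    (hk' : ∀ N M x, P N M x → (k.eval x : ℕ) ≤ N) : CostBound e P (letterP S i k) :=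
  nth' (straight fun _ => rfl) (nth' nil' hS hi hi') hk hk'

theorem gateEntryP' {g : Prog Γ gateTy} {f f' : Prog Γ .bool} (hg : CostBound e P g)
    (hf : CostBound e P f) (hf' : CostBound e P f') : CostBound e P (gateEntryP g f f') :=
  hf.cond'
    (hf'.cond' ((hg.op fun _ => le_rfl).op fun _ => le_rfl) ((hg.op fun _ => le_rfl).op fun _ => le_rfl))
    (hf'.cond' ((hg.op fun _ => le_rfl).op fun _ => le_rfl) ((hg.op fun _ => le_rfl).op fun _ => le_rfl))

theorem mixEntryP' {g : Prog Γ (.prod .scalar .scalar)} {f f' : Prog Γ .bool}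
    (hg : CostBound e P g) (hf : CostBound e P f) (hf' : CostBound e P f') :
    CostBound e P (mixEntryP g f f') :=
  (hf.eqB' hf').cond' (hg.op fun _ => le_rfl) (hg.op fun _ => le_rfl)

theorem neighborP' {v w : Prog Γ .nat} {F : Prog Γ (.list factorTy)} (hv : CostBound 0 P v)
    (hw : CostBound 0 P w) (hF : CostBound 0 P F)
    (hlen : ∀ N M x, P N M x → List.length (F.eval x) ≤ M * N) :
    CostBound 1 P (neighborP v w F) := by
  have hv' : CostBound 0 (fun N M (y : (Ty.prod Γ (.prod .nat factorTy)).Val) => P N M y.1)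
      (wk v : Prog (.prod Γ (.prod .nat factorTy)) .nat) := hv.wk' fun _ _ _ hx => hx
  have hw' : CostBound 0 (fun N M (y : (Ty.prod Γ (.prod .nat factorTy)).Val) => P N M y.1)
      (wk w : Prog (.prod Γ (.prod .nat factorTy)) .nat) := hw.wk' fun _ _ _ hx => hx
  have h1 : CostBound 0 (fun N M (y : (Ty.prod Γ (.prod .nat factorTy)).Val) => P N M y.1)
      (loopFst : Prog (.prod Γ (.prod .nat factorTy)) .nat) := straight fun _ => rfl
  have h2 : CostBound 0 (fun N M (y : (Ty.prod Γ (.prod .nat factorTy)).Val) => P N M y.1)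
      (loopSnd : Prog (.prod Γ (.prod .nat factorTy)) .nat) := straight fun _ => rfl
  refine foldIn' 0 1 (hw.mono (Nat.zero_le _) fun _ _ _ h => h)
    (hF.mono (Nat.zero_le _) fun _ _ _ h => h) (by simpa only [pow_one] using hlen) ?_ le_rfl
  exact cond' ((h1.eqNat' hv').andB' ((h2.eqNat' hv').notB'.andB' (h2.eqNat' hw').notB')) h2
    (cond' ((h2.eqNat' hv').andB' ((h1.eqNat' hv').notB'.andB' (h1.eqNat' hw').notB')) h1
      (straight fun _ => rfl))

end CostBound

open CostBound

theorem costBound_dropTouchingP :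
    CostBound 1 (fun N M (x : elimTy.Val) => x.2.2.length ≤ M * N) dropTouchingP := by
  refine foldIn' 0 1 nil' (straight fun _ => rfl) (by simp only [pow_one]; exact fun _ _ _ h => h)
    ?_ le_rfl
  exact cond' (orB' (eqNat' (straight fun _ => rfl) (straight fun _ => rfl))
    (eqNat' (straight fun _ => rfl) (straight fun _ => rfl))) (straight fun _ => rfl)
    (straight fun _ => rfl)

/-- Context of the innermost loop of the elimination. -/
abbrev elimLoopTy : Ty :=
  .prod (.prod (.prod (.prod (.prod elimTy .nat) .nat) .nat) .nat) .nat

theorem costBound_localProdP : CostBound 1 (fun N M (x : elimLoopTy.Val) =>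
    x.1.1.1.1.1.2.2.length ≤ M * N ∧ x.1.1.2 ≤ N ∧ x.1.2 ≤ N ∧ x.2 ≤ N) localProdP := by
  refine foldIn' 0 1 one' (straight fun _ => rfl) (by simp only [pow_one]; exact fun _ _ _ h => h.1)
    ?_ le_rfl
  have hlv : ∀ x : Prog (.prod elimLoopTy (.prod .scalar factorTy)) .nat,
      CostBound 0 (fun N M (y : (Ty.prod elimLoopTy (.prod .scalar factorTy)).Val) =>
        y.1.1.1.1.1.1.2.2.length ≤ M * N ∧ y.1.1.1.2 ≤ N ∧ y.1.1.2 ≤ N ∧ y.1.2 ≤ N) x →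
      CostBound 0 (fun N M (y : (Ty.prod elimLoopTy (.prod .scalar factorTy)).Val) =>
        y.1.1.1.1.1.1.2.2.length ≤ M * N ∧ y.1.1.1.2 ≤ N ∧ y.1.1.2 ≤ N ∧ y.1.2 ≤ N)
        (localValueP x) := fun x hx =>
    cond' (hx.eqNat' (straight fun _ => rfl)) (straight fun _ => rfl)
      (cond' (hx.eqNat' (straight fun _ => rfl)) (straight fun _ => rfl) (straight fun _ => rfl))
  -- A local value is one of the three loop indices, hence at most N. This bounds the time to walk
  -- to a table entry whatever labels the factor carries.
  have hle : ∀ (x : Prog (.prod elimLoopTy (.prod .scalar factorTy)) .nat) (N M : ℕ)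
      (y : (Ty.prod elimLoopTy (.prod .scalar factorTy)).Val),
      (y.1.1.1.1.1.1.2.2.length ≤ M * N ∧ y.1.1.1.2 ≤ N ∧ y.1.1.2 ≤ N ∧ y.1.2 ≤ N) →
      @LE.le ℕ _ ((localValueP x).eval y) N := by
    rintro x N M y ⟨-, h1, h2, h3⟩
    simp only [localValueP, eval]
    split_ifs
    · exact h3
    · exact h1
    · exact h2
  refine mulS' (straight fun _ => rfl) (cond' (orB' (eqNat' (straight fun _ => rfl)
    (straight fun _ => rfl)) (eqNat' (straight fun _ => rfl) (straight fun _ => rfl))) ?_ one')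
  exact entryAt' (straight fun _ => rfl) (hlv _ (straight fun _ => rfl))
    (hlv _ (straight fun _ => rfl)) (hle _) (hle _)

/-- The table and the sum are loops of length at most N; only the neighbour scans, the innermost
product and the filtering pass run over the factors. These passes are not nested in each other, so
the M-exponent stays 1. -/
theorem costBound_elimP :
    CostBound 1 (fun N M (x : elimTy.Val) => x.1 ≤ N ∧ x.2.2.length ≤ M * N) elimP := by
  refine letIn' (Q := fun N M (x : (Ty.prod elimTy .nat).Val) =>
      x.1.1 ≤ N ∧ x.1.2.2.length ≤ M * N)
    (neighborP' (straight fun _ => rfl) (straight fun _ => rfl) (straight fun _ => rfl)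
      fun _ _ _ h => h.2) ?_ fun _ _ _ h => h
  refine letIn' (Q := fun N M (x : (Ty.prod (.prod elimTy .nat) .nat).Val) =>
      x.1.1.1 ≤ N ∧ x.1.1.2.2.length ≤ M * N)
    (neighborP' (straight fun _ => rfl) (straight fun _ => rfl) (straight fun _ => rfl)
      fun _ _ _ h => h.2) ?_ fun _ _ _ h => h
  refine consL' (pair' (straight fun _ => rfl) ?_)
    ((costBound_dropTouchingP.wk' fun _ _ _ h => h).wk' fun _ _ _ h => h.2)
  refine table' (Q := fun N M
      (x : (Ty.prod (.prod (.prod (.prod elimTy .nat) .nat) .nat) .nat).Val) =>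
      x.1.1.1.1.1 ≤ N ∧ x.1.1.1.1.2.2.length ≤ M * N ∧ x.1.2 ≤ N ∧ x.2 ≤ N)
    (straight fun _ => rfl) (fun _ _ _ h => h.1) ?_ fun _ _ _ h i j hi hj => ⟨h.1, h.2, hi, hj⟩
  exact sum_tabulate (straight fun _ => rfl) (fun _ _ _ h => h.1) costBound_localProdP
    fun N M x h i hi => ⟨h.2.1, h.2.2.1, h.2.2.2, hi.le.trans h.1⟩

/-- The precondition reserves room for n further factors, one for each elimination, so every list
met along the loop has length at most M · N. -/
theorem costBound_contractP :
    CostBound 1 (fun N M (x : (Ty.prod .nat (.prod .nat (.list factorTy))).Val) =>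
      x.1 ≤ N ∧ x.2.1 ≤ N ∧ x.2.2.length + x.1 ≤ M * N) contractP := by
  refine CostBound.comp' (Q := fun N M (F : List Factor) => F.length ≤ M * N)
    (CostBound.op (iterIn' (Q := fun N M (y : (Ty.prod (.prod .nat (.prod .nat (.list factorTy)))
        (.prod .nat (.list factorTy))).Val) => y.1.2.1 ≤ N ∧ y.2.2.length ≤ M * N)
      (straight fun _ => rfl) (straight fun _ => rfl) (fun _ _ _ h => h.1) ?_ ?_)
      fun _ => le_rfl) ?_ ?_
  · exact pair' (straight fun _ => rfl) (CostBound.comp' (straight fun _ => rfl) costBound_elimP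
      fun _ _ _ h => h)
  · intro N M x h j hj
    refine ⟨h.2.1, ?_⟩
    simp only [eval_contractStepP]
    have h1 := Factor.length_iterate_elim_le j x.2.1 x.2.2
    have h2 := h.2.2
    have hj' : j ≤ x.1 := Nat.le_of_lt hj
    exact h1.trans (le_trans (Nat.add_le_add_left hj' _) h2)
  · refine foldIn' 0 1 one' id' (by simp only [pow_one]; exact fun _ _ _ h => h) ?_ le_rfl
    exact mulS' (straight fun _ => rfl) (entryAt' (straight fun _ => rfl) natZero' natZero'
      (fun _ _ _ _ => Nat.zero_le _) fun _ _ _ _ => Nat.zero_le _)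
  · intro N M x h
    simp only [eval, eval_iterIn, eval_contractStepP]
    exact (Factor.length_iterate_elim_le x.1 x.2.1 x.2.2).trans h.2.2

/-- Size bounds for a circuit together with the number of words. -/
def EnvBound (N M : ℕ) (x : envTy.Val) : Prop :=
  x.1.1 ≤ N ∧ x.1.2.1 + 1 ≤ N ∧ x.2.2 ≤ N ∧ x.1.2.2.1.length ≤ M * N

theorem costBound_pathTableP : CostBound 0 EnvBound pathTableP := by
  refine table' (Q := fun N M (x : (Ty.prod (.prod envTy .nat) .nat).Val) =>
      EnvBound N M x.1.1 ∧ x.2 ≤ N)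
    (straight fun _ => rfl) (fun _ _ _ h => h.2.2.1) ?_ fun _ _ _ h i j hi hj => ⟨h, hj⟩
  refine mulS' (letIn' (Q := fun _ _ _ => True) (letterP' (straight fun _ => rfl)
    (straight fun _ => rfl) (straight fun _ => rfl) (fun _ _ _ h => h.2)
    fun _ _ _ h => (Nat.le_succ _).trans h.1.2.1)
    (cond' (eqB' (straight fun _ => rfl) (straight fun _ => rfl)) one' zero')
    fun _ _ _ _ => trivial) ?_
  refine prod_tabulate (Q := fun N M (x : (Ty.prod (.prod (.prod envTy .nat) .nat) .nat).Val) =>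
      x.1.2 ≤ N ∧ x.2 + 1 ≤ N) (straight fun _ => rfl)
    (fun _ _ _ h => (Nat.le_succ _).trans h.1.2.1) ?_
    fun N M x h i hi => ⟨h.2, (Nat.succ_le_of_lt hi).trans ((Nat.le_succ _).trans h.1.2.1)⟩
  refine letIn' (Q := fun N M (x : (Ty.prod (.prod (.prod (.prod envTy .nat) .nat) .nat)
      (.prod .scalar .scalar)).Val) => x.1.1.2 ≤ N ∧ x.1.2 + 1 ≤ N)
    (nth' (straight fun _ => rfl) (straight fun _ => rfl) (straight fun _ => rfl)
      fun _ _ _ h => (Nat.le_succ _).trans h.2) ?_ fun _ _ _ h => h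
  refine letIn' (Q := fun N M (x : (Ty.prod (.prod (.prod (.prod (.prod envTy .nat) .nat) .nat)
      (.prod .scalar .scalar)) spinTy).Val) => x.1.1.1.2 ≤ N ∧ x.1.1.2 + 1 ≤ N)
    (letterP' (straight fun _ => rfl) (straight fun _ => rfl) (straight fun _ => rfl)
      (fun _ _ _ h => h.1) fun _ _ _ h => (Nat.le_succ _).trans h.2) ?_ fun _ _ _ h => h
  refine letIn' (Q := fun _ _ _ => True)
    (letterP' (straight fun _ => rfl) (straight fun _ => rfl) (straight fun _ => rfl)
      (fun _ _ _ h => h.1) fun _ _ _ h => h.2) ?_ fun _ _ _ _ => trivial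
  exact mulS' (mixEntryP' (straight fun _ => rfl) (straight fun _ => rfl) (straight fun _ => rfl))
    (CostBound.op (mixEntryP' (straight fun _ => rfl) (straight fun _ => rfl)
      (straight fun _ => rfl)) fun _ => le_rfl)

theorem costBound_bitTableP :
    CostBound 0 (fun N M (x : (Ty.prod envTy .bool).Val) => EnvBound N M x.1) bitTableP := by
  refine table' (Q := fun N M (x : (Ty.prod (.prod (.prod envTy .bool) .nat) .nat).Val) =>
      EnvBound N M x.1.1.1 ∧ x.2 ≤ N)
    (straight fun _ => rfl) (fun _ _ _ h => h.2.2.1) ?_ fun _ _ _ h i j hi hj => ⟨h, hj⟩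
  exact cond' (eqB' (CostBound.op (letterP' (straight fun _ => rfl)
    (straight fun _ => rfl) (straight fun _ => rfl) (fun _ _ _ h => h.2)
    fun _ _ _ h => (Nat.le_succ _).trans h.1.2.1) fun _ => le_rfl) (straight fun _ => rfl))
    one' zero'

theorem costBound_termTableP :
    CostBound 0 (fun N M (x : (Ty.prod envTy termTy).Val) => EnvBound N M x.1) termTableP := by
  refine table' (Q := fun N M (x : (Ty.prod (.prod (.prod envTy termTy) .nat) .nat).Val) =>
      EnvBound N M x.1.1.1 ∧ x.1.2 ≤ N ∧ x.2 ≤ N)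
    (straight fun _ => rfl) (fun _ _ _ h => h.2.2.1) ?_ fun _ _ _ h i j hi hj => ⟨h, hi, hj⟩
  refine prod_tabulate (Q := fun N M
      (x : (Ty.prod (.prod (.prod (.prod envTy termTy) .nat) .nat) .nat).Val) =>
      x.1.1.2 ≤ N ∧ x.1.2 ≤ N ∧ x.2 ≤ N) (straight fun _ => rfl)
    (fun _ _ _ h => (Nat.le_succ _).trans h.1.2.1) ?_
    fun N M x h i hi => ⟨h.2.1, h.2.2, hi.le.trans ((Nat.le_succ _).trans h.1.2.1)⟩
  refine letIn' (Q := fun N M (x : (Ty.prod (.prod (.prod (.prod (.prod envTy termTy) .nat) .nat)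
      .nat) gateTy).Val) => x.1.1.1.2 ≤ N ∧ x.1.1.2 ≤ N ∧ x.1.2 ≤ N)
    (nth' (straight fun _ => rfl) (straight fun _ => rfl) (straight fun _ => rfl)
      fun _ _ _ h => h.2.2) ?_ fun _ _ _ h => h
  refine letIn' (Q := fun N M (x : (Ty.prod (.prod (.prod (.prod (.prod (.prod envTy termTy) .nat)
      .nat) .nat) gateTy) spinTy).Val) => x.1.1.1.2 ≤ N ∧ x.1.1.2 ≤ N)
    (letterP' (straight fun _ => rfl) (straight fun _ => rfl) (straight fun _ => rfl)
      (fun _ _ _ h => h.1) fun _ _ _ h => h.2.2) ?_ fun _ _ _ h => h.2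
  refine letIn' (Q := fun _ _ _ => True)
    (letterP' (straight fun _ => rfl) (straight fun _ => rfl) (straight fun _ => rfl)
      (fun _ _ _ h => h.1) fun _ _ _ h => h.2) ?_ fun _ _ _ _ => trivial
  exact mulS' (gateEntryP' (straight fun _ => rfl) (straight fun _ => rfl) (straight fun _ => rfl))
    (CostBound.op (gateEntryP' (straight fun _ => rfl) (straight fun _ => rfl)
      (straight fun _ => rfl)) fun _ => le_rfl)

/-- A test of all gates of a term. -/
theorem costBound_gateTest {c : Prog (.prod (.prod (.prod envTy termTy) .nat) gateTy) .bool}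
    (hc : CostBound 0 (fun _ _ _ => True) c) :
    CostBound 0 (fun N M (x : (Ty.prod envTy termTy).Val) => EnvBound N M x.1)
      (eqScalar (.comp prodL (tabulate (wk envDepth)
        (letIn (nth zeroGate (wk (.comp .snd .snd)) .snd) (.cond c .one .zero)))) .one) := by
  refine eqScalar' (prod_tabulate (Q := fun N M (x : (Ty.prod (.prod envTy termTy) .nat).Val) =>
    x.2 ≤ N) (straight fun _ => rfl) (fun _ _ _ h => (Nat.le_succ _).trans h.2.1) ?_
    fun N M x h i hi => hi.le.trans ((Nat.le_succ _).trans h.2.1)) one'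
  exact letIn' (Q := fun _ _ _ => True)
    (nth' (straight fun _ => rfl) (straight fun _ => rfl) (straight fun _ => rfl)
      fun _ _ _ h => h) (hc.cond' one' zero') fun _ _ _ _ => trivial

theorem costBound_termFactorP :
    CostBound 0 (fun N M (x : (Ty.prod envTy termTy).Val) => EnvBound N M x.1) termFactorP := by
  refine pair' (cond' (costBound_gateTest ?_) (straight fun _ => rfl)
    (cond' (costBound_gateTest ?_) (straight fun _ => rfl) (straight fun _ => rfl)))
    costBound_termTableP
  · exact andB' (eqScalar' (straight fun _ => rfl) (straight fun _ => rfl))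
      (eqScalar' (straight fun _ => rfl) (straight fun _ => rfl))
  · exact andB' (eqScalar' (straight fun _ => rfl) (straight fun _ => rfl))
      (eqScalar' (straight fun _ => rfl) (straight fun _ => rfl))

theorem costBound_circuitFactorsP : CostBound 1 EnvBound circuitFactorsP := by
  refine foldIn' 0 1 ?_ (straight fun _ => rfl) (by simp only [pow_one]; exact fun _ _ _ h => h.2.2.2)
    ?_ le_rfl
  · refine CostBound.mono (e := 0) (P := EnvBound) ?_ (Nat.zero_le _) fun _ _ _ h => h
    exact tabulate' (Q := fun N M (x : (Ty.prod envTy .nat).Val) => EnvBound N M x.1)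
      (straight fun _ => rfl) (fun _ _ _ h => h.1)
      (pair' (straight fun _ => rfl) (costBound_pathTableP.wk' fun _ _ _ h => h))
      fun _ _ _ h _ _ => h
  · exact consL' (CostBound.comp' (straight fun _ => rfl) costBound_termFactorP fun _ _ _ h => h)
      (straight fun _ => rfl)

theorem costBound_conditionP : CostBound 0
    (fun N M (x : (Ty.prod (.prod envTy samplerTy) .bool).Val) => EnvBound N M x.1.1)
    conditionP := by
  refine letIn' (Q := fun N M (x : (Ty.prod (.prod (.prod envTy samplerTy) .bool) .nat).Val) =>
    EnvBound N M x.1.1.1) (straight fun _ => rfl) ?_ fun _ _ _ h => h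
  exact consL' (pair' (straight fun _ => rfl) (wk' (CostBound.comp' (straight fun _ => rfl)
    costBound_bitTableP fun _ _ _ h => h) fun _ _ _ h => h)) (straight fun _ => rfl)

theorem costBound_updateP : CostBound 0
    (fun N M (x : (Ty.prod (.prod envTy samplerTy) .bool).Val) => EnvBound N M x.1.1)
    updateP :=
  pair' (straight fun _ => rfl) (pair' (straight fun _ => rfl) costBound_conditionP)

theorem costBound_biasP : CostBound 1
    (fun N M (x : (Ty.prod envTy samplerTy).Val) => EnvBound N M x.1 ∧
      x.2.2.2.length + 1 + x.1.1.1 ≤ M * N) biasP := by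
  refine CostBound.op (pair' ?_ ?_) fun _ => le_rfl
  · refine CostBound.comp' (pair' (straight fun _ => rfl) (pair' (straight fun _ => rfl)
      (CostBound.comp' (straight fun _ => rfl)
        (costBound_conditionP.mono (Nat.zero_le _) fun _ _ _ h => h) fun _ _ _ h => h.1)))
      costBound_contractP fun N M x h => ⟨h.1.1, h.1.2.2.1, ?_⟩
    simp only [eval, eval_conditionP]
    exact h.2
  · exact CostBound.comp' (straight fun _ => rfl) costBound_contractP
      fun N M x h => ⟨h.1.1, h.1.2.2.1, (Nat.add_le_add_right (Nat.le_succ _) _).trans h.2⟩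

/-- After j rounds there are 4^j words. Requiring 4^(p+1) ≤ N is the source of the exponential
dependence on the depth. -/
theorem costBound_wordsP :
    CostBound 0 (fun N _ (c : circuitTy.Val) => 4 ^ (c.2.1 + 1) ≤ N) wordsP := by
  refine iterIn' (Q := fun N M (x : (Ty.prod circuitTy (.list wordTy)).Val) => x.2.length ≤ N)
    (straight fun _ => rfl) (straight fun _ => rfl)
    (fun N M x h => (Nat.lt_pow_self (by norm_num : 1 < 4)).le.trans h) ?_ ?_
  · refine CostBound.comp' (Q := fun N M (l : List (List (Bool × Bool))) => l.length ≤ N) snd' ?_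
      fun _ _ _ h => h
    exact foldIn' 0 0 nil' id' (fun N M x h => h.trans (by simp)) (straight fun _ => rfl) le_rfl
  · intro N M x h j hj
    change (words j).length ≤ N
    rw [length_words]
    exact (Nat.pow_le_pow_right (by norm_num) (Nat.le_of_lt hj)).trans h

theorem costBound_setupP : CostBound 1 (fun N M (c : circuitTy.Val) =>
    c.1 ≤ N ∧ 4 ^ (c.2.1 + 1) ≤ N ∧ c.2.2.1.length ≤ M * N) setupP := by
  refine CostBound.comp' (Q := EnvBound) (pair' id' (CostBound.comp'
    (Q := fun N M (l : List (List (Bool × Bool))) => l.length ≤ N)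
    (costBound_wordsP.mono (Nat.zero_le _) fun _ _ _ h => h.2.1)
    (pair' id' ?_) fun N M x h => ?_)) ?_ fun N M x h => ?_
  · exact foldIn' 0 0 natZero' id' (fun N M x h => h.trans (by simp)) (straight fun _ => rfl)
      (Nat.zero_le _)
  · rw [eval_wordsP, length_words]
    exact h.2.1
  · exact pair' id' (pair' (pair' nil' (pair' (straight fun _ => rfl)
      costBound_circuitFactorsP)) (straight fun _ => rfl))
  · refine ⟨h.1, (Nat.lt_pow_self (by norm_num : 1 < 4)).le.trans h.2.1, ?_, h.2.2⟩
    have : envP.eval x = (x, (words (x.2.1 + 1), (words (x.2.1 + 1)).length)) := eval_envP x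
    change (envP.eval x).2.2 ≤ N
    rw [this]
    exact (length_words _).trans_le h.2.1

end Prog

/-! ### The law and the running time of the sampler -/

theorem coin_apply {q : ℝ} (h0 : 0 ≤ q) (h1 : q ≤ 1) (b : Bool) :
    coin q b = ENNReal.ofReal (if b then q else 1 - q) := by
  have h : min q.toNNReal 1 = q.toNNReal := min_eq_left (by simpa using h1)
  simp only [coin, PMF.ofFintype_apply, h]
  cases b
  · simp only [Bool.false_eq_true, if_false]
    rw [NNReal.sub_def, Real.coe_toNNReal _ h0]
    rfl
  · rfl

namespace Prog

/-- The bound holds for every outcome of the random bits. The invariant is indexed by the number of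
remaining rounds, since the cost of a round depends on how many bits are already fixed. -/
theorem iterRun_support_le {σ : Type} (step : σ → PMF (σ × ℕ)) (Inv : ℕ → σ → Prop) (B : ℕ)
    (h : ∀ j s, Inv (j + 1) s → ∀ r ∈ (step s).support, Inv j r.1 ∧ r.2 ≤ B) (k : ℕ) (s : σ)
    (hs : Inv k s) : ∀ r ∈ (iterRun step k s).support, r.2 ≤ k * (B + 1) := by
  induction k generalizing s with
  | zero =>
    intro r hr
    rw [iterRun, PMF.support_pure, Set.mem_singleton_iff] at hr
    simp [hr]
  | succ k ih =>
    intro r hr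
    rw [iterRun, PMF.mem_support_bind_iff] at hr
    obtain ⟨r₁, hr₁, hr⟩ := hr
    rw [PMF.mem_support_bind_iff] at hr
    obtain ⟨r₂, hr₂, hr⟩ := hr
    rw [PMF.support_pure, Set.mem_singleton_iff] at hr
    obtain ⟨hI, hB⟩ := h k s hs r₁ hr₁
    have := ih r₁.1 hI r₂ hr₂
    rw [hr]
    simp only
    rw [add_mul]
    omega

/-- The only random step of the sampler, stated for arbitrary `f` and `g` so that unfolding `run`
stops at them. The 5 counts `id`, `flip`, the pairing and the two compositions. -/
theorem run_comp_flip {Γ b : Ty} (f : Prog Γ .scalar) (g : Prog (.prod Γ .bool) b)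
    (hf : f.det = true) (hg : g.det = true) (x : Γ.Val) :
    Prog.run (.comp g (.pair .id (.comp .flip f))) x
      = (coin (Complex.re (f.eval x))).bind fun v =>
          PMF.pure (g.eval (x, v), f.cost x + g.cost (x, v) + 5) := by
  simp only [run, run_eq_pure _ hf, run_eq_pure _ hg, PMF.pure_bind, PMF.bind_bind]
  congr 1
  funext v
  congr 2
  omega

theorem run_drawBitP (x : (Ty.prod envTy samplerTy).Val) :
    drawBitP.run x = (coin (Complex.re (biasP.eval x))).bind fun b =>
      PMF.pure (updateP.eval (x, b), biasP.cost x + updateP.cost (x, b) + 5) :=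
  run_comp_flip _ _ det_biasP det_updateP x

theorem run_fst_comp_iter {Γ c a b : Ty} (f : Prog (.prod c (.prod a b)) (.prod a b))
    (g : Prog Γ (.prod c (.prod (.prod a b) .nat))) (hg : g.det = true) (x : Γ.Val) :
    Prog.run (.comp .fst (.comp (.iter f) g)) x
      = (iterRun (fun s => f.run ((g.eval x).1, s)) (g.eval x).2.2 (g.eval x).2.1).bind fun r =>
          PMF.pure (r.1.1, g.cost x + r.2 + 4) := by
  simp only [run, run_eq_pure _ hg, PMF.pure_bind, PMF.bind_bind]
  congr 1

theorem run_samplerP (c : circuitTy.Val) :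
    samplerP.run c = (iterRun (fun s => drawBitP.run ((setupP.eval c).1, s)) (setupP.eval c).2.2
      (setupP.eval c).2.1).bind fun r => PMF.pure (r.1.1, setupP.cost c + r.2 + 4) :=
  run_fst_comp_iter _ _ det_setupP c

end Prog

namespace QAOA

open Prog

variable {n p : ℕ} (Q : QAOA n p)

/-- The context of the sampler. -/
noncomputable def env : envTy.Val := (Q.circuit, (words (p + 1), (words (p + 1)).length))

/-- The state of the sampler after the bits `l` have been drawn. -/
noncomputable def samplerState (l : List Bool) : samplerTy.Val :=
  (l, (n - l.length, Q.conditioned l))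

open Classical in
/-- The probability that the measured string ends with `l`. -/
noncomputable def suffixProb (l : List Bool) : ℝ := ∑ z, if EndsWith z l then Q.outputProb z else 0

theorem outputProb_nonneg (z : Fin n → Bool) : 0 ≤ Q.outputProb z := by
  unfold outputProb
  positivity

theorem suffixProb_nonneg (l : List Bool) : 0 ≤ Q.suffixProb l :=
  Finset.sum_nonneg fun z _ => by split_ifs <;> [exact Q.outputProb_nonneg z; exact le_rfl]

theorem suffixProb_nil : Q.suffixProb [] = 1 := by
  simp only [suffixProb, endsWith_nil, if_true, sum_outputProb]

theorem outputProb_le_suffixProb {z : Fin n → Bool} {l : List Bool} (h : EndsWith z l) :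
    Q.outputProb z ≤ Q.suffixProb l := by
  classical
  have := Finset.single_le_sum (f := fun z => if EndsWith z l then Q.outputProb z else 0)
    (fun z _ => by split_ifs <;> [exact Q.outputProb_nonneg z; exact le_rfl]) (Finset.mem_univ z)
  simp only [h, if_true] at this
  exact this.trans_eq (by unfold suffixProb; congr!)

theorem suffixProb_cons_add (l : List Bool) (hl : l.length < n) :
    Q.suffixProb (true :: l) + Q.suffixProb (false :: l) = Q.suffixProb l := by
  classical
  unfold suffixProb
  rw [← Finset.sum_add_distrib]
  refine Finset.sum_congr rfl fun z _ => ?_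
  have hc := fun b => endsWith_cons z b l hl
  simp only [hc]
  by_cases h : EndsWith z l
  · cases z ⟨(n - l.length).pred, _⟩ <;> simp [h]
  · simp [h]

theorem suffixProb_full (z : Fin n → Bool) : Q.suffixProb (List.ofFn z) = Q.outputProb z := by
  rw [suffixProb, Finset.sum_eq_single z]
  · rw [if_pos]
    rw [endsWith_iff_eq _ _ (List.length_ofFn)]
  · intro z' _ hz'
    rw [if_neg]
    rw [endsWith_iff_eq _ _ (List.length_ofFn)]
    exact fun h => hz' (List.ofFn_injective h)
  · simp

theorem eval_setupP_circuit :
    setupP.eval Q.circuit = (Q.env, (Q.samplerState [], n)) := by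
  rw [eval_setupP]
  rfl

theorem eval_updateP_samplerState (l : List Bool) (b : Bool) :
    updateP.eval ((Q.env, Q.samplerState l), b) = Q.samplerState (b :: l) := by
  rw [eval_updateP]
  rfl

variable {Q}

/-- Both contractions carry the factor 2^n, which cancels. The identity also holds when the
denominator vanishes, because real and complex division by zero agree. -/
theorem eval_biasP_samplerState (hQ : Q.interactionDegree ≤ 2) (l : List Bool) (hl : l.length < n) :
    biasP.eval (Q.env, Q.samplerState l)
      = ((Q.suffixProb (true :: l) / Q.suffixProb l : ℝ) : ℂ) := by
  rw [eval_biasP]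
  change Factor.contract n (words (p + 1)).length (Q.conditioned (true :: l)) /
    Factor.contract n (words (p + 1)).length (Q.conditioned l) = _
  rw [contract_conditioned Q (true :: l) hl (Q.degreeLeTwo_conditioned hQ _),
    contract_conditioned Q l hl.le (Q.degreeLeTwo_conditioned hQ _), ← Complex.ofReal_div,
    mul_div_mul_left _ _ (by positivity)]
  rfl

theorem run_drawBitP_samplerState (hQ : Q.interactionDegree ≤ 2) (l : List Bool)
    (hl : l.length < n) : drawBitP.run (Q.env, Q.samplerState l)
      = (coin (Q.suffixProb (true :: l) / Q.suffixProb l)).bind fun b =>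
          PMF.pure (Q.samplerState (b :: l), biasP.cost (Q.env, Q.samplerState l) +
            updateP.cost ((Q.env, Q.samplerState l), b) + 5) := by
  rw [run_drawBitP, eval_biasP_samplerState hQ l hl, Complex.ofReal_re]
  congr 1
  funext b
  rw [eval_updateP_samplerState]

/-- Once the current suffix has positive mass, additivity puts the quotient in [0, 1]. The cut-off
in `coin` is then inactive and both outcomes have their true conditional probabilities. -/
theorem coin_bias (l : List Bool) (hl : l.length < n) (h0 : Q.suffixProb l ≠ 0) (b : Bool) :
    coin (Q.suffixProb (true :: l) / Q.suffixProb l) b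
      = ENNReal.ofReal (Q.suffixProb (b :: l) / Q.suffixProb l) := by
  have hpos : 0 < Q.suffixProb l := lt_of_le_of_ne (Q.suffixProb_nonneg l) h0.symm
  have hadd := Q.suffixProb_cons_add l hl
  have hf := Q.suffixProb_nonneg (false :: l)
  rw [coin_apply (div_nonneg (Q.suffixProb_nonneg _) hpos.le)
    ((div_le_one hpos).2 (by linarith))]
  cases b
  · simp only [Bool.false_eq_true, if_false]
    congr 1
    rw [eq_div_iff h0, sub_mul, div_mul_cancel₀ _ h0]
    linarith
  · rfl

open Classical in
/-- The law of the output of the sampler after the bits `l` have been drawn. -/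
theorem iterRun_drawBitP_apply (hQ : Q.interactionDegree ≤ 2) (k : ℕ) (l : List Bool)
    (hl : l.length + k = n) (h0 : Q.suffixProb l ≠ 0) (z : Fin n → Bool) :
    ((iterRun (fun s => drawBitP.run (Q.env, s)) k (Q.samplerState l)).map fun r => r.1.1)
        (List.ofFn z)
      = ENNReal.ofReal (if EndsWith z l then Q.outputProb z / Q.suffixProb l else 0) := by
  induction k generalizing l with
  | zero =>
    rw [iterRun, PMF.pure_map, PMF.pure_apply]
    change @ite ℝ≥0∞ (List.ofFn z = l) (Classical.propDecidable _) 1 0 = _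
    rw [endsWith_iff_eq _ _ (by simpa using hl)]
    split_ifs with h
    · subst h
      rw [suffixProb_full] at h0 ⊢
      rw [div_self h0, ENNReal.ofReal_one]
    · rw [ENNReal.ofReal_zero]
  | succ k ih =>
    have hl' : l.length < n := by omega
    have hb : ∀ b, coin (Q.suffixProb (true :: l) / Q.suffixProb l) b *
        ((iterRun (fun s => drawBitP.run (Q.env, s)) k (Q.samplerState (b :: l))).map
          fun r => r.1.1) (List.ofFn z)
        = ENNReal.ofReal (if EndsWith z (b :: l) then Q.outputProb z / Q.suffixProb l else 0) := by
      intro b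
      rw [coin_bias l hl' h0]
      -- A suffix of mass zero is never drawn, and the output probabilities below it vanish as well,
      -- so the induction hypothesis is not needed there. Otherwise the two quotients telescope.
      by_cases hb0 : Q.suffixProb (b :: l) = 0
      · rw [hb0, zero_div, ENNReal.ofReal_zero, zero_mul]
        split_ifs with h
        · have := Q.outputProb_le_suffixProb h
          rw [hb0] at this
          rw [le_antisymm this (Q.outputProb_nonneg z), zero_div, ENNReal.ofReal_zero]
        · rw [ENNReal.ofReal_zero]
      · rw [ih (b :: l) (by rw [List.length_cons]; omega) hb0,
          ← ENNReal.ofReal_mul (div_nonneg (Q.suffixProb_nonneg _) (Q.suffixProb_nonneg _))]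
        congr 1
        split_ifs
        · field_simp
        · rw [mul_zero]
    have hrun : (iterRun (fun s => drawBitP.run (Q.env, s)) (k + 1) (Q.samplerState l)).map
          (fun r => r.1.1)
        = (coin (Q.suffixProb (true :: l) / Q.suffixProb l)).bind fun b =>
          (iterRun (fun s => drawBitP.run (Q.env, s)) k (Q.samplerState (b :: l))).map
            fun r => r.1.1 := by
      rw [iterRun, run_drawBitP_samplerState hQ l hl', PMF.bind_bind, PMF.map_bind]
      congr 1
      funext b
      rw [PMF.pure_bind, PMF.map_bind]
      simp only [PMF.pure_map]
      rfl
    rw [hrun, PMF.bind_apply, tsum_fintype, Fintype.sum_bool]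
    rw [hb true, hb false, ← ENNReal.ofReal_add]
    · congr 1
      have hc := fun b => endsWith_cons z b l hl'
      simp only [hc]
      by_cases h : EndsWith z l
      · cases z ⟨(n - l.length).pred, _⟩ <;> simp [h]
      · simp [h]
    · split_ifs
      · exact div_nonneg (Q.outputProb_nonneg z) (Q.suffixProb_nonneg l)
      · exact le_rfl
    · split_ifs
      · exact div_nonneg (Q.outputProb_nonneg z) (Q.suffixProb_nonneg l)
      · exact le_rfl

theorem samplesExactly (hQ : Q.interactionDegree ≤ 2) : SamplesExactly samplerP Q := by
  intro z
  rw [run_samplerP, eval_setupP_circuit, PMF.map_bind]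
  simp only [PMF.pure_map]
  have := iterRun_drawBitP_apply hQ n [] (by simp) (by rw [suffixProb_nil]; exact one_ne_zero) z
  rw [if_pos (endsWith_nil z), suffixProb_nil, div_one] at this
  exact this

/-- The running time is linear in the number of terms and polynomial in `n` and `4 ^ p`. -/
theorem exists_cost_le : ∃ k : ℕ, ∀ (n p : ℕ) (Q : QAOA n p), 0 < n →
    ∀ r ∈ (samplerP.run Q.circuit).support,
      r.2 ≤ (Q.terms.length + 1) * (n * 4 ^ (p + 2)) ^ k := by
  obtain ⟨k₁, h₁⟩ := costBound_setupP
  obtain ⟨k₂, h₂⟩ := costBound_biasP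
  obtain ⟨k₃, h₃⟩ := costBound_updateP.mono (e' := 1) (Nat.zero_le _) fun _ _ _ h => h
  -- The 3 comes from the loop over the bits, each 2 from one use of `polyBound_add`. The uses with
  -- second summand 1 absorb the additive constants 5 of a round and 4 of the whole run.
  refine ⟨k₁ + (k₂ + k₃ + 2 + 2 + 2 + 3) + 2 + 2 + 2, fun n p Q hn r hr => ?_⟩
  -- The spare factor 16 over n · 4^p makes N dominate 2, 3n + 1, p + 1 and the number of words at
  -- once.
  set N := n * 4 ^ (p + 2) with hNdef
  set M := Q.terms.length + 1 with hMdef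
  have hp4 : 1 ≤ 4 ^ p := Nat.one_le_pow _ _ (by norm_num)
  have hN' : N = 16 * (n * 4 ^ p) := by rw [hNdef, pow_add]; ring
  have hnp : n ≤ n * 4 ^ p := Nat.le_mul_of_pos_right _ hp4
  have hnp' : 4 ^ p ≤ n * 4 ^ p := Nat.le_mul_of_pos_left _ hn
  have hN2 : 2 ≤ N := by omega
  have hM1 : 1 ≤ M := by omega
  have hw : (words (p + 1)).length ≤ N := by
    rw [length_words, pow_succ]
    omega
  -- One factor per term, n path factors, fewer than n bit factors, the tentative new bit factor,
  -- and up to n factors added by a contraction.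
  have hMN : Q.terms.length + 3 * n + 1 ≤ M * N := by
    have : 3 * n + 1 ≤ N := by omega
    calc Q.terms.length + 3 * n + 1 ≤ Q.terms.length * N + N := by
          have := Nat.le_mul_of_pos_right Q.terms.length (show 0 < N by omega)
          omega
      _ = M * N := by rw [hMdef]; ring
  have hts : Q.circuit.2.2.1.length = Q.terms.length := by simp [circuit]
  have henv : EnvBound N M Q.env := by
    refine ⟨?_, ?_, hw, ?_⟩
    · change n ≤ N
      omega
    · change p + 1 ≤ N
      have : p < 4 ^ p := Nat.lt_pow_self (by norm_num)
      omega
    · change Q.circuit.2.2.1.length ≤ M * N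
      omega
  have hc₁ : setupP.cost Q.circuit ≤ M ^ 1 * N ^ k₁ := by
    refine h₁ N M _ hN2 hM1 ⟨?_, ?_, by omega⟩
    · change n ≤ N
      omega
    · change 4 ^ (p + 1) ≤ N
      rw [← length_words]
      exact hw
  rw [run_samplerP, eval_setupP_circuit, PMF.mem_support_bind_iff] at hr
  obtain ⟨r', hr', hr⟩ := hr
  rw [PMF.support_pure, Set.mem_singleton_iff] at hr
  have hloop : r'.2 ≤ n * (M ^ 1 * N ^ (k₂ + k₃ + 2 + 2 + 2) + 1) := by
    refine iterRun_support_le _ (fun j s => ∃ l : List Bool, l.length + j = n ∧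
      s = Q.samplerState l) _ ?_ n _ ⟨[], by simp, rfl⟩ r' hr'
    rintro j s ⟨l, hl, rfl⟩ t ht
    rw [run_drawBitP, PMF.mem_support_bind_iff] at ht
    obtain ⟨b, -, ht⟩ := ht
    rw [PMF.support_pure, Set.mem_singleton_iff, eval_updateP_samplerState] at ht
    rw [ht]
    refine ⟨⟨b :: l, by rw [List.length_cons]; omega, rfl⟩, ?_⟩
    have hc₂ : biasP.cost (Q.env, Q.samplerState l) ≤ M ^ 1 * N ^ k₂ := by
      refine h₂ N M _ hN2 hM1 ⟨henv, ?_⟩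
      change (Q.conditioned l).length + 1 + n ≤ M * N
      rw [length_conditioned]
      omega
    have hc₃ : updateP.cost ((Q.env, Q.samplerState l), b) ≤ M ^ 1 * N ^ k₃ :=
      h₃ N M _ hN2 hM1 henv
    have h4 := polyBound_add hN2 hM1 hc₂ hc₃
    have h5 := polyBound_add (l := 0) hN2 hM1 h4 (polyBound_pos 1 0 hN2 hM1)
    have h6 := polyBound_add (l := 0) hN2 hM1 h5 (polyBound_pos 1 0 hN2 hM1)
    simp only
    omega
  have hnN : n ≤ M ^ 0 * N := by rw [pow_zero, one_mul]; omega
  have h7 := polyBound_loop hN2 hM1 (le_refl (M ^ 1 * N ^ (k₂ + k₃ + 2 + 2 + 2))) hnN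
  rw [Nat.zero_add] at h7
  have h8 := polyBound_add hN2 hM1 hc₁ h7
  have h9 := polyBound_add (l := 0) hN2 hM1 h8 (polyBound_pos 1 0 hN2 hM1)
  have h10 := polyBound_add (l := 0) hN2 hM1 h9 (polyBound_pos 1 0 hN2 hM1)
  rw [pow_one] at h10
  refine le_trans ?_ h10
  rw [hr]
  simp only
  rw [pow_one] at hloop
  omega

theorem exists_runsInTime : ∃ c : ℕ, ∀ (n p : ℕ) (Q : QAOA n p), 0 < n → 0 < p →
    RunsInTime samplerP Q
      (((Q.terms.length : ℝ) + 1) * (((n : ℝ) * p) ^ c * Real.exp ((c : ℝ) * p))) := by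
  obtain ⟨k, hk⟩ := exists_cost_le
  -- From 4 ≤ e^2 and 2(p + 2) ≤ 6p for p ≥ 1.
  refine ⟨6 * k, fun n p Q hn hp r hr => ?_⟩
  have h1 : (r.2 : ℝ) ≤ ((Q.terms.length : ℝ) + 1) * ((n : ℝ) * 4 ^ (p + 2)) ^ k := by
    exact_mod_cast hk n p Q hn r hr
  refine h1.trans (mul_le_mul_of_nonneg_left ?_ (by positivity))
  have hn1 : (1 : ℝ) ≤ n := by exact_mod_cast hn
  have hp1 : (1 : ℝ) ≤ p := by exact_mod_cast hp
  have hnp : (1 : ℝ) ≤ (n : ℝ) * p := by nlinarith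
  have he : (4 : ℝ) ≤ Real.exp 2 := by
    have h := Real.add_one_le_exp (1 : ℝ)
    have : Real.exp 2 = Real.exp 1 * Real.exp 1 := by rw [← Real.exp_add]; norm_num
    nlinarith
  have h4 : (4 : ℝ) ^ (p + 2) ≤ Real.exp (6 * p) := by
    calc (4 : ℝ) ^ (p + 2) ≤ Real.exp 2 ^ (p + 2) := by gcongr
      _ = Real.exp ((p + 2 : ℕ) * 2) := by rw [← Real.exp_nat_mul]
      _ ≤ Real.exp (6 * p) := by
        apply Real.exp_le_exp.2
        push_cast
        linarith
  calc ((n : ℝ) * 4 ^ (p + 2)) ^ k ≤ ((n : ℝ) * p * Real.exp (6 * p)) ^ k := by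
        gcongr
        nlinarith
    _ = ((n : ℝ) * p) ^ k * Real.exp (((6 * k : ℕ) : ℝ) * p) := by
        rw [mul_pow, ← Real.exp_nat_mul]
        congr 2
        push_cast
        ring
    _ ≤ _ := by
        gcongr
        omega

end QAOA

/-! ### Polynomially many terms and logarithmic depth -/

theorem RunsInTime.mono {A : Prog circuitTy (.list .bool)} {n p : ℕ} {Q : QAOA n p} {T T' : ℝ}
    (h : RunsInTime A Q T) (hT : T ≤ T') : RunsInTime A Q T' := fun r hr => (h r hr).trans hT

/-- Since p ≥ 1, the constant K + 1 is absorbed by exp((K+1)p), and n^K by a power of np. Thus no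
multiplicative constant is left over. -/
theorem poly_terms_bound {n p K c m : ℕ} (hn : 0 < n) (hp : 0 < p) (hm : m ≤ K * n ^ K) :
    ((m : ℝ) + 1) * (((n : ℝ) * p) ^ c * Real.exp ((c : ℝ) * p))
      ≤ ((n : ℝ) * p) ^ (c + K + 1) * Real.exp (((c + K + 1 : ℕ) : ℝ) * p) := by
  have hn1 : (1 : ℝ) ≤ n := by exact_mod_cast hn
  have hp1 : (1 : ℝ) ≤ p := by exact_mod_cast hp
  have hnp : (1 : ℝ) ≤ (n : ℝ) * p := by nlinarith
  have hnK : (1 : ℝ) ≤ (n : ℝ) ^ K := one_le_pow₀ hn1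
  have h1 : (m : ℝ) + 1 ≤ ((K : ℝ) + 1) * (n : ℝ) ^ K := by
    have : (m : ℝ) ≤ (K : ℝ) * (n : ℝ) ^ K := by exact_mod_cast hm
    linarith
  have h2 : (K : ℝ) + 1 ≤ Real.exp (((K + 1 : ℕ) : ℝ) * p) := by
    have := Real.add_one_le_exp (((K + 1 : ℕ) : ℝ) * p)
    push_cast at this ⊢
    nlinarith [(Nat.cast_nonneg K : (0 : ℝ) ≤ K)]
  have h3 : (n : ℝ) ^ K ≤ ((n : ℝ) * p) ^ (K + 1) := by
    calc (n : ℝ) ^ K ≤ ((n : ℝ) * p) ^ K := by gcongr; nlinarith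
      _ ≤ ((n : ℝ) * p) ^ (K + 1) := pow_le_pow_right₀ hnp (Nat.le_succ K)
  calc ((m : ℝ) + 1) * (((n : ℝ) * p) ^ c * Real.exp ((c : ℝ) * p))
      ≤ (Real.exp (((K + 1 : ℕ) : ℝ) * p) * ((n : ℝ) * p) ^ (K + 1)) *
          (((n : ℝ) * p) ^ c * Real.exp ((c : ℝ) * p)) := by
        gcongr
        exact h1.trans (by gcongr)
    _ = ((n : ℝ) * p) ^ (c + K + 1) *
          (Real.exp ((c : ℝ) * p) * Real.exp (((K + 1 : ℕ) : ℝ) * p)) := by ring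
    _ = _ := by
        rw [← Real.exp_add]
        congr 2
        push_cast
        ring

/-- At logarithmic depth the running time is polynomial in the number of qubits. -/
theorem exists_log_depth_bound (c : ℕ) (depth : ℕ → ℕ)
    (h : (fun n : ℕ => (depth n : ℝ)) =O[Filter.atTop] fun n : ℕ => Real.log n) :
    ∃ d : ℕ, ∀ n : ℕ, 0 < n →
      ((n : ℝ) * depth n) ^ c * Real.exp ((c : ℝ) * depth n) ≤ (d : ℝ) * (n : ℝ) ^ d := by
  obtain ⟨C, hC⟩ := h.bound
  obtain ⟨n₀, hn₀⟩ := Filter.eventually_atTop.1 hC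
  obtain ⟨C', hC'⟩ := exists_nat_ge C
  -- Below the threshold `n₀` the asymptotic hypothesis says nothing. These finitely many depths are
  -- bounded by their maximum, and `A` absorbs the resulting constant.
  set P := (Finset.range n₀).sup depth with hP
  obtain ⟨A, hA⟩ := exists_nat_ge (Real.exp (2 * c * P))
  -- One number serves as exponent and as coefficient: c from n^c, 2cC' from the exponential of a
  -- multiple of log n, 1 to keep the coefficient positive, and A for small n.
  refine ⟨c + 2 * c * C' + 1 + A, fun n hn => ?_⟩
  have hn1 : (1 : ℝ) ≤ n := by exact_mod_cast hn
  have h1 : ((n : ℝ) * depth n) ^ c * Real.exp ((c : ℝ) * depth n)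
      ≤ (n : ℝ) ^ c * Real.exp (2 * c * depth n) := by
    have hd : (depth n : ℝ) ≤ Real.exp (depth n) :=
      (le_add_of_nonneg_right zero_le_one).trans (Real.add_one_le_exp _)
    have hd' : (depth n : ℝ) ^ c ≤ Real.exp ((c : ℝ) * depth n) := by
      rw [Real.exp_nat_mul]
      gcongr
    have he : Real.exp (2 * c * depth n)
        = Real.exp ((c : ℝ) * depth n) * Real.exp ((c : ℝ) * depth n) := by
      rw [← Real.exp_add]
      congr 1
      ring
    rw [mul_pow, he, mul_assoc]
    gcongr
  refine h1.trans ?_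
  by_cases hlt : n < n₀
  · have hdP : depth n ≤ P := Finset.le_sup (f := depth) (Finset.mem_range.2 hlt)
    have h2 : Real.exp (2 * c * depth n) ≤ A := by
      refine le_trans (Real.exp_le_exp.2 ?_) hA
      gcongr
    calc (n : ℝ) ^ c * Real.exp (2 * c * depth n) ≤ (n : ℝ) ^ c * A := by gcongr
      _ = A * (n : ℝ) ^ c := mul_comm _ _
      _ ≤ ((c + 2 * c * C' + 1 + A : ℕ) : ℝ) * (n : ℝ) ^ (c + 2 * c * C' + 1 + A) := by
        gcongr
        · omega
        · omega
  · have hb := hn₀ n (not_lt.1 hlt)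
    have hlog : 0 ≤ Real.log n := Real.log_nonneg hn1
    rw [Real.norm_of_nonneg (Nat.cast_nonneg _), Real.norm_of_nonneg hlog] at hb
    have hb' : (depth n : ℝ) ≤ C' * Real.log n :=
      hb.trans (mul_le_mul_of_nonneg_right hC' hlog)
    have h2 : Real.exp (2 * c * depth n) ≤ (n : ℝ) ^ (2 * c * C') := by
      rw [← Real.exp_log (show (0 : ℝ) < (n : ℝ) ^ (2 * c * C') by positivity), Real.log_pow]
      apply Real.exp_le_exp.2
      push_cast
      calc 2 * (c : ℝ) * depth n ≤ 2 * c * (C' * Real.log n) := by gcongr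
        _ = 2 * c * C' * Real.log n := by ring
    calc (n : ℝ) ^ c * Real.exp (2 * c * depth n) ≤ (n : ℝ) ^ c * (n : ℝ) ^ (2 * c * C') := by
          gcongr
      _ = 1 * (n : ℝ) ^ (c + 2 * c * C') := by rw [pow_add, one_mul]
      _ ≤ ((c + 2 * c * C' + 1 + A : ℕ) : ℝ) * (n : ℝ) ^ (c + 2 * c * C' + 1 + A) := by
        refine mul_le_mul ?_ (pow_le_pow_right₀ hn1 (by omega)) (by positivity) (by positivity)
        exact_mod_cast (by omega : 1 ≤ c + 2 * c * C' + 1 + A)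

/-- One program samples exactly from every degree-at-most-2 QAOA circuit.  The number of listed
terms enters its running time only as a factor; it is polynomial in `n` for decompositions with
at most polynomially many terms (e.g. one term per pair of variables). -/
theorem corollary4p4 :
    ∃ A : Prog circuitTy (.list .bool),
      (∀ (n p : ℕ) (Q : QAOA n p), 0 < n → 0 < p → Q.interactionDegree ≤ 2 →
        SamplesExactly A Q) ∧
      (∃ c : ℕ, ∀ (n p : ℕ) (Q : QAOA n p), 0 < n → 0 < p → Q.interactionDegree ≤ 2 →
        RunsInTime A Q
          (((Q.terms.length : ℝ) + 1) * (((n : ℝ) * p) ^ c * Real.exp ((c : ℝ) * p)))) ∧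
      (∀ K : ℕ, ∃ c : ℕ, ∀ (n p : ℕ) (Q : QAOA n p), 0 < n → 0 < p →
        Q.interactionDegree ≤ 2 → Q.terms.length ≤ K * n ^ K →
        RunsInTime A Q (((n : ℝ) * p) ^ c * Real.exp ((c : ℝ) * p))) ∧
      (∀ (K : ℕ) (depth : ℕ → ℕ),
        ((fun n : ℕ => (depth n : ℝ)) =O[Filter.atTop] fun n : ℕ => Real.log n) →
        ∃ d : ℕ, ∀ (n : ℕ) (Q : QAOA n (depth n)), 0 < n → 0 < depth n →
          Q.interactionDegree ≤ 2 → Q.terms.length ≤ K * n ^ K →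
          RunsInTime A Q ((d : ℝ) * (n : ℝ) ^ d)) := by
  obtain ⟨c, hc⟩ := QAOA.exists_runsInTime
  refine ⟨Prog.samplerP, fun n p Q _ _ hQ => QAOA.samplesExactly hQ,
    ⟨c, fun n p Q hn hp _ => hc n p Q hn hp⟩,
    fun K => ⟨c + K + 1, fun n p Q hn hp _ hm => (hc n p Q hn hp).mono (poly_terms_bound hn hp hm)⟩,
    fun K depth h => ?_⟩
  obtain ⟨d, hd⟩ := exists_log_depth_bound (c + K + 1) depth h
  exact ⟨d, fun n Q hn hp _ hm =>
    (hc n (depth n) Q hn hp).mono ((poly_terms_bound hn hp hm).trans (hd n hn))⟩
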